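/- Let $J:\mathbb R\to[0,\infty)$ be of class $C^2$ with $J(0)=0$, $J>0$ on $(0,\infty)$, $J'>0$ on $(0,1]$ and $J''>0$ on $(0,\rho_0)$ for some $\rho_0>0$. For $R>1$ set $$I(R)=\sup\Big\{\int_1^R\frac{1-f^2}{r}\,dr \;:\; \int_1^R J(1-f^2)\,r\,dr\le 1\Big\},$$ the supremum being over measurable functions $f$ for which both integrals exist. Let $p_0>0$, $a>0$, $K\in\mathbb R$ and integers $m,d\ge 0$ be given. Then there is a constant $C$, depending only on $J,p_0,a,d,m,K$, with the following property. Let $R_0>0$ and $R$ satisfy $R_0\le R/4$, and let $a_1,\dots,a_m\in\mathbb C$ satisfy $|a_i-a_j|\ge 4R_0$ for $i\ne j$ and $|a_i|\le R/2$ for all $i$. Set $\Omega=B_R(0)\setminus\bigcup_{j=1}^m\overline{B_{R_0}(a_j)}$, where $B_r(x)$ is the open disc. Let $d_1,\dots,d_m$ be integers with $\sum_j|d_j|=d$, and let $u:\overline\Omega\to\mathbb C$ be continuous on $\overline\Omega$ and $C^1$ in $\Omega$, with $$0<a\le|u|\le1\ \text{ in }\Omega,\qquad \deg(u,\partial B_{R_0}(a_j))=d_j\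 \ \forall j,\qquad \frac1{R_0^2}\int_\Omega J(1-|u|^2)\le K.$$ Let $p$ be a measurable weight on $\Omega$ with $p\ge p_0$ in $\Omega$ (for instance, a smooth positive function $p$ on $\overline G$, where $G\supset\Omega$ is a bounded domain, with $p_0=\min_{\overline G}p$). Let $$u_0(z)=\prod_{j=1}^m\Big(\frac{z-a_j}{|z-a_j|}\Big)^{d_j}.$$ Then $\int_\Omega|\nabla u_0|^2<\infty$ and $$\int_\Omega p|\nabla u|^2\ \ge\ p_0\int_\Omega|\nabla u_0|^2-2\pi p_0\Big(\sum_{i=1}^m d_i^2\Big)I\Big(\frac R{R_0}\Big)-2\pi(1-a^2)p_0\sum_{i\ne j}|d_i||d_j|\log\frac{R}{|a_i-a_j|}-C,$$ where the last sum runs over ordered pairs and the left-hand side may be $+\infty$. -/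

import Mathlib

namespace GinzburgLandau

/-- The standing assumptions on the potential `J : ℝ → [0, ∞)`: it is of class `C²`, vanishes at `0`,
is positive on `(0, ∞)`, has positive derivative on `(0, 1]` and positive second derivative on
some interval `(0, ρ₀)`. -/
structure IsPotential (J : ℝ → ℝ) : Prop where
  contDiff : ContDiff ℝ 2 J
  nonneg : ∀ t, 0 ≤ J t
  map_zero : J 0 = 0
  pos : ∀ t, 0 < t → 0 < J t
  deriv_pos : ∀ t, 0 < t → t ≤ 1 → 0 < deriv J t
  deriv_two_pos : ∃ ρ₀ : ℝ, 0 < ρ₀ ∧ ∀ t, 0 < t → t < ρ₀ → 0 < iteratedDeriv 2 J t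

/-- The quantity
`I(R, c) = sup { ∫₁ᴿ (1 - f²) / r dr : ∫₁ᴿ J(1 - f²) r dr ≤ c }`,
the supremum being over the measurable functions `f` for which both integrals exist. -/
noncomputable def vortexI (J : ℝ → ℝ) (R c : ℝ) : ℝ :=
  sSup {s : ℝ | ∃ f : ℝ → ℝ, Measurable f ∧
    IntervalIntegrable (fun r => (1 - f r ^ 2) / r) MeasureTheory.volume 1 R ∧
    IntervalIntegrable (fun r => J (1 - f r ^ 2) * r) MeasureTheory.volume 1 R ∧
    (∫ r in (1 : ℝ)..R, J (1 - f r ^ 2) * r) ≤ c ∧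
    s = ∫ r in (1 : ℝ)..R, (1 - f r ^ 2) / r}

/-- The perforated disc `B_R(0) \ ⋃ⱼ B_{R₀}(aⱼ)`, as an open set. -/
def perforatedDisc {m : ℕ} (R R₀ : ℝ) (pt : Fin m → ℂ) : Set ℂ :=
  Metric.ball 0 R \ ⋃ j, Metric.closedBall (pt j) R₀

/-- `|∇u|² = |∂u/∂x|² + |∂u/∂y|²`. -/
noncomputable def gradSq (u : ℂ → ℂ) (z : ℂ) : ℝ :=
  ‖fderiv ℝ u z 1‖ ^ 2 + ‖fderiv ℝ u z Complex.I‖ ^ 2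

/-- `u` has no zero on the circle of centre `c` and radius `r`, and its degree on this circle,
positively oriented, is `d`: a continuous choice of the argument of `u` increases by `2πd` along
the circle. -/
def HasDegreeOnCircle (u : ℂ → ℂ) (c : ℂ) (r : ℝ) (d : ℤ) : Prop :=
  (∀ θ : ℝ, u (circleMap c r θ) ≠ 0) ∧
  ∃ φ : ℝ → ℝ, Continuous φ ∧
    (∀ θ : ℝ, u (circleMap c r θ) =
      (‖u (circleMap c r θ)‖ : ℂ) * Complex.exp ((φ θ : ℂ) * Complex.I)) ∧
    φ (2 * Real.pi) - φ 0 = 2 * Real.pi * (d : ℝ)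

/-- The canonical map `u₀(z) = ∏ⱼ ((z - aⱼ) / |z - aⱼ|) ^ dⱼ`. -/
noncomputable def canonicalMap {m : ℕ} (pt : Fin m → ℂ) (deg : Fin m → ℤ) (z : ℂ) : ℂ :=
  ∏ j, ((z - pt j) / (‖z - pt j‖ : ℂ)) ^ deg j

end GinzburgLandau

/-! Put t = 1 - |u|², E_j = 1/(z - a_j) and F = ∑ d_j E_j. Up to a fixed reflection, F is the phase
gradient of u₀; let F + G be that of u. Dropping the radial part of the gradient gives |∇u|² ≥ (1 -
t)|F + G|². After expansion, (1 - t)|G|² ≥ a²|G|² is available, t|F|² is lost, and the difficulty is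
the cross term 2(1 - t) F·G, since t is an arbitrary function.

The closed form behind G has no circulation around any hole. It is therefore orthogonal to dh for
every C² function h that is constant near each boundary component
(`setIntegral_wedgeArg_sub_eq_zero`). If t is replaced by a radial profile T_j = T(|z - a_j|/R₀),
then (1 - T_j) E_j is the reflected gradient of a radial function. Cutting that function off near
the boundary costs only bounded energy (`exists_streamFunction`). The remaining part of the cross
term carries the factor t - T_j, and Young's inequality against a²|G|² turns it into M ∑ d_j² |E_j|²
(t - T_j)² with M = 2m/a², plus the cutoff error (`pointwise_energy_bound`).

What is left on the diagonal is |E_j|² (t + M (t - T_j)²). The profile has to make this at most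
g(r)/r² plus a multiple of J(t), with r = |z - a_j|/R₀ and ∫ g/r ≤ I + C (`exists_profile`). The
Euler–Lagrange equation of the problem defining I reads J'(T) = const/r²; T solves it at dyadic
radii, and convexity of J near 0 gives the pointwise inequality. The J term is then paid for by the
bound K.

Off the diagonal t ≤ 1 - a², and ∫ |E_i||E_j| ≤ 2π log(R/|a_i - a_j|) + 12π
(`setIntegral_inv_norm_mul_inv_norm_le`). Since |∇u|² need not be integrable, all this is stored in
an integrable minorant (`exists_integrable_minorant`), and the weight p enters only at the end. -/

namespace GinzburgLandau

open MeasureTheory Set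

/-! ### The potential near zero: convexity. -/

namespace IsPotential

variable {J : ℝ → ℝ}

lemma continuous_deriv (hJ : IsPotential J) : Continuous (deriv J) :=
  hJ.contDiff.continuous_deriv (by norm_num)

lemma differentiable (hJ : IsPotential J) : Differentiable ℝ J :=
  hJ.contDiff.differentiable (by norm_num)

lemma deriv_zero (hJ : IsPotential J) : deriv J 0 = 0 := by
  apply IsLocalMin.deriv_eq_zero
  filter_upwards with t
  rw [hJ.map_zero]; exact hJ.nonneg t

lemma monotoneOn (hJ : IsPotential J) : MonotoneOn J (Icc 0 1) := by
  apply monotoneOn_of_deriv_nonneg (convex_Icc 0 1) hJ.differentiable.continuous.continuousOn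
    hJ.differentiable.differentiableOn
  intro x hx
  rw [interior_Icc] at hx
  exact (hJ.deriv_pos x hx.1 hx.2.le).le

lemma strictMonoOn_deriv {δ : ℝ} (hJ : IsPotential J)
    (hδ : ∀ t, 0 < t → t < δ → 0 < iteratedDeriv 2 J t) : StrictMonoOn (deriv J) (Icc 0 δ) := by
  apply strictMonoOn_of_deriv_pos (convex_Icc 0 δ) hJ.continuous_deriv.continuousOn
  intro x hx
  rw [interior_Icc] at hx
  have := hδ x hx.1 hx.2
  rwa [iteratedDeriv_succ, iteratedDeriv_one] at this

/-- Tangent-line inequalities of a convex function. The first makes the potential dominate a linear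
function beyond a point of known slope; the second bounds the potential from above in the
constraint. -/
lemma sub_bounds {δ : ℝ} (hJ : IsPotential J) (hmono : StrictMonoOn (deriv J) (Icc 0 δ))
    {x y : ℝ} (hx : 0 ≤ x) (hxy : x ≤ y) (hy : y ≤ δ) :
    deriv J x * (y - x) ≤ J y - J x ∧ J y - J x ≤ deriv J y * (y - x) := by
  rcases hxy.eq_or_lt with rfl | hlt
  · simp
  obtain ⟨c, hc, hceq⟩ := exists_deriv_eq_slope J hlt hJ.differentiable.continuous.continuousOn
    hJ.differentiable.differentiableOn
  have hpos : 0 < y - x := sub_pos.2 hlt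
  rw [eq_div_iff hpos.ne'] at hceq
  have hcm : c ∈ Icc 0 δ := ⟨hx.trans hc.1.le, hc.2.le.trans hy⟩
  have h1 : deriv J x ≤ deriv J c := (hmono.le_iff_le ⟨hx, hxy.trans hy⟩ hcm).2 hc.1.le
  have h2 : deriv J c ≤ deriv J y := (hmono.le_iff_le hcm ⟨hx.trans hxy, hy⟩).2 hc.2.le
  rw [← hceq]
  exact ⟨by gcongr, by gcongr⟩

/-- Points at which the derivative of the potential takes geometrically decreasing values. -/
lemma exists_dyadic_points (hJ : IsPotential J) {M : ℝ} :
    ∃ (δ σ : ℝ) (τ : ℕ → ℝ), 0 < δ ∧ δ ≤ 1 ∧ M * δ ≤ 1 ∧ 0 < σ ∧ σ ≤ 1 / 4 ∧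
      StrictMonoOn (deriv J) (Icc 0 δ) ∧
      (∀ k, τ k ∈ Icc 0 δ) ∧ (∀ k, deriv J (τ k) = σ / 4 ^ k) ∧ Antitone τ := by
  obtain ⟨ρ₀, hρ₀, hρ⟩ := hJ.deriv_two_pos
  -- A slope at most 1/4 keeps the constraint integral of the profile below 1. The bound on `M * δ`
  -- makes M s² ≤ s for 0 ≤ s ≤ δ.
  have h1 : ∀ᶠ δ in nhdsWithin (0 : ℝ) (Ioi 0), deriv J δ < 1 / 4 := by
    have := hJ.continuous_deriv.tendsto 0
    rw [hJ.deriv_zero] at this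
    exact (this.mono_left nhdsWithin_le_nhds).eventually_lt_const (by norm_num)
  have h2 : ∀ᶠ δ in nhdsWithin (0 : ℝ) (Ioi 0), M * δ < 1 := by
    have : Filter.Tendsto (fun δ : ℝ => M * δ) (nhds 0) (nhds (M * 0)) :=
      (continuous_const.mul continuous_id).tendsto 0
    rw [mul_zero] at this
    exact (this.mono_left nhdsWithin_le_nhds).eventually_lt_const (by norm_num)
  have h3 : ∀ᶠ δ in nhdsWithin (0 : ℝ) (Ioi 0), δ ∈ Ioo 0 (min 1 ρ₀) :=
    Ioo_mem_nhdsGT (by positivity)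
  obtain ⟨δ, h1, h2, h3⟩ := (h1.and (h2.and h3)).exists
  have hδ1 : δ < 1 := h3.2.trans_le (min_le_left _ _)
  have hδρ : δ < ρ₀ := h3.2.trans_le (min_le_right _ _)
  have hmono := hJ.strictMonoOn_deriv (δ := δ) fun t h0 h1 => hρ t h0 (h1.trans hδρ)
  have hσ : 0 < deriv J δ := hJ.deriv_pos δ h3.1 hδ1.le
  -- This is the Euler–Lagrange equation J'(T) = const/r² at r = 2^k.
  have hex : ∀ k : ℕ, ∃ x ∈ Icc 0 δ, deriv J x = deriv J δ / 4 ^ k := by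
    intro k
    apply intermediate_value_Icc h3.1.le hJ.continuous_deriv.continuousOn
    rw [hJ.deriv_zero]
    refine ⟨by positivity, div_le_self hσ.le (one_le_pow₀ (by norm_num))⟩
  choose τ hτ1 hτ2 using hex
  refine ⟨δ, deriv J δ, τ, h3.1, hδ1.le, h2.le, hσ, h1.le, hmono, hτ1, hτ2, ?_⟩
  intro k l hkl
  rw [← hmono.le_iff_le (hτ1 l) (hτ1 k), hτ2, hτ2]
  gcongr
  norm_num

end IsPotential

/-! ### The dyadic radial profile. -/

/-- A smooth function of `log₂ r` that decreases from `τ k` to `τ (k + 1)` on `[2 ^ k, 2 ^ (k + 1)]`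
for `k < N`. -/
noncomputable def dyadicProfile (τ : ℕ → ℝ) (N : ℕ) (r : ℝ) : ℝ :=
  τ 0 - ∑ k ∈ Finset.range N, (τ k - τ (k + 1)) * Real.smoothTransition (Real.logb 2 r - k)

section dyadicProfile

variable {τ : ℕ → ℝ} {N : ℕ}

lemma contDiffOn_dyadicProfile : ContDiffOn ℝ 2 (dyadicProfile τ N) (Ioi 0) := by
  unfold dyadicProfile
  refine contDiffOn_const.sub (ContDiffOn.sum fun k _ => contDiffOn_const.mul ?_)
  apply Real.smoothTransition.contDiff.comp_contDiffOn
  unfold Real.logb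
  refine (ContDiffOn.div_const ?_ _).sub contDiffOn_const
  exact Real.contDiffOn_log.mono fun x hx => (ne_of_gt hx)

lemma dyadicProfile_le (hτ : Antitone τ) {k : ℕ} (hk : k ≤ N) {r : ℝ} (hr : 2 ^ k ≤ r) :
    dyadicProfile τ N r ≤ τ k := by
  have hL : (k : ℝ) ≤ Real.logb 2 r := by
    rw [Real.le_logb_iff_rpow_le (by norm_num) (lt_of_lt_of_le (by positivity) hr)]
    simpa using hr
  -- The first k transitions are complete once r ≥ 2^k, and the later ones can only lower the
  -- profile; the completed drops telescope.
  have h1 : ∑ l ∈ Finset.range k, (τ l - τ (l + 1)) ≤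
      ∑ l ∈ Finset.range N, (τ l - τ (l + 1)) * Real.smoothTransition (Real.logb 2 r - l) := by
    rw [← Finset.sum_range_add_sum_Ico _ hk]
    have : 0 ≤ ∑ l ∈ Finset.Ico k N,
        (τ l - τ (l + 1)) * Real.smoothTransition (Real.logb 2 r - l) :=
      Finset.sum_nonneg fun l _ => mul_nonneg (sub_nonneg.2 (hτ (Nat.le_succ l)))
        (Real.smoothTransition.nonneg _)
    refine le_trans (Finset.sum_le_sum fun l hl => ?_) (le_add_of_nonneg_right this)
    rw [Real.smoothTransition.one_of_one_le, mul_one]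
    have : (l : ℝ) + 1 ≤ k := by exact_mod_cast Finset.mem_range.1 hl
    linarith
  rw [Finset.sum_range_sub'] at h1
  unfold dyadicProfile
  linarith

lemma le_dyadicProfile (hτ : Antitone τ) {k : ℕ} (hk : k ≤ N) {r : ℝ} (hr0 : 0 < r)
    (hr : r ≤ 2 ^ k) : τ k ≤ dyadicProfile τ N r := by
  have hL : Real.logb 2 r ≤ (k : ℝ) := by
    rw [Real.logb_le_iff_le_rpow (by norm_num) hr0]
    simpa using hr
  have h1 : ∑ l ∈ Finset.range N, (τ l - τ (l + 1)) * Real.smoothTransition (Real.logb 2 r - l) ≤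
      ∑ l ∈ Finset.range k, (τ l - τ (l + 1)) := by
    rw [← Finset.sum_range_add_sum_Ico _ hk]
    have : ∑ l ∈ Finset.Ico k N,
        (τ l - τ (l + 1)) * Real.smoothTransition (Real.logb 2 r - l) = 0 := by
      refine Finset.sum_eq_zero fun l hl => ?_
      rw [Real.smoothTransition.zero_of_nonpos, mul_zero]
      have : (k : ℝ) ≤ l := by exact_mod_cast (Finset.mem_Ico.1 hl).1
      linarith
    rw [this, add_zero]
    exact Finset.sum_le_sum fun l _ => mul_le_of_le_one_right (sub_nonneg.2 (hτ (Nat.le_succ l)))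
      (Real.smoothTransition.le_one _)
  rw [Finset.sum_range_sub'] at h1
  unfold dyadicProfile
  linarith

lemma dyadicProfile_le_zero (hτ : Antitone τ) (r : ℝ) : dyadicProfile τ N r ≤ τ 0 :=
  sub_le_self _ <| Finset.sum_nonneg fun l _ => mul_nonneg (sub_nonneg.2 (hτ (Nat.le_succ l)))
    (Real.smoothTransition.nonneg _)

lemma last_le_dyadicProfile (hτ : Antitone τ) (r : ℝ) : τ N ≤ dyadicProfile τ N r := by
  have : ∑ l ∈ Finset.range N, (τ l - τ (l + 1)) * Real.smoothTransition (Real.logb 2 r - l) ≤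
      ∑ l ∈ Finset.range N, (τ l - τ (l + 1)) :=
    Finset.sum_le_sum fun l _ => mul_le_of_le_one_right (sub_nonneg.2 (hτ (Nat.le_succ l)))
      (Real.smoothTransition.le_one _)
  rw [Finset.sum_range_sub'] at this
  unfold dyadicProfile
  linarith

end dyadicProfile

lemma exists_dyadic_interval {N : ℕ} {r : ℝ} (h1 : 1 ≤ r) (hN : r < 2 ^ N) :
    ∃ k < N, 2 ^ k ≤ r ∧ r ≤ 2 ^ (k + 1) := by
  obtain ⟨k, hk1, hk2⟩ := exists_nat_pow_near h1 (one_lt_two : (1 : ℝ) < 2)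
  refine ⟨k, ?_, hk1, hk2.le⟩
  by_contra! h
  exact absurd (hN.trans_le ((pow_le_pow_right₀ one_le_two h).trans hk1)) (lt_irrefl _)

/-- The potential of the dyadic profile has small weighted integral. -/
lemma integral_potential_dyadicProfile_le {J : ℝ → ℝ} (hJ : IsPotential J) {δ σ : ℝ} {τ : ℕ → ℝ}
    (hδ1 : δ ≤ 1) (hσ : 0 < σ) (hσ1 : σ ≤ 1 / 4)
    (hmono : StrictMonoOn (deriv J) (Icc 0 δ)) (hτ : ∀ k, τ k ∈ Icc 0 δ)
    (hJτ : ∀ k, deriv J (τ k) = σ / 4 ^ k) (hanti : Antitone τ) (N : ℕ) :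
    ∫ r in (1 : ℝ)..2 ^ N, J (dyadicProfile τ N r) * r ≤ 1 := by
  have hcont : ContinuousOn (fun r => J (dyadicProfile τ N r) * r) (Ioi 0) :=
    (hJ.contDiff.continuous.comp_continuousOn contDiffOn_dyadicProfile.continuousOn).mul
      continuousOn_id
  have hint : ∀ {x y : ℝ}, 0 < x → x ≤ y →
      IntervalIntegrable (fun r => J (dyadicProfile τ N r) * r) volume x y := by
    intro x y hx hxy
    apply ContinuousOn.intervalIntegrable
    rw [uIcc_of_le hxy]
    exact hcont.mono fun z hz => hx.trans_le hz.1
  have hsum := intervalIntegral.sum_integral_adjacent_intervals (n := N)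
    (a := fun k : ℕ => (2 : ℝ) ^ k) (μ := volume) (f := fun r => J (dyadicProfile τ N r) * r)
    (fun k _ => hint (by positivity) (pow_le_pow_right₀ one_le_two (Nat.le_succ k)))
  rw [pow_zero] at hsum
  rw [← hsum]
  -- The factor 4^k cancels the slope σ/4^k. What remains is a telescoping term plus a quarter of
  -- the next summand, so the total is bounded independently of N.
  have hQ : ∀ k, 4 ^ k * J (τ k) ≤ σ * (τ k - τ (k + 1)) + 4 ^ (k + 1) * J (τ (k + 1)) / 4 := by
    intro k
    have := (hJ.sub_bounds hmono (hτ (k + 1)).1 (hanti (Nat.le_succ k)) (hτ k).2).2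
    rw [hJτ] at this
    have h4 : (0 : ℝ) < 4 ^ k := by positivity
    have h5 : (4 : ℝ) ^ k * (J (τ k) - J (τ (k + 1))) ≤
        4 ^ k * (σ / 4 ^ k * (τ k - τ (k + 1))) := by gcongr
    have h6 : (4 : ℝ) ^ k * (σ / 4 ^ k * (τ k - τ (k + 1))) = σ * (τ k - τ (k + 1)) := by
      field_simp
    rw [pow_succ]
    linarith
  have hQN : 4 ^ N * J (τ N) ≤ σ * τ N := by
    have := (hJ.sub_bounds hmono le_rfl (hτ N).1 (hτ N).2).2
    rw [hJτ, hJ.map_zero, sub_zero, sub_zero] at this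
    have h4 : (0 : ℝ) < 4 ^ N := by positivity
    calc 4 ^ N * J (τ N) ≤ 4 ^ N * (σ / 4 ^ N * τ N) := by gcongr
      _ = σ * τ N := by field_simp
  have hQsum : ∑ k ∈ Finset.range N, 4 ^ k * J (τ k) ≤ 4 / 3 * σ * τ 0 := by
    have h1 := Finset.sum_le_sum fun k (_ : k ∈ Finset.range N) => hQ k
    rw [Finset.sum_add_distrib, ← Finset.mul_sum, Finset.sum_range_sub', ← Finset.sum_div] at h1
    have h2 := Finset.sum_range_succ' (fun k => 4 ^ k * J (τ k)) N
    rw [Finset.sum_range_succ] at h2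
    have h3 := hJ.nonneg (τ 0)
    simp only [pow_zero, one_mul] at h2
    have h4 : 0 ≤ σ * τ N := mul_nonneg hσ.le (hτ N).1
    linarith
  have hpiece : ∀ k ∈ Finset.range N, ∫ r in (2 : ℝ) ^ k..2 ^ (k + 1),
      J (dyadicProfile τ N r) * r ≤ 2 * (4 ^ k * J (τ k)) := by
    intro k hk
    have hkN := Finset.mem_range.1 hk
    have hle : (2 : ℝ) ^ k ≤ 2 ^ (k + 1) := pow_le_pow_right₀ one_le_two (Nat.le_succ k)
    have hpow : (2 : ℝ) ^ k * 2 ^ k = 4 ^ k := by rw [← mul_pow]; norm_num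
    calc ∫ r in (2 : ℝ) ^ k..2 ^ (k + 1), J (dyadicProfile τ N r) * r
        ≤ ∫ _r in (2 : ℝ) ^ k..2 ^ (k + 1), J (τ k) * 2 ^ (k + 1) := by
          apply intervalIntegral.integral_mono_on hle (hint (by positivity) hle)
            intervalIntegrable_const
          intro r hr
          have hr0 : 0 < r := lt_of_lt_of_le (by positivity) hr.1
          refine mul_le_mul (hJ.monotoneOn ?_ ?_ ?_) hr.2 hr0.le (hJ.nonneg _)
          · exact ⟨(hτ N).1.trans (last_le_dyadicProfile hanti r),
              (dyadicProfile_le_zero hanti r).trans ((hτ 0).2.trans hδ1)⟩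
          · exact ⟨(hτ k).1, (hτ k).2.trans hδ1⟩
          · exact dyadicProfile_le hanti hkN.le hr.1
      _ = 2 * (4 ^ k * J (τ k)) := by
          rw [intervalIntegral.integral_const, smul_eq_mul, ← hpow, pow_succ]; ring
  refine (Finset.sum_le_sum hpiece).trans ?_
  rw [← Finset.mul_sum]
  -- The whole integral is at most 2 · (4/3) · σ · τ 0 ≤ 2/3.
  have : σ * τ 0 ≤ 1 / 4 * 1 :=
    mul_le_mul hσ1 ((hτ 0).2.trans hδ1) (hτ 0).1 (by norm_num)
  linarith

/-- The function f = √(1 - T) is an admissible competitor. The values in the supremum are bounded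
above by ∫ 1/r, as a real `sSup` requires. -/
lemma integral_div_le_vortexI {J : ℝ → ℝ} {T : ℝ → ℝ} {R : ℝ} (hR : 1 ≤ R) (hTm : Measurable T)
    (hT1 : ∀ r, T r ≤ 1) (h1 : IntervalIntegrable (fun r => T r / r) volume 1 R)
    (h2 : IntervalIntegrable (fun r => J (T r) * r) volume 1 R)
    (h3 : ∫ r in (1 : ℝ)..R, J (T r) * r ≤ 1) :
    ∫ r in (1 : ℝ)..R, T r / r ≤ vortexI J R 1 := by
  apply le_csSup
  · refine ⟨∫ r in (1 : ℝ)..R, 1 / r, ?_⟩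
    rintro s ⟨f, -, hf, -, -, rfl⟩
    apply intervalIntegral.integral_mono_on hR hf
    · apply ContinuousOn.intervalIntegrable
      rw [uIcc_of_le hR]
      exact continuousOn_const.div continuousOn_id fun x hx => (zero_lt_one.trans_le hx.1).ne'
    · intro r hr
      have : 0 < r := zero_lt_one.trans_le hr.1
      gcongr
      nlinarith [sq_nonneg (f r)]
  · have hsq : ∀ r, 1 - Real.sqrt (1 - T r) ^ 2 = T r := fun r => by
      rw [Real.sq_sqrt (sub_nonneg.2 (hT1 r))]; ring
    refine ⟨fun r => Real.sqrt (1 - T r), (measurable_const.sub hTm).sqrt, ?_⟩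
    simp only [hsq]
    exact ⟨h1, h2, h3, trivial⟩

lemma measurable_dyadicProfile {τ : ℕ → ℝ} {N : ℕ} : Measurable (dyadicProfile τ N) := by
  unfold dyadicProfile Real.logb
  refine measurable_const.sub (Finset.measurable_sum _ fun k _ => measurable_const.mul ?_)
  exact Real.smoothTransition.continuous.measurable.comp
    ((Real.measurable_log.div_const _).sub_const _)

/-- Radial profiles for which the quadratic deviation is controlled by the potential, and whose
logarithmic integral is almost bounded by `vortexI`. -/
theorem exists_profile {J : ℝ → ℝ} (hJ : IsPotential J) {M : ℝ} (hM : 0 ≤ M) :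
    ∃ Λ C : ℝ, 0 ≤ Λ ∧ 0 ≤ C ∧ ∀ R : ℝ, 1 ≤ R → ∃ T g : ℝ → ℝ,
      ContDiffOn ℝ 2 T (Ioi 0) ∧ (∀ r, 0 ≤ T r ∧ T r ≤ 1) ∧ Measurable T ∧ Measurable g ∧
      ContinuousOn g (Ioi 0) ∧
      (∀ r ∈ Icc 1 (2 * R), 0 ≤ g r) ∧
      (∀ t ∈ Icc (0 : ℝ) 1, ∀ r ∈ Icc 1 (2 * R),
        t + M * (t - T r) ^ 2 ≤ g r + Λ * r ^ 2 * J t) ∧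
      ∫ r in (1 : ℝ)..2 * R, g r / r ≤ vortexI J R 1 + C := by
  obtain ⟨δ, σ, τ, hδ, hδ1, hMδ, hσ, hσ1, hmono, hτ, hJτ, hanti⟩ := hJ.exists_dyadic_points (M := M)
  have hJδ : 0 < J δ := hJ.pos δ hδ
  -- The first summand of Λ pays for t ≥ δ, the second for t between τ k and δ. The constant 5 log 2
  -- is log 2 from [R, 2R] plus twice the 2 log 2 from [1/2, 2].
  refine ⟨(1 + M) / J δ + 2 / σ, 5 * Real.log 2, by positivity, by positivity, ?_⟩
  intro R hR
  obtain ⟨N, hN⟩ := pow_unbounded_of_one_lt (2 * R) (one_lt_two : (1 : ℝ) < 2)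
  set T := dyadicProfile τ N with hTdef
  have hTδ : ∀ r, 0 ≤ T r ∧ T r ≤ δ := fun r =>
    ⟨(hτ N).1.trans (last_le_dyadicProfile hanti r), (dyadicProfile_le_zero hanti r).trans (hτ 0).2⟩
  have hT1 : ∀ r, 0 ≤ T r ∧ T r ≤ 1 := fun r => ⟨(hTδ r).1, (hTδ r).2.trans hδ1⟩
  have hTc : ContinuousOn T (Ioi 0) := contDiffOn_dyadicProfile.continuousOn
  have hTc2 : ContinuousOn (fun r => T (2⁻¹ * r)) (Ioi 0) :=
    hTc.comp (by fun_prop) fun x hx => by simpa using hx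
  have hTc3 : ContinuousOn (fun r => T (2 * r)) (Ioi 0) :=
    hTc.comp (by fun_prop) fun x hx => by simpa using hx
  have hTint : ∀ {x y : ℝ}, 0 < x → x ≤ y →
      IntervalIntegrable (fun r => T r / r) volume x y := by
    intro x y hx hxy
    apply ContinuousOn.intervalIntegrable
    rw [uIcc_of_le hxy]
    exact (hTc.div continuousOn_id fun z hz => (ne_of_gt hz)).mono fun z hz => hx.trans_le hz.1
  have hTle : ∀ {x y : ℝ}, 0 < x → x ≤ y → ∫ r in x..y, T r / r ≤ Real.log (y / x) := by
    intro x y hx hxy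
    rw [← integral_inv_of_pos hx (hx.trans_le hxy)]
    apply intervalIntegral.integral_mono_on hxy (hTint hx hxy)
    · apply ContinuousOn.intervalIntegrable
      rw [uIcc_of_le hxy]
      exact continuousOn_id.inv₀ fun z hz => (hx.trans_le hz.1).ne'
    · intro r hr
      rw [div_eq_mul_inv]
      exact mul_le_of_le_one_left (inv_nonneg.2 (hx.le.trans hr.1)) (hT1 r).2
  have hTnn : ∀ {x y : ℝ}, 0 < x → x ≤ y → 0 ≤ ∫ r in x..y, T r / r := by
    intro x y hx hxy
    exact intervalIntegral.integral_nonneg hxy fun r hr =>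
      div_nonneg (hT1 r).1 (hx.le.trans hr.1)
  have hstep : ∀ r ∈ Icc 1 (2 * R), ∃ k : ℕ, (2 : ℝ) ^ k ≤ r ∧ τ (k + 1) ≤ T r ∧
      τ k ≤ T (2⁻¹ * r) ∧ T (2 * r) ≤ τ (k + 1) := by
    intro r hr
    obtain ⟨k, hkN, hk1, hk2⟩ := exists_dyadic_interval hr.1 (hr.2.trans_lt hN)
    have hr0 : 0 < r := zero_lt_one.trans_le hr.1
    rw [pow_succ] at hk2
    refine ⟨k, hk1, le_dyadicProfile hanti hkN hr0 (by rw [pow_succ]; exact hk2),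
      le_dyadicProfile hanti hkN.le (by positivity) (by linarith),
      dyadicProfile_le hanti hkN (by rw [pow_succ]; linarith)⟩
  -- The correction dominates twice the drop τ k - τ (k + 1) of the dyadic interval containing r.
  -- Since dr/r is scale invariant, its integral reduces to the end intervals and stays bounded.
  refine ⟨T, fun r => T r + 2 * (T (2⁻¹ * r) - T (2 * r)), contDiffOn_dyadicProfile, hT1,
    measurable_dyadicProfile, ?_, ?_, ?_, ?_, ?_⟩
  · have hm : Measurable T := measurable_dyadicProfile
    have h2 : Measurable fun r => T (2⁻¹ * r) := hm.comp (measurable_const_mul _)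
    have h3 : Measurable fun r => T (2 * r) := hm.comp (measurable_const_mul _)
    exact hm.add (measurable_const.mul (h2.sub h3))
  · exact hTc.add (continuousOn_const.mul (hTc2.sub hTc3))
  · intro r hr
    obtain ⟨k, -, -, h2, h3⟩ := hstep r hr
    have := hanti (Nat.le_succ k)
    have := (hT1 r).1
    dsimp only
    simp only [Nat.succ_eq_add_one] at *
    linarith
  · intro t ht r hr
    obtain ⟨k, hk1, h1, h2, h3⟩ := hstep r hr
    have hkk := hanti (Nat.le_succ k)
    simp only [Nat.succ_eq_add_one] at hkk
    have hTr := hTδ r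
    have hr1 : 1 ≤ r ^ 2 := one_le_pow₀ hr.1
    have hJt := hJ.nonneg t
    have hΛ1 : 0 ≤ (1 + M) / J δ := by positivity
    have hΛ2 : 0 ≤ 2 / σ := by positivity
    have e1 : 0 ≤ (1 + M) / J δ * r ^ 2 * J t := by positivity
    have e2 : 0 ≤ 2 / σ * r ^ 2 * J t := by positivity
    dsimp only
    rw [add_mul, add_mul]
    -- For t ≥ δ the left side is at most 1 + M and J t ≥ J δ pays for it. Below δ, M (t - T r)² ≤
    -- |t - T r|: the left side is at most T r if t ≤ T r, and at most T r + 2 (t - T r) otherwise.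
    rcases le_or_gt δ t with hδt | hδt
    · have hJJ : J δ ≤ J t := hJ.monotoneOn ⟨hδ.le, hδ1⟩ ht hδt
      have h5 : 1 + M ≤ (1 + M) / J δ * r ^ 2 * J t := by
        calc 1 + M = (1 + M) / J δ * 1 * J δ := by field_simp
          _ ≤ (1 + M) / J δ * r ^ 2 * J t := by gcongr
      have h6 : M * (t - T r) ^ 2 ≤ M * 1 := by
        gcongr
        rw [sq_le_one_iff_abs_le_one, abs_le]
        constructor <;> linarith [ht.1, ht.2]
      linarith [ht.2]
    · rcases le_or_gt t (T r) with htT | htT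
      · have : M * (T r - t) ≤ 1 := le_trans (by gcongr; linarith [ht.1]) hMδ
        have : M * (T r - t) * (T r - t) ≤ 1 * (T r - t) := by
          gcongr
        nlinarith
      · have : M * (t - T r) ≤ 1 := le_trans (by gcongr; linarith) hMδ
        have h7 : M * (t - T r) * (t - T r) ≤ 1 * (t - T r) := by
          gcongr
        have h8 : 2 * (t - τ k) ≤ 2 / σ * r ^ 2 * J t := by
          rcases le_or_gt t (τ k) with h | h
          · linarith
          -- The tangent at τ k has slope σ/4^k, and 4^k ≤ r² turns it into the weight r² of the
          -- claim.
          · have h9 := (hJ.sub_bounds hmono (hτ k).1 h.le hδt.le).1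
            rw [hJτ] at h9
            have h10 := hJ.nonneg (τ k)
            have h11 : (4 : ℝ) ^ k ≤ r ^ 2 := by
              have : ((2 : ℝ) ^ k) ^ 2 = 4 ^ k := by rw [← pow_mul, mul_comm, pow_mul]; norm_num
              rw [← this]
              gcongr
            have h12 : σ / 4 ^ k * (t - τ k) ≤ J t := by linarith
            have h13 : 0 ≤ t - τ k := by linarith
            calc 2 * (t - τ k) = 2 / σ * 4 ^ k * (σ / 4 ^ k * (t - τ k)) := by field_simp
              _ ≤ 2 / σ * r ^ 2 * J t := by gcongr
        nlinarith
  · have hR0 : 0 < R := by linarith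
    have hi1 := hTint zero_lt_one (show (1 : ℝ) ≤ 2 * R by linarith)
    have hi2 : IntervalIntegrable (fun r => T (2⁻¹ * r) / r) volume 1 (2 * R) := by
      apply ContinuousOn.intervalIntegrable
      rw [uIcc_of_le (by linarith)]
      exact (hTc2.div continuousOn_id fun z hz => (ne_of_gt hz)).mono
        fun z hz => zero_lt_one.trans_le hz.1
    have hi3 : IntervalIntegrable (fun r => T (2 * r) / r) volume 1 (2 * R) := by
      apply ContinuousOn.intervalIntegrable
      rw [uIcc_of_le (by linarith)]
      exact (hTc3.div continuousOn_id fun z hz => (ne_of_gt hz)).mono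
        fun z hz => zero_lt_one.trans_le hz.1
    have hs : ∀ c : ℝ, c ≠ 0 → ∫ r in (1 : ℝ)..2 * R, T (c * r) / r =
        ∫ r in c..c * (2 * R), T r / r := by
      intro c hc
      have := intervalIntegral.mul_integral_comp_mul_left (a := 1) (b := 2 * R)
        (f := fun r => T r / r) (c := c)
      rw [mul_one] at this
      rw [← this, ← intervalIntegral.integral_const_mul]
      congr 1
      ext r
      field_simp
    have hs2 : ∫ r in (1 : ℝ)..2 * R, T (2⁻¹ * r) / r = ∫ r in (2⁻¹ : ℝ)..R, T r / r := by
      rw [hs _ (by norm_num), inv_mul_cancel_left₀ (by norm_num)]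
    have hs3 : ∫ r in (1 : ℝ)..2 * R, T (2 * r) / r = ∫ r in (2 : ℝ)..4 * R, T r / r := by
      rw [hs _ (by norm_num), ← mul_assoc]
      norm_num
    have hsplit1 := intervalIntegral.integral_add_adjacent_intervals
      (hTint (x := 2⁻¹) (y := 2) (by norm_num) (by norm_num))
      (hTint (x := 2) (y := 4 * R) (by norm_num) (by linarith))
    have hsplit2 := intervalIntegral.integral_add_adjacent_intervals
      (hTint (x := 2⁻¹) (y := R) (by norm_num) (by linarith))
      (hTint (x := R) (y := 4 * R) (by linarith) (by linarith))
    have hsplit3 := intervalIntegral.integral_add_adjacent_intervals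
      (hTint (x := 1) (y := R) (by norm_num) (by linarith))
      (hTint (x := R) (y := 2 * R) (by linarith) (by linarith))
    have hb1 := hTle (x := 2⁻¹) (y := 2) (by norm_num) (by norm_num)
    have hb2 := hTnn (x := R) (y := 4 * R) (by linarith) (by linarith)
    have hb3 := hTle (x := R) (y := 2 * R) (by linarith) (by linarith)
    rw [mul_div_cancel_right₀ _ hR0.ne'] at hb3
    have hl4 : Real.log (2 / 2⁻¹) = 2 * Real.log 2 := by
      rw [show (2 : ℝ) / 2⁻¹ = 2 ^ 2 by norm_num, Real.log_pow]; norm_num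
    rw [hl4] at hb1
    have hcontJ : ContinuousOn (fun r => J (T r) * r) (Ioi 0) :=
      (hJ.contDiff.continuous.comp_continuousOn hTc).mul continuousOn_id
    have hJint : ∀ {x y : ℝ}, 0 < x → x ≤ y →
        IntervalIntegrable (fun r => J (T r) * r) volume x y := by
      intro x y hx hxy
      apply ContinuousOn.intervalIntegrable
      rw [uIcc_of_le hxy]
      exact hcontJ.mono fun z hz => hx.trans_le hz.1
    have hJle : ∫ r in (1 : ℝ)..R, J (T r) * r ≤ 1 := by
      have hRN : R ≤ 2 ^ N := by linarith
      have h1 := integral_potential_dyadicProfile_le hJ hδ1 hσ hσ1 hmono hτ hJτ hanti N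
      have h2 := intervalIntegral.integral_add_adjacent_intervals
        (hJint zero_lt_one hR) (hJint hR0 hRN)
      have h3 : 0 ≤ ∫ r in R..2 ^ N, J (T r) * r :=
        intervalIntegral.integral_nonneg hRN fun r hr =>
          mul_nonneg (hJ.nonneg _) (hR0.le.trans hr.1)
      linarith
    have hI := integral_div_le_vortexI hR measurable_dyadicProfile (fun r => (hT1 r).2)
      (hTint zero_lt_one hR) (hJint zero_lt_one hR) hJle
    have heq : ∫ r in (1 : ℝ)..2 * R, (T r + 2 * (T (2⁻¹ * r) - T (2 * r))) / r =
        (∫ r in (1 : ℝ)..2 * R, T r / r) + 2 * ((∫ r in (2⁻¹ : ℝ)..R, T r / r) -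
          ∫ r in (2 : ℝ)..4 * R, T r / r) := by
      rw [← hs2, ← hs3, ← intervalIntegral.integral_sub hi2 hi3,
        ← intervalIntegral.integral_const_mul, ← intervalIntegral.integral_add hi1
          ((hi2.sub hi3).const_mul 2)]
      congr 1
      ext r
      ring
    rw [heq]
    linarith

/-! ### Planar integrals of radial functions and of vortex interactions. -/

/-- Translation and polar coordinates. Integrability is asked only of `r * g r`, so r₁ = 0 is
allowed for singularities such as 1/r. -/
lemma integrableOn_annulus_radial (c : ℂ) {r₁ r₂ : ℝ} (h0 : 0 ≤ r₁) (h12 : r₁ ≤ r₂) {g : ℝ → ℝ}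
    (hg : IntervalIntegrable (fun r => r * g r) volume r₁ r₂) :
    IntegrableOn (fun z : ℂ => g ‖z - c‖) ((fun z => ‖z - c‖) ⁻¹' Ioc r₁ r₂) ∧
      ∫ z in (fun z : ℂ => ‖z - c‖) ⁻¹' Ioc r₁ r₂, g ‖z - c‖ =
        2 * Real.pi * ∫ r in r₁..r₂, r * g r := by
  have hmeas : MeasurableSet ((fun z : ℂ => ‖z - c‖) ⁻¹' Ioc r₁ r₂) :=
    (by fun_prop : Measurable fun z : ℂ => ‖z - c‖) measurableSet_Ioc
  have hind : ((fun z : ℂ => ‖z - c‖) ⁻¹' Ioc r₁ r₂).indicator (fun z : ℂ => g ‖z - c‖) =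
      fun z => (fun w : ℂ => (Ioc r₁ r₂).indicator g ‖w‖) (z - c) := by
    ext z
    simp [indicator]
  have hsub : Ioc r₁ r₂ ⊆ Ioi 0 := fun x hx => h0.trans_lt hx.1
  have hind2 : (fun y : ℝ => y ^ (Module.finrank ℝ ℂ - 1) • (Ioc r₁ r₂).indicator g y) =
      (Ioc r₁ r₂).indicator (fun r => r * g r) := by
    ext y
    simp [indicator, Complex.finrank_real_complex]
  constructor
  · rw [← integrable_indicator_iff hmeas, hind]
    apply Integrable.comp_sub_right (f := fun w : ℂ => (Ioc r₁ r₂).indicator g ‖w‖)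
    rw [integrable_fun_norm_addHaar, hind2]
    apply Integrable.integrableOn
    rw [integrable_indicator_iff measurableSet_Ioc]
    exact (intervalIntegrable_iff_integrableOn_Ioc_of_le h12).1 hg
  · rw [← integral_indicator hmeas, hind,
      integral_sub_right_eq_self (fun w : ℂ => (Ioc r₁ r₂).indicator g ‖w‖),
      integral_fun_norm_addHaar, hind2, setIntegral_indicator measurableSet_Ioc,
      inter_eq_self_of_subset_right hsub, intervalIntegral.integral_of_le h12]
    simp [Complex.finrank_real_complex, Measure.real]
    ring

lemma setIntegral_radial_le (c : ℂ) {r₁ r₂ : ℝ} (h0 : 0 ≤ r₁) (h12 : r₁ ≤ r₂) {g : ℝ → ℝ}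
    (hg : IntervalIntegrable (fun r => r * g r) volume r₁ r₂) (hg0 : ∀ r ∈ Ioc r₁ r₂, 0 ≤ g r)
    {s : Set ℂ} (hs : s ⊆ (fun z => ‖z - c‖) ⁻¹' Ioc r₁ r₂) :
    IntegrableOn (fun z : ℂ => g ‖z - c‖) s ∧
      ∫ z in s, g ‖z - c‖ ≤ 2 * Real.pi * ∫ r in r₁..r₂, r * g r := by
  obtain ⟨h1, h2⟩ := integrableOn_annulus_radial c h0 h12 hg
  refine ⟨h1.mono_set hs, h2 ▸ setIntegral_mono_set h1 ?_ (Filter.Eventually.of_forall hs)⟩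
  have hmeas : MeasurableSet ((fun z : ℂ => ‖z - c‖) ⁻¹' Ioc r₁ r₂) :=
    (by fun_prop : Measurable fun z : ℂ => ‖z - c‖) measurableSet_Ioc
  filter_upwards [ae_restrict_mem hmeas] with z hz using hg0 _ hz

/-- With D = |a - b|, far from a one has |z - b| ≥ |z - a| - D, and 1/(x(x - D)) exceeds 1/x² by at
most 2D/x³ for x ≥ 2D. Keeping 1/x² with coefficient one gives the sharp factor of the logarithm.
Elsewhere one of the two distances is at least D/2. -/
lemma inv_norm_mul_inv_norm_le {a b z : ℂ} (hab : a ≠ b) (hza : z ≠ a) (hzb : z ≠ b) :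
    ‖z - a‖⁻¹ * ‖z - b‖⁻¹ ≤
      (if 2 * ‖a - b‖ < ‖z - a‖ then (‖z - a‖ ^ 2)⁻¹ + 2 * ‖a - b‖ / ‖z - a‖ ^ 3 else 0) +
      (if ‖z - a‖ ≤ 2 * ‖a - b‖ then 2 / ‖a - b‖ * ‖z - a‖⁻¹ else 0) +
      (if ‖z - b‖ ≤ ‖a - b‖ / 2 then 2 / ‖a - b‖ * ‖z - b‖⁻¹ else 0) := by
  have hD : 0 < ‖a - b‖ := norm_pos_iff.2 (sub_ne_zero.2 hab)
  have hx : 0 < ‖z - a‖ := norm_pos_iff.2 (sub_ne_zero.2 hza)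
  have hy : 0 < ‖z - b‖ := norm_pos_iff.2 (sub_ne_zero.2 hzb)
  have t1 : ‖z - a‖ ≤ ‖z - b‖ + ‖a - b‖ := by
    have := norm_sub_le (z - b) (a - b)
    rwa [show z - b - (a - b) = z - a by ring] at this
  have t2 : ‖a - b‖ ≤ ‖z - a‖ + ‖z - b‖ := by
    have := norm_sub_le (z - b) (z - a)
    rw [show z - b - (z - a) = a - b by ring] at this
    linarith
  generalize ‖z - a‖ = x at *
  generalize ‖z - b‖ = y at *
  generalize ‖a - b‖ = D at *
  have e1 : 0 ≤ 2 / D * x⁻¹ := by positivity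
  have e2 : 0 ≤ 2 / D * y⁻¹ := by positivity
  have e3 : 0 ≤ (x ^ 2)⁻¹ + 2 * D / x ^ 3 := by positivity
  rcases lt_or_ge (2 * D) x with h1 | h1
  · rw [if_pos h1, if_neg (not_le.2 h1)]
    have : x⁻¹ * y⁻¹ ≤ (x ^ 2)⁻¹ + 2 * D / x ^ 3 := by
      have hxD : 0 < x - D := by linarith
      calc x⁻¹ * y⁻¹ ≤ x⁻¹ * (x - D)⁻¹ := by gcongr; linarith
        _ ≤ (x ^ 2)⁻¹ + 2 * D / x ^ 3 := by
          rw [← mul_inv, inv_eq_one_div, div_le_iff₀ (by positivity)]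
          have : ((x ^ 2)⁻¹ + 2 * D / x ^ 3) * (x * (x - D)) = 1 + D * (x - 2 * D) / x ^ 2 := by
            field_simp
            ring
          rw [this]
          have : 0 ≤ D * (x - 2 * D) / x ^ 2 :=
            div_nonneg (mul_nonneg hD.le (by linarith)) (by positivity)
          linarith
    split_ifs <;> linarith
  · rw [if_neg (not_lt.2 h1), if_pos h1]
    rcases le_or_gt y (D / 2) with h2 | h2
    · rw [if_pos h2]
      have : x⁻¹ * y⁻¹ ≤ 2 / D * y⁻¹ := by
        gcongr
        rw [inv_eq_one_div, div_le_div_iff₀ hx hD]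
        linarith
      linarith
    · rw [if_neg (not_le.2 h2)]
      have : x⁻¹ * y⁻¹ ≤ 2 / D * x⁻¹ := by
        rw [mul_comm]
        gcongr
        rw [inv_eq_one_div, div_le_div_iff₀ hy hD]
        linarith
      linarith

lemma setIntegral_inv_norm_mul_inv_norm_le {a b : ℂ} (hab : a ≠ b) {R : ℝ} (hR : ‖a - b‖ ≤ R)
    {s : Set ℂ} (hs : MeasurableSet s) (hsR : ∀ z ∈ s, z ≠ a ∧ z ≠ b ∧ ‖z - a‖ ≤ 2 * R) :
    ∫ z in s, ‖z - a‖⁻¹ * ‖z - b‖⁻¹ ≤ 2 * Real.pi * Real.log (R / ‖a - b‖) + 12 * Real.pi := by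
  have hD : 0 < ‖a - b‖ := norm_pos_iff.2 (sub_ne_zero.2 hab)
  set D := ‖a - b‖ with hDdef
  have hDR : 2 * D ≤ 2 * R := by linarith
  have hR0 : 0 < R := by linarith
  have hmA : ∀ (c : ℂ) (x y : ℝ), MeasurableSet ((fun z : ℂ => ‖z - c‖) ⁻¹' Ioc x y) :=
    fun c x y => (by fun_prop : Measurable fun z : ℂ => ‖z - c‖) measurableSet_Ioc
  set g₁ : ℝ → ℝ := fun x => (x ^ 2)⁻¹ + 2 * D / x ^ 3
  set g₂ : ℝ → ℝ := fun x => 2 / D * x⁻¹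
  have hc1 : ContinuousOn (fun x => x⁻¹ + 2 * D * (x ^ 2)⁻¹) (uIcc (2 * D) (2 * R)) := by
    rw [uIcc_of_le hDR]
    have : ∀ x ∈ Icc (2 * D) (2 * R), x ≠ 0 := fun x hx => by
      have := hx.1
      exact ne_of_gt (by linarith)
    exact (continuousOn_id.inv₀ this).add
      (continuousOn_const.mul ((continuousOn_id.pow 2).inv₀ fun x hx => pow_ne_zero 2 (this x hx)))
  have e1 : EqOn (fun x => x⁻¹ + 2 * D * (x ^ 2)⁻¹) (fun x => x * g₁ x) (uIcc (2 * D) (2 * R)) := by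
    intro x hx
    rw [uIcc_of_le hDR] at hx
    have hx0 : x ≠ 0 := ne_of_gt (by linarith [hx.1])
    simp only [g₁]
    field_simp
  have i1 : IntervalIntegrable (fun x => x * g₁ x) volume (2 * D) (2 * R) :=
    (hc1.congr e1.symm).intervalIntegrable
  have v1 : ∫ x in (2 * D)..(2 * R), x * g₁ x ≤ Real.log (R / D) + 1 := by
    rw [← intervalIntegral.integral_congr e1]
    have hd : ∀ x ∈ uIcc (2 * D) (2 * R), HasDerivAt (fun x => Real.log x - 2 * D * x⁻¹)
        (x⁻¹ + 2 * D * (x ^ 2)⁻¹) x := by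
      intro x hx
      rw [uIcc_of_le hDR] at hx
      have hx0 : x ≠ 0 := ne_of_gt (by linarith [hx.1])
      have := (Real.hasDerivAt_log hx0).sub ((hasDerivAt_inv hx0).const_mul (2 * D))
      exact this.congr_deriv (by ring)
    rw [intervalIntegral.integral_eq_sub_of_hasDerivAt hd hc1.intervalIntegrable,
      Real.log_mul two_ne_zero hR0.ne', Real.log_mul two_ne_zero hD.ne',
      Real.log_div hR0.ne' hD.ne', mul_inv_cancel₀ (by positivity)]
    have : 0 ≤ 2 * D * (2 * R)⁻¹ := by positivity
    linarith
  have i2 : ∀ y, 0 ≤ y → IntervalIntegrable (fun x => x * g₂ x) volume 0 y ∧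
      ∫ x in (0 : ℝ)..y, x * g₂ x = 2 / D * y := by
    intro y hy
    have e : EqOn (fun _ => 2 / D) (fun x => x * g₂ x) (uIoc 0 y) := by
      intro x hx
      rw [uIoc_of_le hy] at hx
      have hx0 : x ≠ 0 := hx.1.ne'
      simp only [g₂]
      field_simp
    refine ⟨intervalIntegrable_const.congr e, ?_⟩
    rw [← intervalIntegral.integral_congr_ae (Filter.Eventually.of_forall fun x hx => e hx),
      intervalIntegral.integral_const, smul_eq_mul, sub_zero, mul_comm]
  obtain ⟨I1, V1⟩ := integrableOn_annulus_radial a (by positivity) hDR i1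
  obtain ⟨I2, V2⟩ := integrableOn_annulus_radial a le_rfl (by positivity) (i2 (2 * D) (by positivity)).1
  obtain ⟨I3, V3⟩ := integrableOn_annulus_radial b le_rfl (by positivity) (i2 (D / 2) (by positivity)).1
  rw [(i2 _ (by positivity)).2] at V2 V3
  rw [← integrable_indicator_iff (hmA _ _ _)] at I1 I2 I3
  rw [← integral_indicator (hmA _ _ _)] at V1 V2 V3
  have hg1 : ∀ x, 0 ≤ x → 0 ≤ g₁ x := fun x hx => by simp only [g₁]; positivity
  have hg2 : ∀ x, 0 ≤ x → 0 ≤ g₂ x := fun x hx => by simp only [g₂]; positivity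
  calc ∫ z in s, ‖z - a‖⁻¹ * ‖z - b‖⁻¹
      ≤ ∫ z in s, (((fun z : ℂ => ‖z - a‖) ⁻¹' Ioc (2 * D) (2 * R)).indicator (fun z => g₁ ‖z - a‖) z
        + ((fun z : ℂ => ‖z - a‖) ⁻¹' Ioc 0 (2 * D)).indicator (fun z => g₂ ‖z - a‖) z
        + ((fun z : ℂ => ‖z - b‖) ⁻¹' Ioc 0 (D / 2)).indicator (fun z => g₂ ‖z - b‖) z) := by
        apply integral_mono_of_nonneg
        · exact Filter.Eventually.of_forall fun z => by positivity
        · exact ((I1.add I2).add I3).integrableOn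
        · filter_upwards [ae_restrict_mem hs] with z hz
          obtain ⟨ha, hb, hz2⟩ := hsR z hz
          have hx : 0 < ‖z - a‖ := norm_pos_iff.2 (sub_ne_zero.2 ha)
          have hy : 0 < ‖z - b‖ := norm_pos_iff.2 (sub_ne_zero.2 hb)
          have := inv_norm_mul_inv_norm_le hab ha hb
          simpa [indicator, hx, hy, hz2, g₁, g₂] using this
    _ ≤ ∫ z, (((fun z : ℂ => ‖z - a‖) ⁻¹' Ioc (2 * D) (2 * R)).indicator (fun z => g₁ ‖z - a‖) z
        + ((fun z : ℂ => ‖z - a‖) ⁻¹' Ioc 0 (2 * D)).indicator (fun z => g₂ ‖z - a‖) z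
        + ((fun z : ℂ => ‖z - b‖) ⁻¹' Ioc 0 (D / 2)).indicator (fun z => g₂ ‖z - b‖) z) := by
        apply setIntegral_le_integral ((I1.add I2).add I3)
        refine Filter.Eventually.of_forall fun z => add_nonneg (add_nonneg ?_ ?_) ?_
        · exact indicator_nonneg (fun z _ => hg1 _ (norm_nonneg _)) z
        · exact indicator_nonneg (fun z _ => hg2 _ (norm_nonneg _)) z
        · exact indicator_nonneg (fun z _ => hg2 _ (norm_nonneg _)) z
    _ ≤ 2 * Real.pi * Real.log (R / D) + 12 * Real.pi := by
        -- The three regions contribute at most 2π (log(R/D) + 1), 8π and 2π.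
        have hadd := integral_add (I1.add I2) I3
        simp only [Pi.add_apply] at hadd
        rw [hadd, integral_add I1 I2, V1, V2, V3]
        have : 2 * Real.pi * ∫ r in (2 * D)..(2 * R), r * g₁ r ≤
            2 * Real.pi * (Real.log (R / D) + 1) := by gcongr
        have h1 : 2 / D * (2 * D) = 4 := by field_simp; norm_num
        have h2 : 2 / D * (D / 2) = 1 := by field_simp
        rw [h1, h2]
        linarith

/-! ### Closed forms against compactly supported exact forms. -/

open Filter Topology

lemma integrable_of_continuousOn_compact {f : ℂ → ℝ} {K : Set ℂ} (hK : IsCompact K)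
    (hf : ContinuousOn f K) (h0 : ∀ z ∉ K, f z = 0) : Integrable f := by
  rw [← integrableOn_iff_integrable_of_support_subset (s := K)]
  · exact hf.integrableOn_compact hK
  · intro z hz
    by_contra h
    exact hz (h0 z h)

/-- The density of `dh ∧ Im (dw / w)`. -/
noncomputable def wedgeArg (h : ℂ → ℝ) (w : ℂ → ℂ) (z : ℂ) : ℝ :=
  fderiv ℝ h z 1 * (fderiv ℝ w z Complex.I / w z).im -
    fderiv ℝ h z Complex.I * (fderiv ℝ w z 1 / w z).im

lemma fderiv_eq_zero_of_notMem_tsupport {h : ℂ → ℝ} {z : ℂ} (hz : z ∉ tsupport h) :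
    fderiv ℝ h z = 0 := by
  by_contra hne
  exact hz (support_fderiv_subset ℝ hne)

lemma wedgeArg_eq_zero {h : ℂ → ℝ} {w : ℂ → ℂ} {z : ℂ} (hz : fderiv ℝ h z = 0) :
    wedgeArg h w z = 0 := by
  simp [wedgeArg, hz]

lemma continuousOn_wedgeArg {h : ℂ → ℝ} {w : ℂ → ℂ} {U : Set ℂ} (hU : IsOpen U)
    (hh : ContDiff ℝ 2 h) (hw : ContDiffOn ℝ 1 w U) (hw0 : ∀ z ∈ U, w z ≠ 0) :
    ContinuousOn (wedgeArg h w) U := by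
  have h1 : ∀ v, Continuous fun z => fderiv ℝ h z v := fun v =>
    (hh.continuous_fderiv (by norm_num)).clm_apply continuous_const
  have h2 : ∀ v, ContinuousOn (fun z => (fderiv ℝ w z v / w z).im) U := fun v =>
    Complex.continuous_im.comp_continuousOn <|
      ((hw.continuousOn_fderiv_of_isOpen hU le_rfl).clm_apply continuousOn_const).div
        hw.continuousOn hw0
  exact ((h1 1).continuousOn.mul (h2 _)).sub ((h1 _).continuousOn.mul (h2 1))

lemma integrable_wedgeArg {h : ℂ → ℝ} {w : ℂ → ℂ} {U K : Set ℂ} (hU : IsOpen U)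
    (hh : ContDiff ℝ 2 h) (hK : IsCompact K) (hKU : K ⊆ U) (hhK : ∀ z ∉ K, fderiv ℝ h z = 0)
    (hw : ContDiffOn ℝ 1 w U) (hw0 : ∀ z ∈ U, w z ≠ 0) : Integrable (wedgeArg h w) :=
  integrable_of_continuousOn_compact hK ((continuousOn_wedgeArg hU hh hw hw0).mono hKU)
    fun z hz => wedgeArg_eq_zero (hhK z hz)

/-- An exact form is orthogonal to compactly supported exact forms. -/
lemma integral_wedge_eq_zero_of_potential {h ψ : ℂ → ℝ} {V : Set ℂ} (hV : IsOpen V)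
    (hh : ContDiff ℝ 2 h) (hc : HasCompactSupport h) (hs : tsupport h ⊆ V)
    (hψ : ContDiffOn ℝ 1 ψ V) :
    ∫ z, (fderiv ℝ h z 1 * fderiv ℝ ψ z Complex.I - fderiv ℝ h z Complex.I * fderiv ℝ ψ z 1) = 0 := by
  have hh1 : ∀ v, ContDiff ℝ 1 fun z => fderiv ℝ h z v := fun v =>
    (hh.fderiv_right (m := 1) (by norm_num)).clm_apply contDiff_const
  have hh2 : ∀ v v', Continuous fun z => fderiv ℝ (fun z => fderiv ℝ h z v) z v' := fun v v' =>
    ((hh1 v).continuous_fderiv one_ne_zero).clm_apply continuous_const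
  have hsupp1 : ∀ v, tsupport (fun z => fderiv ℝ h z v) ⊆ tsupport h := fun v =>
    tsupport_fderiv_apply_subset ℝ v
  have hsupp2 : ∀ v v', tsupport (fun z => fderiv ℝ (fun z => fderiv ℝ h z v) z v') ⊆ tsupport h :=
    fun v v' => (tsupport_fderiv_apply_subset ℝ v').trans (hsupp1 v)
  have hψ' : ∀ v, ContinuousOn (fun z => fderiv ℝ ψ z v) V := fun v =>
    (hψ.continuousOn_fderiv_of_isOpen hV le_rfl).clm_apply continuousOn_const
  have hint : ∀ f g : ℂ → ℝ, ContinuousOn f V → Continuous g → tsupport g ⊆ tsupport h →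
      Integrable fun z => f z * g z := by
    intro f g hf hg hgs
    refine integrable_of_continuousOn_compact hc ((hf.mono hs).mul hg.continuousOn) fun z hz => ?_
    rw [image_eq_zero_of_notMem_tsupport fun h => hz (hgs h), mul_zero]
  -- The derivative is moved from ψ onto h, so ψ need only be C¹; symmetry of the second derivative
  -- of h then cancels the two terms.
  have key : ∀ v v', ∫ z, ψ z * fderiv ℝ (fun z => fderiv ℝ h z v) z v' =
      -∫ z, fderiv ℝ ψ z v' * fderiv ℝ h z v := by
    intro v v'
    apply integral_mul_fderiv_eq_neg_fderiv_mul_of_integrable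
    · exact hint _ _ (hψ' v') (hh1 v).continuous (hsupp1 v)
    · exact hint _ _ hψ.continuousOn (hh2 v v') (hsupp2 v v')
    · exact hint _ _ hψ.continuousOn (hh1 v).continuous (hsupp1 v)
    · intro x hx
      exact (hψ.differentiableOn one_ne_zero).differentiableAt (hV.mem_nhds (hs (hsupp1 v hx)))
    · intro x _
      exact (hh1 v).differentiable one_ne_zero x
  have hsymm : ∀ z, fderiv ℝ (fun z => fderiv ℝ h z 1) z Complex.I =
      fderiv ℝ (fun z => fderiv ℝ h z Complex.I) z 1 := by
    intro z
    have hd : DifferentiableAt ℝ (fderiv ℝ h) z :=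
      (hh.fderiv_right (m := 1) (by norm_num)).differentiable one_ne_zero z
    rw [fderiv_clm_apply hd (differentiableAt_const _), fderiv_clm_apply hd (differentiableAt_const _)]
    have := (hh.contDiffAt (x := z)).isSymmSndFDerivAt (by simp)
    simpa using this.eq Complex.I 1
  have k1 := key 1 Complex.I
  have k2 := key Complex.I 1
  simp_rw [hsymm] at k1
  rw [k1] at k2
  have e : ∀ z, fderiv ℝ h z 1 * fderiv ℝ ψ z Complex.I - fderiv ℝ h z Complex.I * fderiv ℝ ψ z 1 =
      fderiv ℝ ψ z Complex.I * fderiv ℝ h z 1 - fderiv ℝ ψ z 1 * fderiv ℝ h z Complex.I :=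
    fun z => by ring
  simp_rw [e]
  rw [integral_sub (hint _ _ (hψ' _) (hh1 _).continuous (hsupp1 _))
    (hint _ _ (hψ' _) (hh1 _).continuous (hsupp1 _))]
  linarith

/-- The potential is a branch of arg w: division by `w x` moves the value at x to 1, away from the
cut of the logarithm. -/
lemma exists_local_potential {w : ℂ → ℂ} {U : Set ℂ} (hU : IsOpen U) (hw : ContDiffOn ℝ 1 w U)
    (hw0 : ∀ z ∈ U, w z ≠ 0) {x : ℂ} (hx : x ∈ U) :
    ∃ V ⊆ U, IsOpen V ∧ x ∈ V ∧ ∃ ψ : ℂ → ℝ, ContDiffOn ℝ 1 ψ V ∧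
      ∀ z ∈ V, ∀ v, fderiv ℝ ψ z v = (fderiv ℝ w z v / w z).im := by
  have hcont : ContinuousOn (fun z => w z / w x) U := hw.continuousOn.div_const _
  refine ⟨U ∩ (fun z => w z / w x) ⁻¹' Complex.slitPlane, inter_subset_left,
    hcont.isOpen_inter_preimage hU Complex.isOpen_slitPlane, ⟨hx, ?_⟩,
    fun z => (Complex.log (w z / w x)).im, ?_, ?_⟩
  · simp [div_self (hw0 x hx), Complex.one_mem_slitPlane]
  · intro z hz
    have hwz : ContDiffWithinAt ℝ 1 (fun z => w z / w x) U z := (hw z hz.1).div_const _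
    have hlog : ContDiffAt ℝ 1 Complex.log (w z / w x) :=
      (Complex.contDiffAt_log hz.2).restrict_scalars ℝ
    have := hlog.comp_contDiffWithinAt z (hwz.mono (inter_subset_left
      (t := (fun z => w z / w x) ⁻¹' Complex.slitPlane)))
    exact Complex.imCLM.contDiff.contDiffAt.comp_contDiffWithinAt z this
  · intro z hz v
    have hd : HasFDerivAt w (fderiv ℝ w z) z :=
      ((hw.differentiableOn one_ne_zero).differentiableAt (hU.mem_nhds hz.1)).hasFDerivAt
    have hlog : HasFDerivAt (𝕜 := ℝ) Complex.log _ (w z / w x) :=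
      ((Complex.hasStrictDerivAt_log hz.2).hasDerivAt.hasFDerivAt).restrictScalars ℝ
    have hq : HasFDerivAt (fun z => w z / w x) ((w x)⁻¹ • fderiv ℝ w z) z := by
      simpa [div_eq_mul_inv] using hd.mul_const (w x)⁻¹
    have := (Complex.imCLM.hasFDerivAt.comp z (hlog.comp z hq)).fderiv
    have hx0 := hw0 x hx
    have hz0 := hw0 z hz.1
    have e : (fun z => (Complex.log (w z / w x)).im) = ⇑Complex.imCLM ∘ Complex.log ∘ fun z => w z / w x := rfl
    rw [e, this]
    simp only [ContinuousLinearMap.comp_apply, smul_apply,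
      ContinuousLinearMap.coe_restrictScalars', ContinuousLinearMap.toSpanSingleton_apply,
      Complex.imCLM_apply, smul_eq_mul]
    congr 1
    field_simp

lemma wedgeArg_sub {h k : ℂ → ℝ} (hh : ContDiff ℝ 2 h) (hk : ContDiff ℝ 2 k) (w : ℂ → ℂ) (z : ℂ) :
    wedgeArg (fun z => h z - k z) w z = wedgeArg h w z - wedgeArg k w z := by
  unfold wedgeArg
  rw [fderiv_fun_sub (hh.differentiable two_ne_zero z) (hk.differentiable two_ne_zero z)]
  simp only [sub_apply]
  ring

/-- The closed form `Im (dw / w)` is orthogonal to compactly supported exact forms. -/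
theorem integral_wedgeArg_eq_zero {h : ℂ → ℝ} {w : ℂ → ℂ} {U : Set ℂ} (hU : IsOpen U)
    (hw : ContDiffOn ℝ 1 w U) (hw0 : ∀ z ∈ U, w z ≠ 0)
    (hh : ContDiff ℝ 2 h) (hc : HasCompactSupport h) (hs : tsupport h ⊆ U) :
    ∫ z, wedgeArg h w z = 0 := by
  have hloc : ∀ x : ℂ, ∃ f : ℂ → ℝ, x ∈ U → ContDiff ℝ 2 f ∧ (∀ᶠ y in 𝓝 x, f y = 1) ∧
      ∀ k : ℂ → ℝ, ContDiff ℝ 2 k → ∫ z, wedgeArg (fun z => k z * f z) w z = 0 := by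
    intro x
    by_cases hx : x ∈ U
    swap
    · exact ⟨0, fun h => absurd h hx⟩
    obtain ⟨V, hVU, hV, hxV, ψ, hψ, hψw⟩ := exists_local_potential hU hw hw0 hx
    obtain ⟨ε, hε, hball⟩ := Metric.isOpen_iff.1 hV x hxV
    let f : ContDiffBump x := ⟨ε / 4, ε / 2, by positivity, by linarith⟩
    refine ⟨f, fun _ => ⟨f.contDiff, f.eventuallyEq_one, fun k hk => ?_⟩⟩
    have hts : tsupport (fun z => k z * f z) ⊆ V := by
      refine (tsupport_mul_subset_right (f := k) (g := f)).trans ?_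
      rw [f.tsupport_eq]
      exact (Metric.closedBall_subset_ball (by simp only [f]; linarith)).trans hball
    have hcs : HasCompactSupport (fun z => k z * f z) := HasCompactSupport.mul_left f.hasCompactSupport
    have := integral_wedge_eq_zero_of_potential hV (hk.mul f.contDiff) hcs hts hψ
    rw [← this]
    refine integral_congr_ae (Eventually.of_forall fun z => ?_)
    by_cases hz : z ∈ V
    · simp only [wedgeArg, hψw z hz]
    · have := fderiv_eq_zero_of_notMem_tsupport fun hh => hz (hts hh)
      simp [wedgeArg, this]
  choose f hf using hloc
  obtain ⟨t, htU, ht⟩ := IsCompact.elim_nhds_subcover hc (fun x => {y | x ∈ U → f x y = 1})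
    (fun x hx => by
      filter_upwards [(hf x (hs hx)).2.1] with y hy _ using hy)
  -- Each factor 1 - f x removes a piece supported where a potential exists, so the integral does
  -- not change. Once all bumps of the finite cover are used, the product vanishes on the support of
  -- h.
  have hmain : ∀ s ⊆ t, ∫ z, wedgeArg (fun z => h z * ∏ x ∈ s, (1 - f x z)) w z =
      ∫ z, wedgeArg h w z := by
    intro s
    induction s using Finset.induction_on with
    | empty => intro _; simp
    | insert x s hxs ih =>
      intro hst
      have hsub := (Finset.subset_insert x s).trans hst
      have hxU : x ∈ U := hs (htU x (hst (Finset.mem_insert_self x s)))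
      rw [← ih hsub]
      have hk : ContDiff ℝ 2 fun z => h z * ∏ x ∈ s, (1 - f x z) :=
        hh.mul (contDiff_prod fun y hy => contDiff_const.sub (hf y (hs (htU y (hsub hy)))).1)
      have hkf : ContDiff ℝ 2 fun z => (h z * ∏ x ∈ s, (1 - f x z)) * f x z := hk.mul (hf x hxU).1
      have hz : ∀ p : ℂ → ℝ, ∀ z ∉ tsupport h, fderiv ℝ (fun z => h z * p z) z = 0 :=
        fun p z hz => fderiv_eq_zero_of_notMem_tsupport fun hh => hz (tsupport_mul_subset_left hh)
      have e : (fun z => h z * ∏ x ∈ insert x s, (1 - f x z)) = fun z =>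
          (h z * ∏ x ∈ s, (1 - f x z)) - (h z * ∏ x ∈ s, (1 - f x z)) * f x z := by
        ext z
        rw [Finset.prod_insert hxs]
        ring
      rw [e]
      simp_rw [wedgeArg_sub hk hkf]
      rw [integral_sub, (hf x hxU).2.2 _ hk, sub_zero]
      · exact integrable_wedgeArg hU hk hc hs (hz _) hw hw0
      · refine integrable_wedgeArg hU hkf hc hs ?_ hw hw0
        simp_rw [mul_assoc]
        exact hz _
  rw [← hmain t Finset.Subset.rfl]
  have : (fun z => h z * ∏ x ∈ t, (1 - f x z)) = fun _ => 0 := by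
    ext z
    by_cases hz : z ∈ tsupport h
    · obtain ⟨x, hxt, hx⟩ := mem_iUnion₂.1 (ht hz)
      rw [Finset.prod_eq_zero hxt, mul_zero]
      rw [hx (hs (htU x hxt)), sub_self]
    · rw [image_eq_zero_of_notMem_tsupport hz, zero_mul]
  rw [this]
  simp [wedgeArg]

/-! ### Degree and circulation. -/

/-- The quotient f/2π is continuous with values in the discrete set of integers. -/
lemma eq_of_forall_exp_mul_I_eq_one {f : ℝ → ℝ} (hf : Continuous f)
    (h : ∀ x, Complex.exp (f x * Complex.I) = 1) (x y : ℝ) : f x = f y := by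
  have hT : IsDiscrete (range ((↑) : ℤ → ℝ)) :=
    Int.isClosedEmbedding_coe_real.isEmbedding.isDiscrete_range
  refine mul_right_cancel₀ (inv_ne_zero Real.two_pi_pos.ne') <|
    isPreconnected_univ.constant_of_mapsTo (f := fun x => f x * (2 * Real.pi)⁻¹) hT
    (hf.mul continuous_const).continuousOn (fun x _ => ?_) (mem_univ x) (mem_univ y)
  obtain ⟨n, hn⟩ := Complex.exp_eq_one_iff.1 (h x)
  refine ⟨n, ?_⟩
  have : (f x : ℂ) = n * (2 * Real.pi) := by
    apply mul_right_cancel₀ Complex.I_ne_zero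
    rw [hn]; ring
  have : f x = n * (2 * Real.pi) := by exact_mod_cast this
  dsimp only
  rw [this]
  field_simp

/-- The variation of a continuous argument of a nonvanishing `C¹` curve is the integral of the
imaginary part of its logarithmic derivative. -/
lemma integral_logDeriv_eq_of_lift {W W' : ℝ → ℂ} (hW : ∀ θ, HasDerivAt W (W' θ) θ)
    (hW' : Continuous W') (hW0 : ∀ θ, W θ ≠ 0) {Φ : ℝ → ℝ} (hΦ : Continuous Φ)
    (hlift : ∀ θ, W θ = (‖W θ‖ : ℂ) * Complex.exp ((Φ θ : ℂ) * Complex.I)) (a b : ℝ) :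
    ∫ θ in a..b, (W' θ / W θ).im = Φ b - Φ a := by
  have hWc : Continuous W := continuous_iff_continuousAt.2 fun θ => (hW θ).continuousAt
  have hl : Continuous fun θ => W' θ / W θ := hW'.div hWc hW0
  set Λ : ℝ → ℂ := fun θ => ∫ s in a..θ, W' s / W s with hΛ
  have hΛd : ∀ θ, HasDerivAt Λ (W' θ / W θ) θ := fun θ => hl.integral_hasStrictDerivAt a θ |>.hasDerivAt
  have hΛc : Continuous Λ := continuous_iff_continuousAt.2 fun θ => (hΛd θ).continuousAt
  have hconst : ∀ θ, W θ = W a * Complex.exp (Λ θ) := by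
    intro θ
    have hd : ∀ θ, HasDerivAt (fun θ => W θ * Complex.exp (-Λ θ)) 0 θ := by
      intro θ
      have := (hW θ).mul ((hΛd θ).neg.cexp)
      refine this.congr_deriv ?_
      have := hW0 θ
      field_simp
      ring
    have := is_const_of_deriv_eq_zero (fun θ => (hd θ).differentiableAt) (fun θ => (hd θ).deriv) θ a
    simp only [hΛ, intervalIntegral.integral_same, neg_zero, Complex.exp_zero, mul_one] at this
    rw [← this, mul_assoc, ← Complex.exp_add, neg_add_cancel, Complex.exp_zero, mul_one]
  have him : ∫ θ in a..b, (W' θ / W θ).im = (Λ b).im :=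
    Complex.imCLM.intervalIntegral_comp_comm (hl.intervalIntegrable a b)
  -- Im Λ and Φ - Φ(a) are both continuous arguments of W/W(a), so they differ by a multiple of 2π;
  -- this multiple is constant and vanishes at a.
  have hone : ∀ θ, Complex.exp ((((Λ θ).im - (Φ θ - Φ a) : ℝ) : ℂ) * Complex.I) = 1 := by
    intro θ
    have h1 := hconst θ
    have h2 : ‖W θ‖ = ‖W a‖ * Real.exp (Λ θ).re := by
      rw [h1, norm_mul, Complex.norm_exp]
    have hna : (‖W a‖ : ℂ) ≠ 0 := by simpa using hW0 a
    have h3 : Complex.exp (Λ θ) = Complex.exp ((Λ θ).re) * Complex.exp ((Λ θ).im * Complex.I) := by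
      rw [← Complex.exp_add, Complex.re_add_im]
    rw [hlift θ, hlift a, h2, h3] at h1
    push_cast at h1 ⊢
    have h4 : Complex.exp (Φ θ * Complex.I) =
        Complex.exp (Φ a * Complex.I) * Complex.exp ((Λ θ).im * Complex.I) := by
      apply mul_left_cancel₀ (mul_ne_zero hna (Complex.exp_ne_zero ((Λ θ).re)))
      rw [h1]
      ring
    have h5 : (((Λ θ).im : ℂ) - (Φ θ - Φ a)) * Complex.I =
        Φ a * Complex.I + (Λ θ).im * Complex.I - Φ θ * Complex.I := by ring
    rw [h5, Complex.exp_sub, Complex.exp_add, ← h4, div_self (Complex.exp_ne_zero _)]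
  have hD := eq_of_forall_exp_mul_I_eq_one (by fun_prop) hone b a
  simp only [hΛ, intervalIntegral.integral_same, Complex.zero_im, sub_self] at hD
  rw [him]
  simp only [hΛ]
  linarith

/-- The degree is prescribed on the boundary circle, where w is only continuous. By compactness in θ
the ratio to its boundary value is close to 1 on nearby circles, so its principal argument is
continuous and can be added to a lift. -/
lemma eventually_circle_re_pos {w : ℂ → ℂ} {c : ℂ} {r₀ r₁ : ℝ} (h0 : 0 < r₀) (h01 : r₀ < r₁)
    (hw : ContinuousOn w {z | r₀ ≤ ‖z - c‖ ∧ ‖z - c‖ < r₁})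
    (hw0 : ∀ θ, w (circleMap c r₀ θ) ≠ 0) :
    ∃ ε > 0, r₀ + ε ≤ r₁ ∧ ∀ r ∈ Ioo r₀ (r₀ + ε), ∀ θ,
      0 < (w (circleMap c r θ) / w (circleMap c r₀ θ)).re := by
  have hmem : ∀ r θ, r₀ ≤ r → r < r₁ → circleMap c r θ ∈ {z | r₀ ≤ ‖z - c‖ ∧ ‖z - c‖ < r₁} := by
    intro r θ hr hr1
    have : ‖circleMap c r θ - c‖ = r := by
      rw [circleMap_sub_center, norm_circleMap_zero, abs_of_pos (h0.trans_le hr)]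
    rw [mem_ofPred_eq, this]
    exact ⟨hr, hr1⟩
  -- `max r₀` extends the map to radii below r₀, so that continuity at r₀ can be used on a full
  -- neighbourhood.
  have hwc : ContinuousOn (fun p : ℝ × ℝ => w (circleMap c (max r₀ p.1) p.2)) (Iio r₁ ×ˢ univ) := by
    refine hw.comp (Continuous.continuousOn ?_) fun p hp =>
      hmem _ _ (le_max_left _ _) (max_lt h01 hp.1)
    unfold circleMap
    fun_prop
  have hwc2 : Continuous fun p : ℝ × ℝ => w (circleMap c r₀ p.2) :=
    hw.comp_continuous (by unfold circleMap; fun_prop) fun p => hmem _ _ le_rfl h01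
  have hcont : ContinuousOn (fun p : ℝ × ℝ =>
      (w (circleMap c (max r₀ p.1) p.2) / w (circleMap c r₀ p.2)).re) (Iio r₁ ×ˢ univ) :=
    Complex.continuous_re.comp_continuousOn (hwc.div hwc2.continuousOn fun p _ => hw0 p.2)
  have hopen : IsOpen (Iio r₁ ×ˢ (univ : Set ℝ)) := isOpen_Iio.prod isOpen_univ
  have hev : ∀ᶠ s in 𝓝 r₀, ∀ θ ∈ Icc 0 (2 * Real.pi),
      0 < (w (circleMap c (max r₀ s) θ) / w (circleMap c r₀ θ)).re := by
    apply isCompact_Icc.eventually_forall_of_forall_eventually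
    intro θ _
    have hat := hcont.continuousAt (hopen.mem_nhds (show (r₀, θ) ∈ Iio r₁ ×ˢ univ from ⟨h01, trivial⟩))
    refine hat.eventually (lt_mem_nhds ?_)
    simp [div_self (hw0 θ)]
  obtain ⟨ε, hε, hball⟩ := Metric.eventually_nhds_iff.1 hev
  refine ⟨min ε (r₁ - r₀), lt_min hε (sub_pos.2 h01), ?_, fun r hr θ => ?_⟩
  · linarith [min_le_right ε (r₁ - r₀)]
  · obtain ⟨θ', hθ', heq⟩ : ∃ θ' ∈ Ico 0 (2 * Real.pi), ∀ r, circleMap c r θ = circleMap c r θ' := by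
      obtain ⟨θ', hθ', h⟩ := (periodic_circleMap 0 1).exists_mem_Ico₀ Real.two_pi_pos θ
      refine ⟨θ', hθ', fun r => ?_⟩
      simp only [circleMap, Complex.ofReal_one, one_mul, zero_add] at h ⊢
      rw [h]
    rw [heq, heq]
    have := hball (y := r) (by
      rw [Real.dist_eq, abs_of_pos (sub_pos.2 hr.1)]
      linarith [hr.2, min_le_left ε (r₁ - r₀)]) θ' ⟨hθ'.1, hθ'.2.le⟩
    rwa [max_eq_right hr.1.le] at this

/-- Near a circle on which a map has degree `d`, the integral of `Im (dw / w)` over concentric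
circles is `2πd`. -/
theorem exists_circle_integral_eq_degree {w : ℂ → ℂ} {c : ℂ} {r₀ r₁ : ℝ} {d : ℤ} (h0 : 0 < r₀)
    (h01 : r₀ < r₁) (hw : ContinuousOn w {z | r₀ ≤ ‖z - c‖ ∧ ‖z - c‖ < r₁})
    (hw1 : ContDiffOn ℝ 1 w {z | r₀ < ‖z - c‖ ∧ ‖z - c‖ < r₁})
    (hw0 : ∀ z, r₀ < ‖z - c‖ → ‖z - c‖ < r₁ → w z ≠ 0) (hd : HasDegreeOnCircle w c r₀ d) :
    ∃ ε > 0, r₀ + ε ≤ r₁ ∧ ∀ r ∈ Ioo r₀ (r₀ + ε),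
      (Continuous fun θ => (fderiv ℝ w (circleMap c r θ) (circleMap 0 r θ * Complex.I) /
        w (circleMap c r θ)).im) ∧
      ∫ θ in -Real.pi..Real.pi, (fderiv ℝ w (circleMap c r θ) (circleMap 0 r θ * Complex.I) /
        w (circleMap c r θ)).im = 2 * Real.pi * d := by
  obtain ⟨hd0, φ, hφ, hlift, hφd⟩ := hd
  obtain ⟨ε, hε, hε1, hpos⟩ := eventually_circle_re_pos h0 h01 hw hd0
  refine ⟨ε, hε, hε1, fun r hr => ?_⟩
  have hr0 : 0 < r := h0.trans hr.1
  have hr1 : r < r₁ := hr.2.trans_le hε1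
  have hn : ∀ θ, ‖circleMap c r θ - c‖ = r := fun θ => by
    rw [circleMap_sub_center, norm_circleMap_zero, abs_of_pos hr0]
  have hopen : IsOpen {z : ℂ | r₀ < ‖z - c‖ ∧ ‖z - c‖ < r₁} := by
    have hcn : Continuous fun z : ℂ => ‖z - c‖ := by fun_prop
    exact (isOpen_lt continuous_const hcn).inter (isOpen_lt hcn continuous_const)
  have hmem : ∀ θ, circleMap c r θ ∈ {z : ℂ | r₀ < ‖z - c‖ ∧ ‖z - c‖ < r₁} := fun θ => by
    rw [mem_ofPred_eq, hn]; exact ⟨hr.1, hr1⟩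
  have hw0' : ∀ θ, w (circleMap c r θ) ≠ 0 := fun θ => hw0 _ (hmem θ).1 (hmem θ).2
  set W' : ℝ → ℂ := fun θ => fderiv ℝ w (circleMap c r θ) (circleMap 0 r θ * Complex.I)
  have hW : ∀ θ, HasDerivAt (fun θ => w (circleMap c r θ)) (W' θ) θ := fun θ =>
    (((hw1.differentiableOn one_ne_zero).differentiableAt
      (hopen.mem_nhds (hmem θ))).hasFDerivAt).comp_hasDerivAt θ (hasDerivAt_circleMap c r θ)
  have hW' : Continuous W' := by
    have h1 : Continuous fun θ => fderiv ℝ w (circleMap c r θ) :=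
      (hw1.continuousOn_fderiv_of_isOpen hopen le_rfl).comp_continuous (continuous_circleMap c r) hmem
    exact h1.clm_apply ((continuous_circleMap 0 r).mul continuous_const)
  have hc0 : Continuous fun θ => w (circleMap c r₀ θ) := by
    refine hw.comp_continuous (continuous_circleMap c r₀) fun θ => ?_
    rw [mem_ofPred_eq, circleMap_sub_center, norm_circleMap_zero, abs_of_pos h0]
    exact ⟨le_rfl, h01⟩
  have hcr : Continuous fun θ => w (circleMap c r θ) :=
    continuous_iff_continuousAt.2 fun θ => (hW θ).continuousAt
  set q : ℝ → ℂ := fun θ => w (circleMap c r θ) / w (circleMap c r₀ θ)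
  have hq : Continuous fun θ => (q θ).arg := by
    rw [continuous_iff_continuousAt]
    intro θ
    exact ContinuousAt.comp (f := q) (Complex.continuousAt_arg (Or.inl (hpos r hr θ)))
      (hcr.div hc0 hd0).continuousAt
  have hlift' : ∀ θ, w (circleMap c r θ) = (‖w (circleMap c r θ)‖ : ℂ) *
      Complex.exp (((φ θ + (q θ).arg : ℝ) : ℂ) * Complex.I) := by
    intro θ
    have h1 : w (circleMap c r θ) = q θ * w (circleMap c r₀ θ) := by
      simp only [q]
      rw [div_mul_cancel₀ _ (hd0 θ)]
    have h2 := Complex.norm_mul_exp_arg_mul_I (q θ)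
    conv_lhs => rw [h1, ← h2, hlift θ]
    rw [h1, norm_mul]
    push_cast
    rw [add_mul, Complex.exp_add]
    ring
  -- Polar coordinates use (-π, π), the degree uses [0, 2π]; periodicity identifies the integrals.
  have hper : Function.Periodic (fun θ => (W' θ / w (circleMap c r θ)).im) (2 * Real.pi) := by
    intro θ
    simp only [W', periodic_circleMap c r θ, periodic_circleMap 0 r θ]
  have hshift := hper.intervalIntegral_add_eq (-Real.pi) 0
  rw [show -Real.pi + 2 * Real.pi = Real.pi by ring, zero_add] at hshift
  refine ⟨Complex.continuous_im.comp (hW'.div hcr hw0'), ?_⟩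
  rw [hshift, integral_logDeriv_eq_of_lift hW hW' hw0' (hφ.add hq) hlift']
  have hqp : q (2 * Real.pi) = q 0 := by
    have h1 := periodic_circleMap c r 0
    have h2 := periodic_circleMap c r₀ 0
    rw [zero_add] at h1 h2
    simp only [q, h1, h2]
  simp only [Pi.add_apply, hqp]
  linarith

/-! ### Radial cutoffs. -/

/-- A smooth radial function equal to `1` for `‖z - c‖ ≤ r₁` and to `0` for `‖z - c‖ ≥ r₂`. -/
noncomputable def radialCutoff (c : ℂ) (r₁ r₂ : ℝ) (z : ℂ) : ℝ :=
  Real.smoothTransition ((r₂ ^ 2 - ‖z - c‖ ^ 2) / (r₂ ^ 2 - r₁ ^ 2))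

section radialCutoff

variable {c : ℂ} {r₁ r₂ : ℝ}

lemma contDiff_radialCutoff : ContDiff ℝ 2 (radialCutoff c r₁ r₂) := by
  apply Real.smoothTransition.contDiff.comp
  exact (contDiff_const.sub ((contDiff_norm_sq ℝ).comp (contDiff_id.sub contDiff_const))).div_const _

lemma radialCutoff_eq_one (h1 : 0 ≤ r₁) (h12 : r₁ < r₂) {z : ℂ} (hz : ‖z - c‖ ≤ r₁) :
    radialCutoff c r₁ r₂ z = 1 := by
  apply Real.smoothTransition.one_of_one_le
  have : r₁ ^ 2 < r₂ ^ 2 := by gcongr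
  have : ‖z - c‖ ^ 2 ≤ r₁ ^ 2 := by gcongr
  rw [le_div_iff₀ (by linarith)]
  linarith

lemma radialCutoff_eq_zero (h1 : 0 ≤ r₁) (h12 : r₁ < r₂) {z : ℂ} (hz : r₂ ≤ ‖z - c‖) :
    radialCutoff c r₁ r₂ z = 0 := by
  apply Real.smoothTransition.zero_of_nonpos
  have h3 : r₁ ^ 2 < r₂ ^ 2 := by gcongr
  have : r₂ ^ 2 ≤ ‖z - c‖ ^ 2 := by have := h1.trans h12.le; gcongr
  exact div_nonpos_of_nonpos_of_nonneg (by linarith) (by linarith)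

lemma deriv_smoothTransition_eq_zero {x : ℝ} (hx : x ≤ 0 ∨ 1 ≤ x) :
    deriv Real.smoothTransition x = 0 := by
  rcases hx with hx | hx
  · apply IsLocalMin.deriv_eq_zero
    filter_upwards with y
    rw [Real.smoothTransition.zero_of_nonpos hx]
    exact Real.smoothTransition.nonneg y
  · apply IsLocalMax.deriv_eq_zero
    filter_upwards with y
    rw [Real.smoothTransition.one_of_one_le hx]
    exact Real.smoothTransition.le_one y

lemma fderiv_radialCutoff (z v : ℂ) : fderiv ℝ (radialCutoff c r₁ r₂) z v =
    deriv Real.smoothTransition ((r₂ ^ 2 - ‖z - c‖ ^ 2) / (r₂ ^ 2 - r₁ ^ 2)) *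
      (-2 / (r₂ ^ 2 - r₁ ^ 2)) * inner ℝ (z - c) v := by
  have h1 : HasFDerivAt (fun z : ℂ => ‖z - c‖ ^ 2) (2 • innerSL ℝ (z - c)) z := by
    have := ((hasFDerivAt_id (𝕜 := ℝ) z).sub_const c).norm_sq
    simpa using this
  have h2 : HasFDerivAt (fun z : ℂ => (r₂ ^ 2 - ‖z - c‖ ^ 2) / (r₂ ^ 2 - r₁ ^ 2))
      ((r₂ ^ 2 - r₁ ^ 2)⁻¹ • (-(2 • innerSL ℝ (z - c)) : ℂ →L[ℝ] ℝ)) z := by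
    simpa [div_eq_mul_inv] using (h1.const_sub (r₂ ^ 2)).mul_const (r₂ ^ 2 - r₁ ^ 2)⁻¹
  have hS : DifferentiableAt ℝ Real.smoothTransition
      ((r₂ ^ 2 - ‖z - c‖ ^ 2) / (r₂ ^ 2 - r₁ ^ 2)) :=
    (Real.smoothTransition.contDiff (n := 1)).differentiable one_ne_zero _
  have := (hS.hasDerivAt.comp_hasFDerivAt z h2).fderiv
  have e : radialCutoff c r₁ r₂ = Real.smoothTransition ∘ fun z : ℂ =>
    (r₂ ^ 2 - ‖z - c‖ ^ 2) / (r₂ ^ 2 - r₁ ^ 2) := rfl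
  rw [e, this]
  simp
  ring

lemma fderiv_radialCutoff_eq_zero (h1 : 0 ≤ r₁) (h12 : r₁ < r₂) {z : ℂ}
    (hz : ‖z - c‖ ≤ r₁ ∨ r₂ ≤ ‖z - c‖) : fderiv ℝ (radialCutoff c r₁ r₂) z = 0 := by
  ext v
  have h3 : r₁ ^ 2 < r₂ ^ 2 := by gcongr
  rw [fderiv_radialCutoff, deriv_smoothTransition_eq_zero, zero_mul, zero_mul, zero_apply]
  rcases hz with hz | hz
  · right
    have : ‖z - c‖ ^ 2 ≤ r₁ ^ 2 := by gcongr
    rw [le_div_iff₀ (by linarith)]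
    linarith
  · left
    have : r₂ ^ 2 ≤ ‖z - c‖ ^ 2 := by have := h1.trans h12.le; gcongr
    exact div_nonpos_of_nonpos_of_nonneg (by linarith) (by linarith)

/-- The differential of the cutoff is radial, so the wedge sees only the angular derivative of the
phase. On each circle this is a constant times the circulation density. -/
lemma wedgeArg_radialCutoff (w : ℂ → ℂ) {r θ : ℝ} (hr : 0 < r) :
    wedgeArg (radialCutoff c r₁ r₂) w (circleMap c r θ) =
      deriv Real.smoothTransition ((r₂ ^ 2 - r ^ 2) / (r₂ ^ 2 - r₁ ^ 2)) *
      (-2 / (r₂ ^ 2 - r₁ ^ 2)) * (fderiv ℝ w (circleMap c r θ) (circleMap 0 r θ * Complex.I) /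
        w (circleMap c r θ)).im := by
  have hlin : fderiv ℝ w (circleMap c r θ) (circleMap 0 r θ * Complex.I) =
      (r * Real.cos θ) • fderiv ℝ w (circleMap c r θ) Complex.I -
        (r * Real.sin θ) • fderiv ℝ w (circleMap c r θ) 1 := by
    rw [← map_smul, ← map_smul, ← map_sub]
    congr 1
    rw [circleMap_zero]
    rw [Complex.exp_mul_I, ← Complex.ofReal_cos, ← Complex.ofReal_sin]
    apply Complex.ext <;> simp
  have hn : ‖circleMap c r θ - c‖ = r := by
    rw [circleMap_sub_center, norm_circleMap_zero, abs_of_pos hr]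
  unfold wedgeArg
  rw [fderiv_radialCutoff, fderiv_radialCutoff, hn, hlin, circleMap_sub_center]
  have e1 : inner ℝ (circleMap 0 r θ) 1 = r * Real.cos θ := by
    simp [circleMap_zero, Complex.inner, Complex.exp_re]
  have e2 : inner ℝ (circleMap 0 r θ) Complex.I = r * Real.sin θ := by
    simp [circleMap_zero, Complex.inner, Complex.exp_im]
  have e3 : ∀ (x y : ℝ) (p q s : ℂ), ((x • p - y • q) / s).im = x * (p / s).im - y * (q / s).im := by
    intro x y p q s
    rw [sub_div, smul_div_assoc, smul_div_assoc, Complex.sub_im, Complex.smul_im,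
      Complex.smul_im, smul_eq_mul, smul_eq_mul]
  rw [e1, e2, e3]
  ring

/-- Radial exact forms are orthogonal to closed forms without circulation. -/
lemma integral_wedgeArg_radialCutoff_sub_eq_zero {u v : ℂ → ℂ} {r₀ ε : ℝ} (h0 : 0 ≤ r₀)
    (h1 : r₀ < r₁) (h12 : r₁ < r₂) (h2 : r₂ < r₀ + ε)
    (hcirc : ∀ r ∈ Ioo r₀ (r₀ + ε), ∫ θ in -Real.pi..Real.pi,
      ((fderiv ℝ u (circleMap c r θ) (circleMap 0 r θ * Complex.I) / u (circleMap c r θ)).im -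
      (fderiv ℝ v (circleMap c r θ) (circleMap 0 r θ * Complex.I) / v (circleMap c r θ)).im) = 0) :
    ∫ z, (wedgeArg (radialCutoff c r₁ r₂) u z - wedgeArg (radialCutoff c r₁ r₂) v z) = 0 := by
  set F : ℂ → ℝ := fun z =>
    wedgeArg (radialCutoff c r₁ r₂) u z - wedgeArg (radialCutoff c r₁ r₂) v z with hF
  rw [← integral_add_left_eq_self F c, ← Complex.integral_comp_polarCoord_symm,
    polarCoord_target, Measure.volume_eq_prod, ← Measure.prod_restrict]
  have hinner : ∀ r ∈ Ioi (0 : ℝ), ∫ θ in Ioo (-Real.pi) Real.pi,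
      r • F (c + Complex.polarCoord.symm (r, θ)) = 0 := by
    intro r hr
    have e : ∀ θ, c + Complex.polarCoord.symm (r, θ) = circleMap c r θ := by
      intro θ
      simp [Complex.polarCoord_symm_apply, circleMap, Complex.exp_mul_I]
    simp_rw [e, hF, wedgeArg_radialCutoff _ hr, ← mul_sub, smul_eq_mul, integral_const_mul]
    by_cases hrr : r ∈ Ioo r₀ (r₀ + ε)
    · have := hcirc r hrr
      rw [intervalIntegral.integral_of_le (by linarith [Real.pi_pos]), integral_Ioc_eq_integral_Ioo]
        at this
      rw [this, mul_zero, mul_zero]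
    · have hr1 : 0 ≤ r₁ := h0.trans h1.le
      have h3 : r₁ ^ 2 < r₂ ^ 2 := by gcongr
      rw [deriv_smoothTransition_eq_zero]
      · ring
      · have hr0 : 0 ≤ r := le_of_lt hr
        by_cases hrr0 : r ≤ r₀
        · right
          have : r ^ 2 ≤ r₁ ^ 2 := by gcongr; linarith
          rw [le_div_iff₀ (by linarith)]
          linarith
        · left
          have h4 : r₀ + ε ≤ r := by
            by_contra hlt
            exact hrr ⟨not_le.1 hrr0, not_le.1 hlt⟩
          have : r₂ ^ 2 ≤ r ^ 2 := by have := hr1.trans h12.le; gcongr; linarith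
          exact div_nonpos_of_nonpos_of_nonneg (by linarith) (by linarith)
  -- Without integrability the Bochner integral is 0 by convention, so both cases give the claim.
  by_cases hint : Integrable (fun p : ℝ × ℝ => p.1 • F (c + Complex.polarCoord.symm p))
      ((volume.restrict (Ioi (0 : ℝ))).prod (volume.restrict (Ioo (-Real.pi) Real.pi)))
  · rw [integral_prod _ hint]
    exact setIntegral_eq_zero_of_forall_eq_zero hinner
  · exact integral_undef hint

end radialCutoff

/-! ### Orthogonality in the perforated disc. -/

lemma isOpen_perforatedDisc {m : ℕ} {R R₀ : ℝ} {pt : Fin m → ℂ} :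
    IsOpen (perforatedDisc R R₀ pt) :=
  Metric.isOpen_ball.sdiff (isClosed_iUnion_of_finite fun _ => Metric.isClosed_closedBall)

lemma mem_perforatedDisc {m : ℕ} {R R₀ : ℝ} {pt : Fin m → ℂ} {z : ℂ} :
    z ∈ perforatedDisc R R₀ pt ↔ ‖z‖ < R ∧ ∀ j, R₀ < ‖z - pt j‖ := by
  simp [perforatedDisc, dist_eq_norm]

/-- Two closed forms `Im (du / u)`, `Im (dv / v)` in a perforated disc with equal circulations have
the same pairing with `dh`, if `h` is constant near each boundary component. -/
theorem setIntegral_wedgeArg_sub_eq_zero {m : ℕ} {R R₀ : ℝ} {pt : Fin m → ℂ} (hR₀ : 0 < R₀)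
    (hR : R₀ ≤ R / 4) (hsep : ∀ i j, i ≠ j → 4 * R₀ ≤ ‖pt i - pt j‖) (hpt : ∀ i, ‖pt i‖ ≤ R / 2)
    {u v : ℂ → ℂ} (hu : ContDiffOn ℝ 1 u (perforatedDisc R R₀ pt))
    (hv : ContDiffOn ℝ 1 v (perforatedDisc R R₀ pt))
    (hu0 : ∀ z ∈ perforatedDisc R R₀ pt, u z ≠ 0) (hv0 : ∀ z ∈ perforatedDisc R R₀ pt, v z ≠ 0)
    (hcirc : ∀ k, ∃ ε > 0, ∀ r ∈ Ioo R₀ (R₀ + ε), ∫ θ in -Real.pi..Real.pi,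
      ((fderiv ℝ u (circleMap (pt k) r θ) (circleMap 0 r θ * Complex.I) /
          u (circleMap (pt k) r θ)).im -
        (fderiv ℝ v (circleMap (pt k) r θ) (circleMap 0 r θ * Complex.I) /
          v (circleMap (pt k) r θ)).im) = 0)
    {h : ℂ → ℝ} (hh : ContDiff ℝ 2 h) {c : Fin m → ℝ} {c₀ η : ℝ} (hη : 0 < η)
    (hc : ∀ k z, ‖z - pt k‖ < R₀ + η → h z = c k) (hc₀ : ∀ z, R - η < ‖z‖ → h z = c₀) :
    IntegrableOn (wedgeArg h u) (perforatedDisc R R₀ pt) ∧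
    IntegrableOn (wedgeArg h v) (perforatedDisc R R₀ pt) ∧
    ∫ z in perforatedDisc R R₀ pt, (wedgeArg h u z - wedgeArg h v z) = 0 := by
  choose ε hε hcirc using hcirc
  obtain ⟨e, he0, heη, heR, heε⟩ : ∃ e > 0, e < η ∧ e < R₀ ∧ ∀ k, e < ε k := by
    have h1 : ∀ x > (0 : ℝ), ∀ᶠ e in 𝓝[>] (0 : ℝ), e < x := fun x hx =>
      nhdsWithin_le_nhds (Iio_mem_nhds hx)
    obtain ⟨e, h⟩ := ((eventually_mem_nhdsWithin (a := (0 : ℝ)) (s := Ioi 0)).and ((h1 η hη).and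
      ((h1 R₀ hR₀).and (eventually_all.2 fun k => h1 _ (hε k))))).exists
    exact ⟨e, h⟩
  set K : Set ℂ := {z | ‖z‖ ≤ R - e / 3 ∧ ∀ k, R₀ + e / 3 ≤ ‖z - pt k‖} with hKdef
  have hKΩ : K ⊆ perforatedDisc R R₀ pt := fun z hz =>
    mem_perforatedDisc.2 ⟨by linarith [hz.1], fun j => by linarith [hz.2 j]⟩
  have hKcl : IsClosed K := by
    have : K = {z : ℂ | ‖z‖ ≤ R - e / 3} ∩ ⋂ k, {z | R₀ + e / 3 ≤ ‖z - pt k‖} := by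
      ext z; simp [hKdef]
    rw [this]
    exact (isClosed_le continuous_norm continuous_const).inter
      (isClosed_iInter fun k => isClosed_le continuous_const (by fun_prop))
  have hKc : IsCompact K := by
    refine (isCompact_closedBall (0 : ℂ) R).of_isClosed_subset hKcl fun z hz => ?_
    rw [mem_closedBall_zero_iff]
    linarith [hz.1]
  have hnotK : ∀ z ∉ K, R - e / 3 < ‖z‖ ∨ ∃ k, ‖z - pt k‖ < R₀ + e / 3 := by
    intro z hz
    by_contra! hcon
    exact hz hcon
  have hhK : ∀ z ∉ K, fderiv ℝ h z = 0 := by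
    intro z hz
    rcases hnotK z hz with h1 | ⟨k, h1⟩
    · have : h =ᶠ[𝓝 z] fun _ => c₀ := by
        filter_upwards [(isOpen_lt continuous_const continuous_norm).mem_nhds h1] with y hy
        have hy' : R - e / 3 < ‖y‖ := hy
        exact hc₀ y (by linarith)
      rw [this.fderiv_eq]; simp
    · have : h =ᶠ[𝓝 z] fun _ => c k := by
        have hcn : Continuous fun z : ℂ => ‖z - pt k‖ := by fun_prop
        filter_upwards [(isOpen_lt hcn continuous_const).mem_nhds h1] with y hy
        have hy' : ‖y - pt k‖ < R₀ + e / 3 := hy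
        exact hc k y (by linarith)
      rw [this.fderiv_eq]; simp
  have hIu := integrable_wedgeArg isOpen_perforatedDisc hh hKc hKΩ hhK hu hu0
  have hIv := integrable_wedgeArg isOpen_perforatedDisc hh hKc hKΩ hhK hv hv0
  refine ⟨hIu.integrableOn, hIv.integrableOn, ?_⟩
  rw [setIntegral_eq_integral_of_forall_compl_eq_zero fun z hz => by
    rw [wedgeArg_eq_zero (hhK z fun hk => hz (hKΩ hk)),
      wedgeArg_eq_zero (hhK z fun hk => hz (hKΩ hk)), sub_zero]]
  set χ : Fin m → ℂ → ℝ := fun k => radialCutoff (pt k) (R₀ + e / 3) (R₀ + 2 * e / 3) with hχ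
  have hχd : ∀ k, ContDiff ℝ 2 (χ k) := fun k => contDiff_radialCutoff
  have hr1 : 0 ≤ R₀ + e / 3 := by positivity
  have hr12 : R₀ + e / 3 < R₀ + 2 * e / 3 := by linarith
  -- Subtracting the constants through cutoffs makes the support compact in the perforated disc,
  -- where closedness suffices. The cutoffs are radial about the holes, and for them equality of the
  -- circulations is what matters.
  set g : ℂ → ℝ := fun z => h z - c₀ - ∑ k, (c k - c₀) * χ k z with hg
  have hgd : ContDiff ℝ 2 g :=
    (hh.sub contDiff_const).sub (ContDiff.sum fun k _ => contDiff_const.mul (hχd k))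
  have hgK : ∀ z ∉ K, g z = 0 := by
    intro z hz
    rcases hnotK z hz with h1 | ⟨k, h1⟩
    · have hχ0 : ∀ k, χ k z = 0 := by
        intro k
        apply radialCutoff_eq_zero hr1 hr12
        have := norm_sub_norm_le z (pt k)
        linarith [hpt k]
      simp [hg, hχ0, hc₀ z (by linarith)]
    · have hχ0 : ∀ j, j ≠ k → χ j z = 0 := by
        intro j hj
        apply radialCutoff_eq_zero hr1 hr12
        have h3 := hsep k j hj.symm
        have h4 := norm_sub_le (z - pt j) (z - pt k)
        rw [show z - pt j - (z - pt k) = pt k - pt j by ring] at h4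
        linarith
      have hχ1 : χ k z = 1 := radialCutoff_eq_one hr1 hr12 h1.le
      simp only [hg]
      rw [Finset.sum_eq_single k (fun j _ hj => by rw [hχ0 j hj, mul_zero])
        (fun hk => absurd (Finset.mem_univ k) hk), hχ1, hc k z (by linarith)]
      ring
  have hgts : tsupport g ⊆ K :=
    closure_minimal (fun z hz => by by_contra hk; exact hz (hgK z hk)) hKcl
  have hgc : HasCompactSupport g := hKc.of_isClosed_subset (isClosed_tsupport g) hgts
  have hfd : ∀ z w, fderiv ℝ h z w = fderiv ℝ g z w + ∑ k, (c k - c₀) * fderiv ℝ (χ k) z w := by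
    intro z w
    have hd : HasFDerivAt g (fderiv ℝ h z - ∑ k, (c k - c₀) • fderiv ℝ (χ k) z) z :=
      ((hh.differentiable two_ne_zero z).hasFDerivAt.sub_const c₀).sub
        (HasFDerivAt.fun_sum fun k _ =>
          ((hχd k).differentiable two_ne_zero z).hasFDerivAt.const_mul (c k - c₀))
    rw [hd.fderiv]
    simp [sum_apply]
  have hdecomp : ∀ w z, wedgeArg h w z = wedgeArg g w z + ∑ k, (c k - c₀) * wedgeArg (χ k) w z := by
    intro w z
    simp only [wedgeArg, hfd, add_mul, Finset.sum_mul, mul_sub, Finset.sum_sub_distrib, mul_assoc]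
    ring
  have hχK : ∀ k, IsCompact {z : ℂ | R₀ + e / 3 ≤ ‖z - pt k‖ ∧ ‖z - pt k‖ ≤ R₀ + 2 * e / 3} := by
    intro k
    have hcn : Continuous fun z : ℂ => ‖z - pt k‖ := by fun_prop
    refine (isCompact_closedBall (pt k) (R₀ + 2 * e / 3)).of_isClosed_subset
      ((isClosed_le continuous_const hcn).inter (isClosed_le hcn continuous_const)) fun z hz => ?_
    rw [Metric.mem_closedBall, dist_eq_norm]
    exact hz.2
  have hχKΩ : ∀ k, {z : ℂ | R₀ + e / 3 ≤ ‖z - pt k‖ ∧ ‖z - pt k‖ ≤ R₀ + 2 * e / 3} ⊆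
      perforatedDisc R R₀ pt := by
    rintro k z ⟨hz1, hz2⟩
    refine mem_perforatedDisc.2 ⟨?_, fun j => ?_⟩
    · have := norm_sub_norm_le z (pt k)
      linarith [hpt k]
    · rcases eq_or_ne j k with rfl | hj
      · linarith
      · have h3 := hsep k j hj.symm
        have h4 := norm_sub_le (z - pt j) (z - pt k)
        rw [show z - pt j - (z - pt k) = pt k - pt j by ring] at h4
        linarith
  have hχz : ∀ k, ∀ z ∉ {z : ℂ | R₀ + e / 3 ≤ ‖z - pt k‖ ∧ ‖z - pt k‖ ≤ R₀ + 2 * e / 3},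
      fderiv ℝ (χ k) z = 0 := by
    intro k z hz
    apply fderiv_radialCutoff_eq_zero hr1 hr12
    by_contra! hcon
    exact hz ⟨hcon.1.le, hcon.2.le⟩
  have hIχu : ∀ k, Integrable (wedgeArg (χ k) u) := fun k =>
    integrable_wedgeArg isOpen_perforatedDisc (hχd k) (hχK k) (hχKΩ k) (hχz k) hu hu0
  have hIχv : ∀ k, Integrable (wedgeArg (χ k) v) := fun k =>
    integrable_wedgeArg isOpen_perforatedDisc (hχd k) (hχK k) (hχKΩ k) (hχz k) hv hv0
  have hgz : ∀ z ∉ K, fderiv ℝ g z = 0 := fun z hz =>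
    fderiv_eq_zero_of_notMem_tsupport fun hzt => hz (hgts hzt)
  have hIgu := integrable_wedgeArg isOpen_perforatedDisc hgd hKc hKΩ hgz hu hu0
  have hIgv := integrable_wedgeArg isOpen_perforatedDisc hgd hKc hKΩ hgz hv hv0
  have e1 : ∀ z, wedgeArg h u z - wedgeArg h v z = (wedgeArg g u z - wedgeArg g v z) +
      ∑ k, (c k - c₀) * (wedgeArg (χ k) u z - wedgeArg (χ k) v z) := by
    intro z
    rw [hdecomp u, hdecomp v]
    simp only [mul_sub, Finset.sum_sub_distrib]
    ring
  have i1 : Integrable fun z => wedgeArg g u z - wedgeArg g v z := hIgu.sub hIgv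
  have i2 : ∀ k, Integrable fun z => (c k - c₀) * (wedgeArg (χ k) u z - wedgeArg (χ k) v z) :=
    fun k => ((hIχu k).sub (hIχv k)).const_mul _
  simp_rw [e1]
  rw [integral_add i1 (integrable_finsetSum _ fun k _ => i2 k), integral_sub hIgu hIgv,
    integral_wedgeArg_eq_zero isOpen_perforatedDisc hu hu0 hgd hgc (hgts.trans hKΩ),
    integral_wedgeArg_eq_zero isOpen_perforatedDisc hv hv0 hgd hgc (hgts.trans hKΩ),
    integral_finsetSum _ fun k _ => i2 k]
  simp only [sub_zero, zero_add]
  refine Finset.sum_eq_zero fun k _ => ?_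
  rw [integral_const_mul, integral_wedgeArg_radialCutoff_sub_eq_zero hR₀.le (by linarith) hr12
    (by linarith [heε k]) (hcirc k), mul_zero]

/-! ### The canonical map and its phase. -/

/-- The logarithmic derivative `∑ⱼ dⱼ / (z - aⱼ)` of `∏ⱼ (z - aⱼ) ^ dⱼ`. -/
noncomputable def vortexField {m : ℕ} (pt : Fin m → ℂ) (deg : Fin m → ℤ) (z : ℂ) : ℂ :=
  ∑ j, (deg j : ℂ) * (z - pt j)⁻¹

/-- `f` is differentiable at `z` with purely imaginary logarithmic derivative `i α`. -/
def HasPhaseDerivAt (f : ℂ → ℂ) (α : ℂ → ℝ) (z : ℂ) : Prop :=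
  ∃ L : ℂ →L[ℝ] ℂ, HasFDerivAt f L z ∧ ∀ v, L v = f z * (Complex.I * α v)

lemma hasFDerivAt_norm_sub {a z : ℂ} (hz : z ≠ a) :
    HasFDerivAt (fun z : ℂ => ‖z - a‖) (‖z - a‖⁻¹ • innerSL ℝ (z - a)) z := by
  have hn0 : ‖z - a‖ ≠ 0 := norm_ne_zero_iff.2 (sub_ne_zero.2 hz)
  have h1 : HasFDerivAt (fun z : ℂ => ‖z - a‖ ^ 2) (2 • innerSL ℝ (z - a)) z := by
    simpa using ((hasFDerivAt_id (𝕜 := ℝ) z).sub_const a).norm_sq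
  have h2 := h1.sqrt (pow_ne_zero 2 hn0)
  simp only [Real.sqrt_sq (norm_nonneg _)] at h2
  refine h2.congr_fderiv ?_
  ext v
  simp only [smul_apply, smul_eq_mul, nsmul_eq_mul, innerSL_apply_apply]
  push_cast
  field_simp

lemma hasPhaseDerivAt_sub_div_norm {a z : ℂ} (hz : z ≠ a) :
    HasPhaseDerivAt (fun z => (z - a) / (‖z - a‖ : ℂ)) (fun v => (v * (z - a)⁻¹).im) z := by
  have hs : z - a ≠ 0 := sub_ne_zero.2 hz
  have hn0 : ‖z - a‖ ≠ 0 := norm_ne_zero_iff.2 hs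
  have hN := hasFDerivAt_norm_sub hz
  have hNc : HasFDerivAt (fun z : ℂ => (‖z - a‖ : ℂ))
      (Complex.ofRealCLM.comp (‖z - a‖⁻¹ • innerSL ℝ (z - a))) z :=
    Complex.ofRealCLM.hasFDerivAt.comp z hN
  have hnc0 : (‖z - a‖ : ℂ) ≠ 0 := by exact_mod_cast hn0
  have hinv : HasFDerivAt (fun z : ℂ => ((‖z - a‖ : ℂ))⁻¹) _ z :=
    (((hasDerivAt_inv hnc0).hasFDerivAt).restrictScalars ℝ).comp z hNc
  have hmul := ((hasFDerivAt_id (𝕜 := ℝ) z).sub_const a).mul hinv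
  refine ⟨_, hmul, fun v => ?_⟩
  -- Relative to z - a, the real part of q is the radial component, which the normalisation kills,
  -- and the imaginary part is the angular one.
  obtain ⟨q, rfl⟩ : ∃ q, v = (z - a) * q := ⟨v / (z - a), by field_simp⟩
  have hin : inner ℝ (z - a) ((z - a) * q) = ‖z - a‖ ^ 2 * q.re := by
    rw [Complex.inner, mul_right_comm, Complex.mul_conj, Complex.re_ofReal_mul, Complex.sq_norm]
  have hN2 : ‖z - a‖⁻¹ * inner ℝ (z - a) ((z - a) * q) = ‖z - a‖ * q.re := by
    rw [hin]; field_simp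
  have e : (z - a) * q * (z - a)⁻¹ = q := by field_simp
  dsimp only
  rw [e]
  simp only [id_eq, add_apply, smul_apply, ContinuousLinearMap.comp_apply,
    ContinuousLinearMap.coe_restrictScalars', ContinuousLinearMap.toSpanSingleton_apply,
    innerSL_apply_apply, smul_eq_mul, hN2, Complex.ofRealCLM_apply, ContinuousLinearMap.id_apply]
  push_cast
  have hq : q = q.re + q.im * Complex.I := (Complex.re_add_im q).symm
  generalize hre : q.re = x at *
  generalize him : q.im = y at *
  rw [hq]
  field_simp
  ring

lemma HasPhaseDerivAt.zpow {f : ℂ → ℂ} {α : ℂ → ℝ} {z : ℂ} (h : HasPhaseDerivAt f α z)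
    (hf : f z ≠ 0) (n : ℤ) : HasPhaseDerivAt (fun z => f z ^ n) (fun v => n * α v) z := by
  obtain ⟨L, hL, hLv⟩ := h
  refine ⟨_, (((hasDerivAt_zpow n (f z) (Or.inl hf)).hasFDerivAt).restrictScalars ℝ).comp z hL,
    fun v => ?_⟩
  simp [hLv, zpow_sub_one₀ hf]
  field_simp

lemma HasPhaseDerivAt.finset_prod {ι : Type*} (s : Finset ι) {f : ι → ℂ → ℂ} {α : ι → ℂ → ℝ} {z : ℂ}
    (h : ∀ i ∈ s, HasPhaseDerivAt (f i) (α i) z) :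
    HasPhaseDerivAt (fun z => ∏ i ∈ s, f i z) (fun v => ∑ i ∈ s, α i v) z := by
  classical
  induction s using Finset.induction_on with
  | empty => exact ⟨0, by simpa using hasFDerivAt_const (1 : ℂ) z, by simp⟩
  | insert i s hi ih =>
    obtain ⟨L, hL, hLv⟩ := ih fun j hj => h j (Finset.mem_insert_of_mem hj)
    obtain ⟨M, hM, hMv⟩ := h i (Finset.mem_insert_self i s)
    simp_rw [Finset.prod_insert hi, Finset.sum_insert hi]
    refine ⟨_, hM.mul hL, fun v => ?_⟩
    simp [hLv, hMv]
    ring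

section canonicalMap

variable {m : ℕ} {pt : Fin m → ℂ} {deg : Fin m → ℤ} {z : ℂ}

lemma sub_div_norm_ne_zero {a z : ℂ} (hz : z ≠ a) : (z - a) / (‖z - a‖ : ℂ) ≠ 0 := by
  have hs : z - a ≠ 0 := sub_ne_zero.2 hz
  exact div_ne_zero hs (by exact_mod_cast norm_ne_zero_iff.2 hs)

lemma canonicalMap_ne_zero (hz : ∀ j, z ≠ pt j) : canonicalMap pt deg z ≠ 0 :=
  Finset.prod_ne_zero_iff.2 fun j _ => zpow_ne_zero _ (sub_div_norm_ne_zero (hz j))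

lemma norm_canonicalMap (hz : ∀ j, z ≠ pt j) : ‖canonicalMap pt deg z‖ = 1 := by
  unfold canonicalMap
  rw [norm_prod]
  refine Finset.prod_eq_one fun j _ => ?_
  rw [norm_zpow, norm_div, Complex.norm_real, norm_norm,
    div_self (norm_ne_zero_iff.2 (sub_ne_zero.2 (hz j))), one_zpow]

lemma hasPhaseDerivAt_canonicalMap (hz : ∀ j, z ≠ pt j) :
    HasPhaseDerivAt (canonicalMap pt deg) (fun v => (v * vortexField pt deg z).im) z := by
  have h := HasPhaseDerivAt.finset_prod Finset.univ fun j _ =>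
    (hasPhaseDerivAt_sub_div_norm (hz j)).zpow (sub_div_norm_ne_zero (hz j)) (deg j)
  have e : (fun v => (v * vortexField pt deg z).im) =
      fun v => ∑ j, (deg j : ℝ) * (v * (z - pt j)⁻¹).im := by
    ext v
    unfold vortexField
    rw [Finset.mul_sum, Complex.im_sum]
    refine Finset.sum_congr rfl fun j _ => ?_
    rw [show v * (deg j * (z - pt j)⁻¹) = ((deg j : ℝ) : ℂ) * (v * (z - pt j)⁻¹) by
      push_cast; ring, Complex.im_ofReal_mul]
  rw [e]
  exact h

lemma fderiv_canonicalMap (hz : ∀ j, z ≠ pt j) (v : ℂ) : fderiv ℝ (canonicalMap pt deg) z v =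
    canonicalMap pt deg z * (Complex.I * ((v * vortexField pt deg z).im : ℝ)) := by
  obtain ⟨L, hL, hLv⟩ := hasPhaseDerivAt_canonicalMap (deg := deg) hz
  rw [hL.fderiv, hLv]

lemma fderiv_canonicalMap_div_im (hz : ∀ j, z ≠ pt j) (v : ℂ) :
    (fderiv ℝ (canonicalMap pt deg) z v / canonicalMap pt deg z).im =
      (v * vortexField pt deg z).im := by
  rw [fderiv_canonicalMap hz, mul_div_cancel_left₀ _ (canonicalMap_ne_zero hz), Complex.I_mul_im,
    Complex.ofReal_re]

lemma gradSq_canonicalMap (hz : ∀ j, z ≠ pt j) :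
    gradSq (canonicalMap pt deg) z = ‖vortexField pt deg z‖ ^ 2 := by
  unfold gradSq
  rw [fderiv_canonicalMap hz, fderiv_canonicalMap hz, Complex.sq_norm (vortexField pt deg z),
    Complex.normSq_apply]
  simp only [norm_mul, norm_canonicalMap hz, Complex.norm_I, Complex.norm_real, Real.norm_eq_abs,
    one_mul, sq_abs, Complex.I_mul_im]
  ring

lemma contDiffAt_zpow {n : ℤ} {x : ℂ} (hx : x ≠ 0) : ContDiffAt ℝ 1 (fun x : ℂ => x ^ n) x := by
  obtain ⟨k, rfl | rfl⟩ := n.eq_nat_or_neg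
  · simp only [zpow_natCast]; exact contDiffAt_id.pow k
  · simp only [zpow_neg, zpow_natCast]; exact (contDiffAt_id.pow k).inv (pow_ne_zero k hx)

lemma contDiffAt_canonicalMap (hz : ∀ j, z ≠ pt j) : ContDiffAt ℝ 1 (canonicalMap pt deg) z := by
  unfold canonicalMap
  refine contDiffAt_prod fun j _ => ?_
  have hs : z - pt j ≠ 0 := sub_ne_zero.2 (hz j)
  have h1 : ContDiffAt ℝ 1 (fun z : ℂ => z - pt j) z := contDiffAt_id.sub contDiffAt_const
  have h2 : ContDiffAt ℝ 1 (fun z : ℂ => (‖z - pt j‖ : ℂ)) z :=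
    Complex.ofRealCLM.contDiff.contDiffAt.comp z (h1.norm ℝ hs)
  have h3 : ContDiffAt ℝ 1 (fun z : ℂ => (z - pt j) / (‖z - pt j‖ : ℂ)) z := by
    simp only [div_eq_mul_inv]
    exact h1.mul (h2.inv (by exact_mod_cast norm_ne_zero_iff.2 hs))
  exact (contDiffAt_zpow (sub_div_norm_ne_zero (hz j))).comp z h3

/-- The circulation of the canonical phase around a point `aₖ` is `2πdₖ`. -/
lemma circle_integral_canonicalMap {R₀ r : ℝ} (hsep : ∀ i j, i ≠ j → 4 * R₀ ≤ ‖pt i - pt j‖)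
    (k : Fin m) (h0 : 0 < r) (hr : r < 4 * R₀) :
    (Continuous fun θ => (fderiv ℝ (canonicalMap pt deg) (circleMap (pt k) r θ)
        (circleMap 0 r θ * Complex.I) / canonicalMap pt deg (circleMap (pt k) r θ)).im) ∧
      ∫ θ in -Real.pi..Real.pi, (fderiv ℝ (canonicalMap pt deg) (circleMap (pt k) r θ)
        (circleMap 0 r θ * Complex.I) / canonicalMap pt deg (circleMap (pt k) r θ)).im =
          2 * Real.pi * deg k := by
  have hsph : ∀ j, ∀ z ∈ Metric.sphere (pt k) r, z ≠ pt j := by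
    rintro j z hz rfl
    rw [mem_sphere_iff_norm] at hz
    rcases eq_or_ne j k with rfl | hjk
    · rw [sub_self, norm_zero] at hz; exact h0.ne hz
    · linarith [hsep j k hjk]
  have hne : ∀ θ j, circleMap (pt k) r θ ≠ pt j := fun θ j =>
    hsph j _ (circleMap_mem_sphere _ h0.le θ)
  have hFc : ∀ j, ContinuousOn (fun z : ℂ => (deg j : ℂ) * (z - pt j)⁻¹) (Metric.sphere (pt k) r) :=
    fun j => continuousOn_const.mul ((continuousOn_id.sub continuousOn_const).inv₀
      fun z hz => sub_ne_zero.2 (hsph j z hz))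
  have hFcont : Continuous fun θ => vortexField pt deg (circleMap (pt k) r θ) := by
    unfold vortexField
    exact continuous_finsetSum _ fun j _ => (hFc j).comp_continuous (continuous_circleMap _ _)
      fun θ => circleMap_mem_sphere _ h0.le θ
  have hc : Continuous fun θ => circleMap 0 r θ * Complex.I *
      vortexField pt deg (circleMap (pt k) r θ) :=
    ((continuous_circleMap 0 r).mul continuous_const).mul hFcont
  have hcirc : (∮ z in C(pt k, r), vortexField pt deg z) = 2 * Real.pi * Complex.I * deg k := by
    unfold vortexField
    rw [circleIntegral.integral_fun_sum fun j _ => (hFc j).circleIntegrable h0.le,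
      Finset.sum_eq_single k]
    · rw [circleIntegral.integral_const_mul,
        circleIntegral.integral_sub_inv_of_mem_ball (Metric.mem_ball_self h0)]
      ring
    · intro j _ hjk
      have hcb : ∀ z ∈ Metric.closedBall (pt k) r, z - pt j ≠ 0 := by
        intro z hz h
        rw [sub_eq_zero.1 h, mem_closedBall_iff_norm] at hz
        linarith [hsep j k hjk]
      have hcc : ContinuousOn (fun z => (z - pt j)⁻¹) (Metric.closedBall (pt k) r) :=
        (continuousOn_id.sub continuousOn_const).inv₀ hcb
      rw [circleIntegral.integral_const_mul,
        Complex.circleIntegral_eq_zero_of_differentiable_on_off_countable h0.le countable_empty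
          hcc, mul_zero]
      intro z hz
      exact (differentiableAt_id.sub_const _).inv (hcb z (Metric.ball_subset_closedBall hz.1))
    · exact fun h => absurd (Finset.mem_univ k) h
  simp_rw [fderiv_canonicalMap_div_im (hne _)]
  refine ⟨Complex.continuous_im.comp hc, ?_⟩
  have hper : Function.Periodic (fun θ => (circleMap 0 r θ * Complex.I *
      vortexField pt deg (circleMap (pt k) r θ)).im) (2 * Real.pi) := by
    intro θ
    simp only [periodic_circleMap (pt k) r θ, periodic_circleMap 0 r θ]
  have hshift := hper.intervalIntegral_add_eq (-Real.pi) 0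
  rw [show -Real.pi + 2 * Real.pi = Real.pi by ring, zero_add] at hshift
  rw [hshift]
  have := Complex.imCLM.intervalIntegral_comp_comm (hc.intervalIntegrable (μ := volume) 0 (2 * Real.pi))
  simp only [Complex.imCLM_apply] at this
  rw [this]
  have h2 : (∮ z in C(pt k, r), vortexField pt deg z) = ∫ θ in (0 : ℝ)..2 * Real.pi,
      circleMap 0 r θ * Complex.I * vortexField pt deg (circleMap (pt k) r θ) := by
    simp [circleIntegral, deriv_circleMap]
  rw [← h2, hcirc]
  simp

end canonicalMap

/-! ### Stream functions with boundary cutoffs. -/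

/-- The gradient of a real function, reflected so that it is `f'` if `h` is the real part of a
holomorphic function `f`. -/
noncomputable def streamField (h : ℂ → ℝ) (z : ℂ) : ℂ :=
  ⟨fderiv ℝ h z 1, -fderiv ℝ h z Complex.I⟩

/-- The composite H(|z - a|) has (1 - T(|z - a|/R₀))/(z - a) as its reflected gradient; for T = 0 it
is log|z - a| up to a constant. -/
lemma exists_primitive {T : ℝ → ℝ} (hT : ContDiffOn ℝ 2 T (Ioi 0)) {R₀ : ℝ} (hR₀ : 0 < R₀) :
    ∃ H : ℝ → ℝ, ContDiffOn ℝ 2 H (Ioi 0) ∧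
      ∀ r > 0, HasDerivAt H ((1 - T (r / R₀)) * r⁻¹) r := by
  set k : ℝ → ℝ := fun r => (1 - T (r / R₀)) * r⁻¹ with hk
  have hkd : ContDiffOn ℝ 1 k (Ioi 0) := by
    have h1 : ContDiffOn ℝ 2 (fun r => T (r / R₀)) (Ioi 0) :=
      hT.comp (contDiff_id.div_const R₀).contDiffOn fun r (hr : 0 < r) => div_pos hr hR₀
    exact ((contDiffOn_const.sub h1).of_le (by norm_num)).mul
      (contDiffOn_id.inv fun r (hr : 0 < r) => hr.ne')
  have hd : ∀ r > 0, HasDerivAt (fun r => ∫ s in R₀..r, k s) (k r) r := by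
    intro r hr
    apply intervalIntegral.integral_hasDerivAt_right
    · apply ContinuousOn.intervalIntegrable
      exact hkd.continuousOn.mono fun x hx => lt_of_lt_of_le (lt_min hR₀ hr) hx.1
    · exact hkd.continuousOn.stronglyMeasurableAtFilter isOpen_Ioi r hr
    · exact hkd.continuousOn.continuousAt (isOpen_Ioi.mem_nhds hr)
  refine ⟨fun r => ∫ s in R₀..r, k s, ?_, hd⟩
  rw [show (2 : WithTop ℕ∞) = 1 + 1 by norm_num, contDiffOn_succ_iff_deriv_of_isOpen isOpen_Ioi]
  refine ⟨fun r hr => (hd r hr).differentiableAt.differentiableWithinAt, by simp, ?_⟩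
  exact hkd.congr fun r hr => (hd r hr).deriv

lemma exists_bound_deriv_smoothTransition :
    ∃ B, 0 ≤ B ∧ ∀ x, |deriv Real.smoothTransition x| ≤ B := by
  have hc : Continuous (deriv Real.smoothTransition) :=
    (Real.smoothTransition.contDiff (n := 1)).continuous_deriv le_rfl
  obtain ⟨B, hB⟩ := (isCompact_Icc (a := (0 : ℝ)) (b := 1)).exists_bound_of_continuousOn
    hc.continuousOn
  refine ⟨max B 0, le_max_right _ _, fun x => ?_⟩
  by_cases hx : x ∈ Icc (0 : ℝ) 1
  · exact (hB x hx).trans (le_max_left _ _)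
  · rw [deriv_smoothTransition_eq_zero, abs_zero]
    · exact le_max_right _ _
    · by_contra! h
      exact hx ⟨h.1.le, h.2.le⟩

lemma radialCutoff_mem_Icc (c : ℂ) (r₁ r₂ : ℝ) (z : ℂ) : radialCutoff c r₁ r₂ z ∈ Icc (0 : ℝ) 1 :=
  ⟨Real.smoothTransition.nonneg _, Real.smoothTransition.le_one _⟩

lemma abs_fderiv_radialCutoff_le {B : ℝ} (hB : ∀ x, |deriv Real.smoothTransition x| ≤ B) {c : ℂ}
    {r₁ r₂ : ℝ} (h1 : 0 ≤ r₁) (h12 : r₁ < r₂) (z v : ℂ) (hv : ‖v‖ = 1) :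
    |fderiv ℝ (radialCutoff c r₁ r₂) z v| ≤ B * (2 * r₂ / (r₂ ^ 2 - r₁ ^ 2)) := by
  have h3 : 0 < r₂ ^ 2 - r₁ ^ 2 := sub_pos.2 (by gcongr)
  have hB0 : 0 ≤ B := (abs_nonneg _).trans (hB 0)
  have hr2 : 0 ≤ r₂ := h1.trans h12.le
  rcases le_or_gt r₂ ‖z - c‖ with h | h
  · rw [fderiv_radialCutoff_eq_zero h1 h12 (Or.inr h), zero_apply, abs_zero]
    positivity
  · rw [fderiv_radialCutoff, abs_mul, abs_mul, mul_assoc]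
    refine mul_le_mul (hB _) ?_ (by positivity) hB0
    rw [abs_div, abs_of_pos h3, abs_neg, abs_two, mul_comm 2 r₂, mul_div_assoc, mul_comm]
    refine mul_le_mul ((abs_real_inner_le_norm _ _).trans ?_) le_rfl (by positivity) hr2
    rw [hv, mul_one]
    exact h.le

/-- Stream functions of radial vortex fields can be made constant near the boundary components of
a perforated disc, with an error of bounded energy. -/
theorem exists_streamFunction (m : ℕ) : ∃ C : ℝ, 0 ≤ C ∧ ∀ (R R₀ : ℝ) (pt : Fin m → ℂ) (T : ℝ → ℝ),
    0 < R₀ → R₀ ≤ R / 4 → (∀ i j, i ≠ j → 4 * R₀ ≤ ‖pt i - pt j‖) → (∀ i, ‖pt i‖ ≤ R / 2) →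
    ContDiffOn ℝ 2 T (Ioi 0) → (∀ r, 0 ≤ T r ∧ T r ≤ 1) → ∀ j, ∃ (h : ℂ → ℝ) (c : Fin m → ℝ) (c₀ : ℝ),
      ContDiff ℝ 2 h ∧ (∀ k z, ‖z - pt k‖ < R₀ + R₀ / 4 → h z = c k) ∧
      (∀ z, R - R₀ / 4 < ‖z‖ → h z = c₀) ∧
      ∀ z ∈ perforatedDisc R R₀ pt,
        ‖((1 - T (‖z - pt j‖ / R₀) : ℝ) : ℂ) * (z - pt j)⁻¹ - streamField h z‖ ^ 2 ≤
          C * (∑ k, (if ‖z - pt k‖ ≤ 2 * R₀ then 1 / R₀ ^ 2 else 0) + 1 / R ^ 2) := by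
  obtain ⟨B, hB0, hB⟩ := exists_bound_deriv_smoothTransition
  set A : ℝ := 40 * (B + 1) with hA
  refine ⟨8 * A ^ 2 * (m + 1), by positivity, ?_⟩
  intro R R₀ pt T hR₀ hR hsep hpt hT hT01 j
  have hR0 : 0 < R := by linarith
  obtain ⟨H, hH2, hHd⟩ := exists_primitive hT hR₀
  have hk1 : ∀ r > 0, |(1 - T (r / R₀)) * r⁻¹| ≤ r⁻¹ := by
    intro r hr
    rw [abs_mul, abs_of_nonneg (sub_nonneg.2 (hT01 _).2), abs_of_pos (inv_pos.2 hr)]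
    exact mul_le_of_le_one_left (inv_pos.2 hr).le (by linarith [(hT01 (r / R₀)).1])
  have hLip : ∀ ρ > 0, ∀ x y, ρ ≤ x → ρ ≤ y → |H x - H y| ≤ ρ⁻¹ * |x - y| := by
    intro ρ hρ x y hx hy
    exact (convex_Ici ρ).norm_image_sub_le_of_norm_hasDerivWithin_le
      (fun r (hr : ρ ≤ r) => (hHd r (hρ.trans_le hr)).hasDerivWithinAt)
      (fun r (hr : ρ ≤ r) => (hk1 r (hρ.trans_le hr)).trans (inv_anti₀ hρ hr)) hy hx
  set f : ℂ → ℝ := fun z => H ‖z - pt j‖ with hf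
  have hfd2 : ∀ z, z ≠ pt j → ContDiffAt ℝ 2 f z := by
    intro z hz
    have hs : z - pt j ≠ 0 := sub_ne_zero.2 hz
    have h1 : ContDiffAt ℝ 2 (fun z : ℂ => ‖z - pt j‖) z :=
      (contDiffAt_id.sub contDiffAt_const).norm ℝ hs
    exact (hH2.contDiffAt (isOpen_Ioi.mem_nhds (norm_pos_iff.2 hs))).comp z h1
  have hfd : ∀ z, z ≠ pt j → HasFDerivAt f (((1 - T (‖z - pt j‖ / R₀)) * ‖z - pt j‖⁻¹) •
      (‖z - pt j‖⁻¹ • innerSL ℝ (z - pt j))) z := fun z hz =>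
    (hHd _ (norm_pos_iff.2 (sub_ne_zero.2 hz))).comp_hasFDerivAt z (hasFDerivAt_norm_sub hz)
  have hfv : ∀ z v, z ≠ pt j → ‖v‖ = 1 → |fderiv ℝ f z v| ≤ ‖z - pt j‖⁻¹ := by
    intro z v hz hv
    have hn : 0 < ‖z - pt j‖ := norm_pos_iff.2 (sub_ne_zero.2 hz)
    rw [(hfd z hz).fderiv, smul_apply, smul_eq_mul, abs_mul]
    refine (mul_le_mul (hk1 _ hn) ?_ (abs_nonneg _) (inv_pos.2 hn).le).trans (mul_one _).le
    rw [smul_apply, innerSL_apply_apply, smul_eq_mul, abs_mul, abs_inv, abs_norm,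
      inv_mul_le_iff₀ hn, mul_one]
    have := abs_real_inner_le_norm (z - pt j) v
    rwa [hv, mul_one] at this
  -- H is Lipschitz with constant 1/R₀ only on [R₀, ∞); the maximum matters for k = j, where the
  -- distance is 0.
  set c : Fin m → ℝ := fun k => H (max R₀ ‖pt k - pt j‖) with hc
  set c₀ : ℝ := H R with hc₀
  -- The inner transitions lie within 2R₀ of their centres, away from the other holes. Discs of
  -- radius 5R₀/4 about the centres stay in |z| ≤ 13R/16 < 27R/32, and R - R₀/4 ≥ 15R/16, so the
  -- outer transition lies in between.
  set χ : Fin m → ℂ → ℝ := fun k => radialCutoff (pt k) (5 / 4 * R₀) (7 / 4 * R₀) with hχ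
  set ω : ℂ → ℝ := radialCutoff 0 (27 / 32 * R) (15 / 16 * R) with hω
  have hχ1 : 0 ≤ 5 / 4 * R₀ := by positivity
  have hχ12 : 5 / 4 * R₀ < 7 / 4 * R₀ := by linarith
  have hω1 : 0 ≤ 27 / 32 * R := by positivity
  have hω12 : 27 / 32 * R < 15 / 16 * R := by linarith
  have hχd : ∀ k, ContDiff ℝ 2 (χ k) := fun k => contDiff_radialCutoff
  have hωd : ContDiff ℝ 2 ω := contDiff_radialCutoff
  set h : ℂ → ℝ := fun z =>
    f z - (∑ k, χ k z * (f z - c k) + (1 - ω z) * (f z - c₀)) with hh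
  have hhc : ∀ k z, ‖z - pt k‖ < R₀ + R₀ / 4 → h z = c k := by
    intro k z hz
    have e0 : ∀ i, i ≠ k → χ i z = 0 := by
      intro i hi
      apply radialCutoff_eq_zero hχ1 hχ12
      have h3 := hsep k i hi.symm
      have h4 := norm_sub_le (z - pt i) (z - pt k)
      rw [show z - pt i - (z - pt k) = pt k - pt i by ring] at h4
      linarith
    have e1 : χ k z = 1 := radialCutoff_eq_one hχ1 hχ12 (by linarith)
    have e2 : ω z = 1 := by
      apply radialCutoff_eq_one hω1 hω12
      have := norm_sub_norm_le z (pt k)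
      rw [sub_zero]
      linarith [hpt k]
    simp only [hh]
    rw [Finset.sum_eq_single k (fun i _ hi => by rw [e0 i hi, zero_mul])
      (fun hk => absurd (Finset.mem_univ k) hk), e1, e2]
    ring
  have hhc₀ : ∀ z, R - R₀ / 4 < ‖z‖ → h z = c₀ := by
    intro z hz
    have e0 : ∀ i, χ i z = 0 := by
      intro i
      apply radialCutoff_eq_zero hχ1 hχ12
      have := norm_sub_norm_le z (pt i)
      linarith [hpt i]
    have e2 : ω z = 0 := by
      apply radialCutoff_eq_zero hω1 hω12
      rw [sub_zero]
      linarith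
    simp [hh, e0, e2]
  refine ⟨h, c, c₀, ?_, hhc, hhc₀, ?_⟩
  · rw [contDiff_iff_contDiffAt]
    intro z
    -- H is singular at the centre, but h is constant near it.
    by_cases hz : z = pt j
    · have : h =ᶠ[𝓝 z] fun _ => c j := by
        have hcn : Continuous fun z : ℂ => ‖z - pt j‖ := by fun_prop
        filter_upwards [(isOpen_lt hcn continuous_const).mem_nhds
          (show ‖z - pt j‖ < R₀ + R₀ / 4 by rw [hz, sub_self, norm_zero]; positivity)] with y hy
        exact hhc j y hy
      exact contDiffAt_const.congr_of_eventuallyEq this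
    · have hfz := hfd2 z hz
      exact hfz.sub ((ContDiffAt.sum fun k _ => (hχd k).contDiffAt.mul
        (hfz.sub contDiffAt_const)).add ((contDiffAt_const.sub hωd.contDiffAt).mul
          (hfz.sub contDiffAt_const)))
  · intro z hzΩ
    obtain ⟨hzR, hzj⟩ := mem_perforatedDisc.1 hzΩ
    have hz : z ≠ pt j := fun h => by
      have := hzj j
      rw [h, sub_self, norm_zero] at this
      linarith
    have hfz := (hfd z hz).differentiableAt.hasFDerivAt
    have hsum : HasFDerivAt (fun z => ∑ k, χ k z * (f z - c k) + (1 - ω z) * (f z - c₀))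
        (∑ k, (χ k z • fderiv ℝ f z + (f z - c k) • fderiv ℝ (χ k) z) +
          ((1 - ω z) • fderiv ℝ f z + (f z - c₀) • -fderiv ℝ ω z)) z := by
      refine (HasFDerivAt.fun_sum fun k _ => ?_).add ?_
      · exact ((hχd k).differentiable two_ne_zero z).hasFDerivAt.mul (hfz.sub_const (c k))
      · exact ((hωd.differentiable two_ne_zero z).hasFDerivAt.const_sub 1).mul (hfz.sub_const c₀)
    set L : ℂ →L[ℝ] ℝ := ∑ k, (χ k z • fderiv ℝ f z + (f z - c k) • fderiv ℝ (χ k) z) +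
          ((1 - ω z) • fderiv ℝ f z + (f z - c₀) • -fderiv ℝ ω z) with hL
    have hhL : fderiv ℝ h z = fderiv ℝ f z - L := (hfz.sub hsum).fderiv
    have hX : ((1 - T (‖z - pt j‖ / R₀) : ℝ) : ℂ) * (z - pt j)⁻¹ - streamField h z =
        ⟨L 1, -L Complex.I⟩ := by
      have hs : ‖z - pt j‖ ≠ 0 := norm_ne_zero_iff.2 (sub_ne_zero.2 hz)
      unfold streamField
      rw [hhL, (hfd z hz).fderiv]
      apply Complex.ext
      · simp only [Complex.sub_re, Complex.re_ofReal_mul, Complex.inv_re, sub_apply, smul_apply,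
          innerSL_apply_apply, smul_eq_mul, Complex.normSq_eq_norm_sq, Complex.inner]
        simp
        field_simp
        ring
      · simp only [Complex.sub_im, Complex.im_ofReal_mul, Complex.inv_im, sub_apply, smul_apply,
          innerSL_apply_apply, smul_eq_mul, Complex.normSq_eq_norm_sq, Complex.inner]
        simp
        field_simp
        ring
    set ind : Fin m → ℝ := fun k => if ‖z - pt k‖ ≤ 2 * R₀ then 1 / R₀ else 0 with hind
    have hLv : ∀ v : ℂ, ‖v‖ = 1 → |L v| ≤ A * (∑ k, ind k + 1 / R) := by
      intro v hv
      have hrj : (‖z - pt j‖)⁻¹ ≤ 1 / R₀ := by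
        rw [inv_eq_one_div]; exact one_div_le_one_div_of_le hR₀ (hzj j).le
      -- Near a hole f differs from its constant by O(1) and all gradients are O(1/R₀), on an area
      -- O(R₀²). This energy is bounded independently of R/R₀; the outer transition is the same at
      -- scale R.
      have hterm : ∀ k, |χ k z * fderiv ℝ f z v + (f z - c k) * fderiv ℝ (χ k) z v| ≤ A * ind k := by
        intro k
        rcases le_or_gt (7 / 4 * R₀) ‖z - pt k‖ with hk | hk
        · rw [show χ k z = 0 from radialCutoff_eq_zero hχ1 hχ12 hk,
            show fderiv ℝ (χ k) z = 0 from fderiv_radialCutoff_eq_zero hχ1 hχ12 (Or.inr hk)]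
          simp only [zero_mul, zero_apply, mul_zero, add_zero, abs_zero, hind]
          split_ifs <;> positivity
        · have hi : ind k = 1 / R₀ := if_pos (by linarith)
          have hχm := radialCutoff_mem_Icc (pt k) (5 / 4 * R₀) (7 / 4 * R₀) z
          have b1 : |χ k z * fderiv ℝ f z v| ≤ 1 * (1 / R₀) := by
            rw [abs_mul, abs_of_nonneg hχm.1]
            exact mul_le_mul hχm.2 ((hfv z v hz hv).trans hrj) (abs_nonneg _) zero_le_one
          have b2 : |f z - c k| ≤ 2 := by
            have h1 := hLip R₀ hR₀ ‖z - pt j‖ (max R₀ ‖pt k - pt j‖) (hzj j).le (le_max_left _ _)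
            have h2 : |‖z - pt j‖ - max R₀ ‖pt k - pt j‖| ≤ 2 * R₀ := by
              have h3 : |max R₀ ‖z - pt j‖ - max R₀ ‖pt k - pt j‖| ≤
                  |‖z - pt j‖ - ‖pt k - pt j‖| := by
                simpa only [max_comm] using abs_max_sub_max_le_abs ‖z - pt j‖ ‖pt k - pt j‖ R₀
              rw [max_eq_right (hzj j).le] at h3
              have h4 := abs_norm_sub_norm_le (z - pt j) (pt k - pt j)
              rw [show z - pt j - (pt k - pt j) = z - pt k by ring] at h4
              linarith
            calc |f z - c k| ≤ R₀⁻¹ * |‖z - pt j‖ - max R₀ ‖pt k - pt j‖| := h1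
              _ ≤ R₀⁻¹ * (2 * R₀) := by gcongr
              _ = 2 := by field_simp
          have b3 : |fderiv ℝ (χ k) z v| ≤ B * (3 / R₀) := by
            refine (abs_fderiv_radialCutoff_le hB hχ1 hχ12 z v hv).trans
              (mul_le_mul_of_nonneg_left ?_ hB0)
            rw [show (7 / 4 * R₀) ^ 2 - (5 / 4 * R₀) ^ 2 = 3 / 2 * R₀ ^ 2 by ring,
              div_le_div_iff₀ (by positivity) hR₀]
            nlinarith [sq_nonneg R₀]
          calc |χ k z * fderiv ℝ f z v + (f z - c k) * fderiv ℝ (χ k) z v|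
              ≤ |χ k z * fderiv ℝ f z v| + |(f z - c k) * fderiv ℝ (χ k) z v| := abs_add_le _ _
            _ ≤ 1 * (1 / R₀) + 2 * (B * (3 / R₀)) := by
              rw [abs_mul (f z - c k)]
              gcongr
            _ ≤ A * ind k := by
              rw [hi, hA]
              have : 0 < 1 / R₀ := by positivity
              have e : B * (3 / R₀) = 3 * (B * (1 / R₀)) := by ring
              have : 0 ≤ B * (1 / R₀) := by positivity
              rw [e]
              nlinarith
      have hlast : |(1 - ω z) * fderiv ℝ f z v + (f z - c₀) * -fderiv ℝ ω z v| ≤ A * (1 / R) := by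
        rcases le_or_gt ‖z‖ (27 / 32 * R) with hk | hk
        · have hk' : ‖z - 0‖ ≤ 27 / 32 * R := by rwa [sub_zero]
          rw [show ω z = 1 from radialCutoff_eq_one hω1 hω12 hk',
            show fderiv ℝ ω z = 0 from fderiv_radialCutoff_eq_zero hω1 hω12 (Or.inl hk')]
          simp only [sub_self, zero_mul, zero_apply, neg_zero, mul_zero, add_zero, abs_zero]
          positivity
        · have hωm := radialCutoff_mem_Icc 0 (27 / 32 * R) (15 / 16 * R) z
          have hlow : R / 3 ≤ ‖z - pt j‖ := by
            have := norm_sub_norm_le z (pt j)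
            linarith [hpt j]
          have hup : ‖z - pt j‖ ≤ 3 / 2 * R := by
            have := norm_sub_le z (pt j)
            linarith [hpt j]
          have b1 : |(1 - ω z) * fderiv ℝ f z v| ≤ 1 * (3 * (1 / R)) := by
            rw [abs_mul, abs_of_nonneg (sub_nonneg.2 hωm.2)]
            refine mul_le_mul (by linarith [hωm.1]) ((hfv z v hz hv).trans ?_) (abs_nonneg _)
              zero_le_one
            rw [show 3 * (1 / R) = (R / 3)⁻¹ by field_simp]
            exact inv_anti₀ (by positivity) hlow
          have b2 : |f z - c₀| ≤ 3 := by
            have h1 := hLip (R / 3) (by positivity) ‖z - pt j‖ R hlow (by linarith)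
            have h2 : |‖z - pt j‖ - R| ≤ R := by
              rw [abs_le]
              constructor <;> linarith
            calc |f z - c₀| ≤ (R / 3)⁻¹ * |‖z - pt j‖ - R| := h1
              _ ≤ (R / 3)⁻¹ * R := by gcongr
              _ = 3 := by field_simp
          have b3 : |-fderiv ℝ ω z v| ≤ B * (12 * (1 / R)) := by
            rw [abs_neg]
            refine (abs_fderiv_radialCutoff_le hB hω1 hω12 z v hv).trans
              (mul_le_mul_of_nonneg_left ?_ hB0)
            rw [show (15 / 16 * R) ^ 2 - (27 / 32 * R) ^ 2 = 171 / 1024 * R ^ 2 by ring,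
              mul_one_div, div_le_div_iff₀ (by positivity) hR0]
            nlinarith [sq_nonneg R]
          calc |(1 - ω z) * fderiv ℝ f z v + (f z - c₀) * -fderiv ℝ ω z v|
              ≤ |(1 - ω z) * fderiv ℝ f z v| + |(f z - c₀) * -fderiv ℝ ω z v| := abs_add_le _ _
            _ ≤ 1 * (3 * (1 / R)) + 3 * (B * (12 * (1 / R))) := by
              rw [abs_mul (f z - c₀)]
              gcongr
            _ ≤ A * (1 / R) := by
              rw [hA]
              have : 0 < 1 / R := by positivity
              have : 0 ≤ B * (1 / R) := by positivity
              nlinarith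
      have hLeq : L v = ∑ k, (χ k z * fderiv ℝ f z v + (f z - c k) * fderiv ℝ (χ k) z v) +
          ((1 - ω z) * fderiv ℝ f z v + (f z - c₀) * -fderiv ℝ ω z v) := by
        simp [hL, sum_apply]
      rw [hLeq, mul_add, Finset.mul_sum]
      exact (abs_add_le _ _).trans (add_le_add ((Finset.abs_sum_le_sum_abs _ _).trans
        (Finset.sum_le_sum fun k _ => hterm k)) hlast)
    have hL1 := hLv 1 norm_one
    have hLI := hLv Complex.I Complex.norm_I
    rw [hX, Complex.sq_norm, Complex.normSq_apply]
    have hind2 : (∑ k, ind k) ^ 2 ≤ m * ∑ k, ind k ^ 2 := by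
      have := sq_sum_le_card_mul_sum_sq (s := Finset.univ) (f := ind)
      simpa using this
    have hsq : ∀ k, ind k ^ 2 = if ‖z - pt k‖ ≤ 2 * R₀ then 1 / R₀ ^ 2 else 0 := by
      intro k
      simp only [hind]
      split_ifs <;> simp
    simp_rw [← hsq]
    have hi0 : 0 ≤ ∑ k, ind k ^ 2 := Finset.sum_nonneg fun k _ => sq_nonneg _
    have hS0 : 0 ≤ A * (∑ k, ind k + 1 / R) := (abs_nonneg _).trans hL1
    have q1 : L 1 * L 1 ≤ (A * (∑ k, ind k + 1 / R)) ^ 2 := by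
      rw [← sq, ← sq_abs]; gcongr
    have q2 : L Complex.I * L Complex.I ≤ (A * (∑ k, ind k + 1 / R)) ^ 2 := by
      rw [← sq, ← sq_abs]; gcongr
    have q3 : (∑ k, ind k + 1 / R) ^ 2 ≤ 2 * (m + 1) * (∑ k, ind k ^ 2 + 1 / R ^ 2) := by
      have e : (1 / R) ^ 2 = 1 / R ^ 2 := by rw [one_div_pow]
      have hm : (0 : ℝ) ≤ m := Nat.cast_nonneg m
      have hR2 : 0 ≤ 1 / R ^ 2 := by positivity
      have := mul_nonneg hm hR2
      nlinarith [sq_nonneg (∑ k, ind k - 1 / R)]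
    rw [neg_mul_neg]
    rw [mul_pow] at q1 q2
    have q4 := mul_le_mul_of_nonneg_left q3 (sq_nonneg A)
    have q5 : 0 ≤ A ^ 2 * (m + 1) * (∑ k, ind k ^ 2 + 1 / R ^ 2) :=
      mul_nonneg (by positivity) (add_nonneg hi0 (by positivity))
    linarith

/-! ### The pointwise energy inequality. -/

/-- The gradient of the phase of `w`, in the convention of `streamField` rotated by a right angle. -/
noncomputable def phaseField (w : ℂ → ℂ) (z : ℂ) : ℂ :=
  ⟨(fderiv ℝ w z Complex.I / w z).im, (fderiv ℝ w z 1 / w z).im⟩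

lemma wedgeArg_eq_inner (h : ℂ → ℝ) (w : ℂ → ℂ) (z : ℂ) :
    wedgeArg h w z = inner ℝ (streamField h z) (phaseField w z) := by
  simp [wedgeArg, streamField, phaseField, Complex.inner]
  ring

lemma phaseField_canonicalMap {m : ℕ} {pt : Fin m → ℂ} {deg : Fin m → ℤ} {z : ℂ}
    (hz : ∀ j, z ≠ pt j) : phaseField (canonicalMap pt deg) z = vortexField pt deg z := by
  unfold phaseField
  rw [fderiv_canonicalMap_div_im hz, fderiv_canonicalMap_div_im hz]
  apply Complex.ext <;> simp

/-- Only the derivative of the modulus is discarded. -/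
lemma normSq_mul_phaseField_le (u : ℂ → ℂ) (z : ℂ) :
    ‖u z‖ ^ 2 * ‖phaseField u z‖ ^ 2 ≤ gradSq u z := by
  have key : ∀ x w : ℂ, ‖w‖ ^ 2 * ((x / w).im * (x / w).im) ≤ ‖x‖ ^ 2 := by
    intro x w
    rcases eq_or_ne w 0 with rfl | hw
    · simp
    · have h1 : |(x / w).im| ≤ ‖x‖ / ‖w‖ := by
        rw [← norm_div]; exact Complex.abs_im_le_norm _
      have h2 : 0 < ‖w‖ := norm_pos_iff.2 hw
      rw [le_div_iff₀ h2, mul_comm] at h1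
      rw [← sq, ← sq_abs (x / w).im, ← mul_pow]
      gcongr
  rw [Complex.sq_norm (phaseField u z), Complex.normSq_apply, mul_add, gradSq, add_comm]
  exact add_le_add (key _ _) (key _ _)

lemma sq_sum_eq_diag_add {m : ℕ} (x : Fin m → ℝ) :
    (∑ i, x i) ^ 2 = ∑ i, x i ^ 2 + ∑ i, ∑ j ∈ Finset.univ.erase i, x i * x j := by
  rw [sq, Finset.sum_mul_sum, ← Finset.sum_add_distrib]
  refine Finset.sum_congr rfl fun i _ => ?_
  rw [← Finset.add_sum_erase _ _ (Finset.mem_univ i), sq]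

/-- Pointwise lower bound for the energy density of the phase. -/
lemma pointwise_energy_bound {m : ℕ} {a t q : ℝ} (ha : 0 < a) (ht0 : 0 ≤ t) (hta : t ≤ 1 - a ^ 2)
    (D : Fin m → ℝ) (E X : Fin m → ℂ) (T : Fin m → ℝ) (G : ℂ)
    (hX : ∀ j, ‖((1 - T j : ℝ) : ℂ) * E j - X j‖ ^ 2 ≤ q) :
    ‖∑ j, (D j : ℂ) * E j‖ ^ 2 + 2 * ∑ j, D j * inner ℝ (X j) G
      - ∑ j, D j ^ 2 * (‖E j‖ ^ 2 * (t + 2 * m / a ^ 2 * (t - T j) ^ 2))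
      - (1 - a ^ 2) * ∑ i, ∑ j ∈ Finset.univ.erase i, |D i| * |D j| * (‖E i‖ * ‖E j‖)
      - 2 * m / a ^ 2 * (∑ j, D j ^ 2) * q ≤
    (1 - t) * ‖∑ j, (D j : ℂ) * E j + G‖ ^ 2 := by
  set F : ℂ := ∑ j, (D j : ℂ) * E j with hF
  set S : ℂ := ∑ j, (D j : ℂ) * (((1 - t : ℝ) : ℂ) * E j - X j) with hS
  -- The X_j part integrates to zero later; S carries the differences t - T_j and the cutoff errors.
  have hFG : (1 - t) * inner ℝ F G = ∑ j, D j * inner ℝ (X j) G + inner ℝ S G := by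
    have h1 : ∀ (x : ℝ) (y : ℂ), (x : ℂ) * y = x • y := fun x y => (Complex.real_smul).symm
    have h2 : (1 - t) • F = ∑ j, D j • X j + S := by
      rw [hF, hS, Finset.smul_sum, ← Finset.sum_add_distrib]
      refine Finset.sum_congr rfl fun j _ => ?_
      simp only [Complex.real_smul]
      push_cast
      ring
    rw [← real_inner_smul_left, h2, inner_add_left, sum_inner]
    simp_rw [real_inner_smul_left]
  -- Young's inequality, with the weight that uses up exactly the available a²|G|².
  have hSG : -(a ^ 2 * ‖G‖ ^ 2) - ‖S‖ ^ 2 / a ^ 2 ≤ 2 * inner ℝ S G := by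
    have h1 := (abs_le.1 (abs_real_inner_le_norm S G)).1
    have h2 := two_mul_le_add_sq (a * ‖G‖) (‖S‖ / a)
    have h3 : a * ‖G‖ * (‖S‖ / a) = ‖S‖ * ‖G‖ := by field_simp
    rw [mul_assoc, h3, mul_pow, div_pow] at h2
    linarith
  have hS2 : ‖S‖ ^ 2 ≤ m * ∑ j, D j ^ 2 * (2 * ((t - T j) ^ 2 * ‖E j‖ ^ 2 + q)) := by
    have h1 : ‖S‖ ≤ ∑ j, |D j| * ‖((1 - t : ℝ) : ℂ) * E j - X j‖ := by
      refine (norm_sum_le _ _).trans (Finset.sum_le_sum fun j _ => ?_)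
      rw [norm_mul, Complex.norm_real, Real.norm_eq_abs]
    have h2 := sq_sum_le_card_mul_sum_sq (s := Finset.univ)
      (f := fun j => |D j| * ‖((1 - t : ℝ) : ℂ) * E j - X j‖)
    rw [Finset.card_univ, Fintype.card_fin] at h2
    refine (pow_le_pow_left₀ (norm_nonneg _) h1 2).trans (h2.trans ?_)
    gcongr with j _
    rw [mul_pow, sq_abs]
    gcongr
    have h3 : ((1 - t : ℝ) : ℂ) * E j - X j =
        ((T j - t : ℝ) : ℂ) * E j + (((1 - T j : ℝ) : ℂ) * E j - X j) := by
      push_cast; ring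
    have h4 := norm_add_le (((T j - t : ℝ) : ℂ) * E j) (((1 - T j : ℝ) : ℂ) * E j - X j)
    rw [← h3] at h4
    have h5 : ‖((T j - t : ℝ) : ℂ) * E j‖ ^ 2 = (t - T j) ^ 2 * ‖E j‖ ^ 2 := by
      rw [norm_mul, mul_pow, Complex.norm_real, Real.norm_eq_abs, sq_abs]; ring
    have h6 := pow_le_pow_left₀ (norm_nonneg _) h4 2
    have h7 := add_sq_le (a := ‖((T j - t : ℝ) : ℂ) * E j‖) (b := ‖((1 - T j : ℝ) : ℂ) * E j - X j‖)
    have h8 := hX j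
    linarith
  have hF2 : ‖F‖ ^ 2 ≤ ∑ j, D j ^ 2 * ‖E j‖ ^ 2 +
      ∑ i, ∑ j ∈ Finset.univ.erase i, |D i| * |D j| * (‖E i‖ * ‖E j‖) := by
    have h1 : ‖F‖ ≤ ∑ j, |D j| * ‖E j‖ := by
      refine (norm_sum_le _ _).trans (Finset.sum_le_sum fun j _ => ?_)
      rw [norm_mul, Complex.norm_real, Real.norm_eq_abs]
    refine (pow_le_pow_left₀ (norm_nonneg _) h1 2).trans (le_of_eq ?_)
    rw [sq_sum_eq_diag_add]
    congr 1
    · simp_rw [mul_pow, sq_abs]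
    · refine Finset.sum_congr rfl fun i _ => Finset.sum_congr rfl fun j _ => ?_
      ring
  have hcross : 0 ≤ ∑ i, ∑ j ∈ Finset.univ.erase i, |D i| * |D j| * (‖E i‖ * ‖E j‖) :=
    Finset.sum_nonneg fun i _ => Finset.sum_nonneg fun j _ => by positivity
  -- The crude bound t ≤ 1 - a² is spent only off the diagonal; the diagonal keeps t for comparison
  -- with the profile.
  have hcross2 := mul_le_mul_of_nonneg_right hta hcross
  have htF := mul_le_mul_of_nonneg_left hF2 ht0
  have hGn : a ^ 2 * ‖G‖ ^ 2 ≤ (1 - t) * ‖G‖ ^ 2 := by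
    gcongr
    linarith
  have hS3 : ‖S‖ ^ 2 / a ^ 2 ≤ 2 * m / a ^ 2 * ∑ j, D j ^ 2 * ((t - T j) ^ 2 * ‖E j‖ ^ 2) +
      2 * m / a ^ 2 * (∑ j, D j ^ 2) * q := by
    have e : m * ∑ j, D j ^ 2 * (2 * ((t - T j) ^ 2 * ‖E j‖ ^ 2 + q)) =
        2 * m * (∑ j, D j ^ 2 * ((t - T j) ^ 2 * ‖E j‖ ^ 2)) + 2 * m * (∑ j, D j ^ 2) * q := by
      rw [mul_assoc (2 * (m : ℝ)), Finset.sum_mul, ← mul_add, ← Finset.sum_add_distrib,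
        Finset.mul_sum, Finset.mul_sum]
      refine Finset.sum_congr rfl fun j _ => ?_
      ring
    rw [e] at hS2
    calc ‖S‖ ^ 2 / a ^ 2 ≤ _ / a ^ 2 := div_le_div_of_nonneg_right hS2 (sq_nonneg a)
      _ = _ := by ring
  have hdiag : ∑ j, D j ^ 2 * (‖E j‖ ^ 2 * (t + 2 * m / a ^ 2 * (t - T j) ^ 2)) =
      t * ∑ j, D j ^ 2 * ‖E j‖ ^ 2 +
        2 * m / a ^ 2 * ∑ j, D j ^ 2 * ((t - T j) ^ 2 * ‖E j‖ ^ 2) := by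
    rw [Finset.mul_sum, Finset.mul_sum, ← Finset.sum_add_distrib]
    refine Finset.sum_congr rfl fun j _ => ?_
    ring
  rw [norm_add_sq_real, mul_add, mul_add, hdiag]
  linarith

/-! ### Geometry and integrability on the perforated disc. -/

section perforatedDisc

variable {m : ℕ} {R R₀ : ℝ} {pt : Fin m → ℂ}

lemma annulus_subset_perforatedDisc (hR : R₀ ≤ R / 4)
    (hsep : ∀ i j, i ≠ j → 4 * R₀ ≤ ‖pt i - pt j‖) (hpt : ∀ i, ‖pt i‖ ≤ R / 2) (k : Fin m) {z : ℂ}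
    (h1 : R₀ < ‖z - pt k‖) (h2 : ‖z - pt k‖ < 2 * R₀) : z ∈ perforatedDisc R R₀ pt := by
  refine mem_perforatedDisc.2 ⟨?_, fun j => ?_⟩
  · have := norm_sub_norm_le z (pt k)
    linarith [hpt k]
  · rcases eq_or_ne j k with rfl | hj
    · exact h1
    · have h3 := hsep k j hj.symm
      have h4 := norm_sub_le (z - pt j) (z - pt k)
      rw [show z - pt j - (z - pt k) = pt k - pt j by ring] at h4
      linarith

/-- Boundary points of a hole are limits of their outward dilations from its centre; this makes
continuity on the closure usable on the degree circle. -/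
lemma annulus_subset_closure_perforatedDisc (hR₀ : 0 < R₀) (hR : R₀ ≤ R / 4)
    (hsep : ∀ i j, i ≠ j → 4 * R₀ ≤ ‖pt i - pt j‖) (hpt : ∀ i, ‖pt i‖ ≤ R / 2) (k : Fin m) {z : ℂ}
    (h1 : R₀ ≤ ‖z - pt k‖) (h2 : ‖z - pt k‖ < 2 * R₀) : z ∈ closure (perforatedDisc R R₀ pt) := by
  have ht : Tendsto (fun s : ℝ => pt k + s • (z - pt k)) (𝓝[>] 1) (𝓝 z) := by
    have : ContinuousAt (fun s : ℝ => pt k + s • (z - pt k)) 1 := by fun_prop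
    have h := this.tendsto
    simp only [one_smul, add_sub_cancel] at h
    exact h.mono_left nhdsWithin_le_nhds
  have hn : 0 < ‖z - pt k‖ := hR₀.trans_le h1
  refine mem_closure_of_tendsto ht ?_
  filter_upwards [Ioo_mem_nhdsGT (show (1 : ℝ) < 2 * R₀ / ‖z - pt k‖ by rwa [one_lt_div hn])] with s hs
  have hns : ‖pt k + s • (z - pt k) - pt k‖ = s * ‖z - pt k‖ := by
    rw [add_sub_cancel_left, norm_smul, Real.norm_eq_abs, abs_of_pos (by linarith [hs.1])]
  refine annulus_subset_perforatedDisc hR hsep hpt k ?_ ?_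
  · rw [hns]
    nlinarith [hs.1]
  · rw [hns]
    exact (lt_div_iff₀ hn).1 hs.2

/-- Maps with the degrees `dₖ` have the circulations of the canonical map. -/
lemma exists_circulation_eq (hR₀ : 0 < R₀) (hR : R₀ ≤ R / 4)
    (hsep : ∀ i j, i ≠ j → 4 * R₀ ≤ ‖pt i - pt j‖) (hpt : ∀ i, ‖pt i‖ ≤ R / 2) {deg : Fin m → ℤ}
    {u : ℂ → ℂ} (hu : ContDiffOn ℝ 1 u (perforatedDisc R R₀ pt))
    (huc : ContinuousOn u (closure (perforatedDisc R R₀ pt)))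
    (hu0 : ∀ z ∈ perforatedDisc R R₀ pt, u z ≠ 0)
    (hdeg : ∀ j, HasDegreeOnCircle u (pt j) R₀ (deg j)) (k : Fin m) :
    ∃ ε > 0, ∀ r ∈ Ioo R₀ (R₀ + ε), ∫ θ in -Real.pi..Real.pi,
      ((fderiv ℝ u (circleMap (pt k) r θ) (circleMap 0 r θ * Complex.I) /
          u (circleMap (pt k) r θ)).im -
        (fderiv ℝ (canonicalMap pt deg) (circleMap (pt k) r θ) (circleMap 0 r θ * Complex.I) /
          canonicalMap pt deg (circleMap (pt k) r θ)).im) = 0 := by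
  obtain ⟨ε, hε, hε1, h⟩ := exists_circle_integral_eq_degree (c := pt k) (r₁ := 2 * R₀) hR₀
    (by linarith)
    (huc.mono fun z hz => annulus_subset_closure_perforatedDisc hR₀ hR hsep hpt k hz.1 hz.2)
    (hu.mono fun z hz => annulus_subset_perforatedDisc hR hsep hpt k hz.1 hz.2)
    (fun z h1 h2 => hu0 z (annulus_subset_perforatedDisc hR hsep hpt k h1 h2)) (hdeg k)
  refine ⟨ε, hε, fun r hr => ?_⟩
  obtain ⟨hc1, hi1⟩ := h r hr
  obtain ⟨hc2, hi2⟩ := circle_integral_canonicalMap (deg := deg) hsep k (hR₀.trans hr.1)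
    (by linarith [hr.2])
  rw [intervalIntegral.integral_sub (hc1.intervalIntegrable _ _) (hc2.intervalIntegrable _ _),
    hi1, hi2, sub_self]

lemma volume_perforatedDisc_le : volume (perforatedDisc R R₀ pt) ≤ volume (Metric.ball (0 : ℂ) R) :=
  measure_mono sdiff_subset

lemma integrableOn_perforatedDisc_of_bound {f : ℂ → ℝ}
    (hf : AEStronglyMeasurable f (volume.restrict (perforatedDisc R R₀ pt))) (B : ℝ)
    (hB : ∀ z ∈ perforatedDisc R R₀ pt, |f z| ≤ B) : IntegrableOn f (perforatedDisc R R₀ pt) := by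
  have : IsFiniteMeasure (volume.restrict (perforatedDisc R R₀ pt)) :=
    isFiniteMeasure_restrict.2
      (ne_top_of_le_ne_top measure_ball_lt_top.ne volume_perforatedDisc_le)
  exact Integrable.of_bound hf B
    ((ae_restrict_iff' isOpen_perforatedDisc.measurableSet).2 (Eventually.of_forall hB))

/-- The point 7R/8 has distance at least 3R/8 > R₀ from every centre. -/
lemma nonempty_perforatedDisc (hR₀ : 0 < R₀) (hR : R₀ ≤ R / 4) (hpt : ∀ i, ‖pt i‖ ≤ R / 2) :
    (perforatedDisc R R₀ pt).Nonempty := by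
  have hR0 : 0 < R := by linarith
  have hn : ‖((7 / 8 * R : ℝ) : ℂ)‖ = 7 / 8 * R := by
    rw [Complex.norm_real, Real.norm_eq_abs, abs_of_pos (by positivity)]
  refine ⟨((7 / 8 * R : ℝ) : ℂ), mem_perforatedDisc.2 ⟨by rw [hn]; linarith, fun j => ?_⟩⟩
  have := norm_sub_norm_le ((7 / 8 * R : ℝ) : ℂ) (pt j)
  rw [hn] at this
  linarith [hpt j]

/-- The integral of the error of the stream functions. -/
lemma setIntegral_cutoff_error_le (hR₀ : 0 < R₀) (hR0 : 0 < R) :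
    IntegrableOn (fun z => ∑ k, (if ‖z - pt k‖ ≤ 2 * R₀ then 1 / R₀ ^ 2 else 0) + 1 / R ^ 2)
      (perforatedDisc R R₀ pt) ∧
    ∫ z in perforatedDisc R R₀ pt,
      (∑ k, (if ‖z - pt k‖ ≤ 2 * R₀ then 1 / R₀ ^ 2 else 0) + 1 / R ^ 2) ≤
        4 * Real.pi * m + Real.pi := by
  have hind : ∀ k, (fun z : ℂ => if ‖z - pt k‖ ≤ 2 * R₀ then 1 / R₀ ^ 2 else 0) =
      (Metric.closedBall (pt k) (2 * R₀)).indicator fun _ => 1 / R₀ ^ 2 := by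
    intro k
    ext z
    simp [indicator, dist_eq_norm]
  have hI : ∀ k, Integrable fun z : ℂ => if ‖z - pt k‖ ≤ 2 * R₀ then 1 / R₀ ^ 2 else 0 := by
    intro k
    rw [hind, integrable_indicator_iff Metric.isClosed_closedBall.measurableSet]
    exact integrableOn_const (measure_closedBall_lt_top.ne)
  have hv : ∀ k, ∫ z in perforatedDisc R R₀ pt,
      (if ‖z - pt k‖ ≤ 2 * R₀ then 1 / R₀ ^ 2 else 0) ≤ 4 * Real.pi := by
    intro k
    refine (setIntegral_le_integral (hI k) (Eventually.of_forall fun z => ?_)).trans ?_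
    · dsimp only
      split_ifs
      · positivity
      · exact le_rfl
    · rw [hind, integral_indicator Metric.isClosed_closedBall.measurableSet, setIntegral_const,
        Measure.real, Complex.volume_closedBall, smul_eq_mul]
      simp
      rw [ENNReal.toReal_ofReal (by positivity)]
      field_simp
      norm_num
  have hc : IntegrableOn (fun _ : ℂ => 1 / R ^ 2) (perforatedDisc R R₀ pt) :=
    integrableOn_perforatedDisc_of_bound aestronglyMeasurable_const _ fun z _ => le_rfl
  have hcv : ∫ _z in perforatedDisc R R₀ pt, 1 / R ^ 2 ≤ Real.pi := by
    have h1 : ∫ _z in perforatedDisc R R₀ pt, 1 / R ^ 2 ≤ ∫ _z in Metric.ball (0 : ℂ) R, 1 / R ^ 2 :=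
      setIntegral_mono_set (integrableOn_const measure_ball_lt_top.ne)
        (Eventually.of_forall fun z => by dsimp only [Pi.zero_apply]; positivity)
        (Eventually.of_forall fun z hz => hz.1)
    refine h1.trans (le_of_eq ?_)
    rw [setIntegral_const, Measure.real, Complex.volume_ball, smul_eq_mul]
    simp
    rw [ENNReal.toReal_ofReal hR0.le]
    field_simp
  have hs := integrable_finsetSum (μ := volume.restrict (perforatedDisc R R₀ pt)) Finset.univ
    fun k _ => (hI k).integrableOn
  refine ⟨hs.add hc, ?_⟩
  rw [integral_add hs hc, integral_finsetSum _ fun k _ => (hI k).integrableOn]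
  refine add_le_add ?_ hcv
  refine (Finset.sum_le_sum fun k _ => hv k).trans (le_of_eq ?_)
  simp
  ring

end perforatedDisc

/-- Discarding the negative part of f only increases the right side, so minorants of variable sign
are allowed. -/
lemma ofReal_integral_le_lintegral_ofReal {μ : Measure ℂ} {f : ℂ → ℝ} (hf : Integrable f μ) :
    ENNReal.ofReal (∫ z, f z ∂μ) ≤ ∫⁻ z, ENNReal.ofReal (f z) ∂μ := by
  rw [integral_eq_lintegral_pos_part_sub_lintegral_neg_part hf]
  exact (ENNReal.ofReal_le_ofReal (sub_le_self _ ENNReal.toReal_nonneg)).trans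
    ENNReal.ofReal_toReal_le

/-- Rescaled radial integral of a profile. -/
lemma setIntegral_profile_le {R R₀ I : ℝ} (hR₀ : 0 < R₀) (hR : R₀ ≤ R / 4) {g : ℝ → ℝ}
    (hg : ContinuousOn g (Ioi 0)) (hg0 : ∀ r ∈ Icc 1 (2 * (R / R₀)), 0 ≤ g r)
    (hgI : ∫ r in (1 : ℝ)..2 * (R / R₀), g r / r ≤ I) {c : ℂ} {s : Set ℂ}
    (hs : s ⊆ (fun z => ‖z - c‖) ⁻¹' Ioc R₀ (2 * R)) :
    IntegrableOn (fun z => g (‖z - c‖ / R₀) / ‖z - c‖ ^ 2) s ∧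
      ∫ z in s, g (‖z - c‖ / R₀) / ‖z - c‖ ^ 2 ≤ 2 * Real.pi * I := by
  have h12 : R₀ ≤ 2 * R := by linarith
  have hcont : ContinuousOn (fun r => r * (g (r / R₀) / r ^ 2)) (uIcc R₀ (2 * R)) := by
    rw [uIcc_of_le h12]
    have hpos : ∀ r ∈ Icc R₀ (2 * R), 0 < r := fun r hr => hR₀.trans_le hr.1
    refine continuousOn_id.mul (ContinuousOn.div ?_ (continuousOn_id.pow 2)
      fun r hr => pow_ne_zero 2 (hpos r hr).ne')
    exact hg.comp (continuous_id.div_const R₀).continuousOn fun r hr => div_pos (hpos r hr) hR₀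
  have hnn : ∀ r ∈ Ioc R₀ (2 * R), 0 ≤ g (r / R₀) / r ^ 2 := fun r hr => by
    refine div_nonneg (hg0 _ ⟨?_, ?_⟩) (sq_nonneg r)
    · rw [one_le_div hR₀]; exact hr.1.le
    · rw [← mul_div_assoc]; exact div_le_div_of_nonneg_right hr.2 hR₀.le
  obtain ⟨h1, h2⟩ := setIntegral_radial_le c hR₀.le h12 hcont.intervalIntegrable hnn hs
  refine ⟨h1, h2.trans ?_⟩
  have e : ∫ r in R₀..2 * R, r * (g (r / R₀) / r ^ 2) = ∫ r in (1 : ℝ)..2 * (R / R₀), g r / r := by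
    have h3 := intervalIntegral.integral_comp_div (a := R₀) (b := 2 * R) (fun r => g r / r) hR₀.ne'
    rw [div_self hR₀.ne', mul_div_assoc] at h3
    rw [← mul_right_inj' hR₀.ne', ← smul_eq_mul R₀ (∫ r in (1 : ℝ)..2 * (R / R₀), g r / r), ← h3,
      ← intervalIntegral.integral_const_mul]
    refine intervalIntegral.integral_congr fun r hr => ?_
    rw [uIcc_of_le h12] at hr
    have : r ≠ 0 := (hR₀.trans_le hr.1).ne'
    field_simp
  rw [e]
  gcongr

/-! ### Integration of the energy bound. -/

section energy

variable {m : ℕ} {R R₀ : ℝ} {pt : Fin m → ℂ}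

lemma norm_inv_sub_le (hR₀ : 0 < R₀) {z : ℂ} (hz : z ∈ perforatedDisc R R₀ pt) (j : Fin m) :
    ‖(z - pt j)⁻¹‖ ≤ R₀⁻¹ := by
  rw [norm_inv]
  exact inv_anti₀ hR₀ ((mem_perforatedDisc.1 hz).2 j).le

lemma measurable_vortexField {deg : Fin m → ℤ} : Measurable (vortexField pt deg) := by
  unfold vortexField
  fun_prop

lemma integrableOn_sq_norm_vortexField (hR₀ : 0 < R₀) {deg : Fin m → ℤ} :
    IntegrableOn (fun z => ‖vortexField pt deg z‖ ^ 2) (perforatedDisc R R₀ pt) := by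
  apply integrableOn_perforatedDisc_of_bound
    (measurable_vortexField.norm.pow_const 2).aestronglyMeasurable ((∑ j, ‖(deg j : ℂ)‖ * R₀⁻¹) ^ 2)
  intro z hz
  rw [abs_of_nonneg (sq_nonneg _)]
  gcongr
  refine (norm_sum_le _ _).trans (Finset.sum_le_sum fun j _ => ?_)
  rw [norm_mul]
  gcongr
  exact norm_inv_sub_le hR₀ hz j

lemma integrableOn_cross (hR₀ : 0 < R₀) (i j : Fin m) :
    IntegrableOn (fun z => ‖(z - pt i)⁻¹‖ * ‖(z - pt j)⁻¹‖) (perforatedDisc R R₀ pt) := by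
  apply integrableOn_perforatedDisc_of_bound
    (Measurable.aestronglyMeasurable (by fun_prop)) (R₀⁻¹ * R₀⁻¹)
  intro z hz
  rw [abs_of_nonneg (by positivity)]
  exact mul_le_mul (norm_inv_sub_le hR₀ hz i) (norm_inv_sub_le hR₀ hz j) (norm_nonneg _)
    (inv_nonneg.2 hR₀.le)

lemma setIntegral_cross_le (hR₀ : 0 < R₀) (hpt : ∀ i, ‖pt i‖ ≤ R / 2)
    (hsep : ∀ i j, i ≠ j → 4 * R₀ ≤ ‖pt i - pt j‖) {i j : Fin m} (hij : i ≠ j) :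
    ∫ z in perforatedDisc R R₀ pt, ‖(z - pt i)⁻¹‖ * ‖(z - pt j)⁻¹‖ ≤
      2 * Real.pi * Real.log (R / ‖pt i - pt j‖) + 12 * Real.pi := by
  simp_rw [norm_inv]
  have hne : ∀ z ∈ perforatedDisc R R₀ pt, ∀ k, z ≠ pt k := by
    intro z hz k h
    have := (mem_perforatedDisc.1 hz).2 k
    rw [h, sub_self, norm_zero] at this
    linarith
  apply setIntegral_inv_norm_mul_inv_norm_le
  · intro h
    have := hsep i j hij
    rw [h, sub_self, norm_zero] at this
    linarith
  · have := norm_sub_le (pt i) (pt j)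
    linarith [hpt i, hpt j]
  · exact isOpen_perforatedDisc.measurableSet
  · intro z hz
    refine ⟨hne z hz i, hne z hz j, ?_⟩
    have h1 := norm_sub_le z (pt i)
    have h2 := (mem_perforatedDisc.1 hz).1
    have h3 := norm_nonneg z
    linarith [hpt i]

lemma integrableOn_potential {J : ℝ → ℝ} (hJ : Continuous J) {u : ℂ → ℂ}
    (hu : ContinuousOn u (perforatedDisc R R₀ pt)) (hu1 : ∀ z ∈ perforatedDisc R R₀ pt, ‖u z‖ ≤ 1) :
    IntegrableOn (fun z => J (1 - ‖u z‖ ^ 2)) (perforatedDisc R R₀ pt) := by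
  obtain ⟨B, hB⟩ := (isCompact_Icc (a := (0 : ℝ)) (b := 1)).exists_bound_of_continuousOn
    hJ.continuousOn
  apply integrableOn_perforatedDisc_of_bound _ B
  · intro z hz
    have h1 := pow_le_one₀ (n := 2) (norm_nonneg (u z)) (hu1 z hz)
    exact hB _ ⟨by linarith, by linarith [sq_nonneg ‖u z‖]⟩
  · exact (hJ.comp_continuousOn (continuousOn_const.sub (hu.norm.pow 2))).aestronglyMeasurable
      isOpen_perforatedDisc.measurableSet

lemma abs_deg_le {deg : Fin m → ℤ} {d : ℕ} (hd : ∑ j, (deg j).natAbs = d) (i : Fin m) :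
    |(deg i : ℝ)| ≤ d := by
  have h1 : (deg i).natAbs ≤ d := by
    rw [← hd]
    exact Finset.single_le_sum (f := fun j => (deg j).natAbs) (fun _ _ => Nat.zero_le _)
      (Finset.mem_univ i)
  have h2 : ((deg i).natAbs : ℝ) = |(deg i : ℝ)| := by
    rw [Nat.cast_natAbs, Int.cast_abs]
  rw [← h2]
  exact_mod_cast h1

/-- An integrable lower bound for the energy density, with the value of its integral estimated in
terms of `vortexI`. -/
theorem exists_integrable_minorant {J : ℝ → ℝ} (hJ : IsPotential J) {a : ℝ} (ha : 0 < a) (K : ℝ)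
    (m d : ℕ) : ∃ C : ℝ, ∀ (R R₀ : ℝ) (pt : Fin m → ℂ) (deg : Fin m → ℤ) (u : ℂ → ℂ),
      0 < R₀ → R₀ ≤ R / 4 →
      (∀ i j, i ≠ j → 4 * R₀ ≤ ‖pt i - pt j‖) →
      (∀ i, ‖pt i‖ ≤ R / 2) →
      ContDiffOn ℝ 1 u (perforatedDisc R R₀ pt) →
      ContinuousOn u (closure (perforatedDisc R R₀ pt)) →
      (∀ z ∈ perforatedDisc R R₀ pt, a ≤ ‖u z‖ ∧ ‖u z‖ ≤ 1) →
      (∀ j, HasDegreeOnCircle u (pt j) R₀ (deg j)) →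
      (∑ j, (deg j).natAbs = d) →
      1 / R₀ ^ 2 * (∫ z in perforatedDisc R R₀ pt, J (1 - ‖u z‖ ^ 2)) ≤ K →
      ∃ L : ℂ → ℝ, IntegrableOn L (perforatedDisc R R₀ pt) ∧
        (∀ z ∈ perforatedDisc R R₀ pt, L z ≤ gradSq u z) ∧
        (∫ z in perforatedDisc R R₀ pt, ‖vortexField pt deg z‖ ^ 2)
            - 2 * Real.pi * (∑ i, (deg i : ℝ) ^ 2) * vortexI J (R / R₀) 1
            - 2 * Real.pi * (1 - a ^ 2) * (∑ i, ∑ j ∈ Finset.univ.erase i,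
                  |(deg i : ℝ)| * |(deg j : ℝ)| * Real.log (R / ‖pt i - pt j‖)) - C ≤
          ∫ z in perforatedDisc R R₀ pt, L z := by
  -- This M is the factor of (t - T_j)² in the pointwise bound: 1/a² from Young, m from
  -- Cauchy–Schwarz over the vortices, 2 from separating the cutoff error.
  obtain ⟨Λ, C₁, hΛ, hC₁, hprofile⟩ := exists_profile hJ (M := 2 * m / a ^ 2) (by positivity)
  obtain ⟨C₂, hC₂, hstream⟩ := exists_streamFunction m
  refine ⟨m * d ^ 2 * (2 * Real.pi * C₁ + Λ * max K 0) + m * m * d ^ 2 * (12 * Real.pi) +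
    2 * m / a ^ 2 * (m * d ^ 2) * (C₂ * (4 * Real.pi * m + Real.pi)), ?_⟩
  intro R R₀ pt deg u hR₀ hR hsep hpt hu huc hua hdeg hd hK
  have hR0 : 0 < R := by linarith
  set Ω := perforatedDisc R R₀ pt with hΩ
  have hne : ∀ z ∈ Ω, ∀ k, z ≠ pt k := by
    intro z hz k h
    have := (mem_perforatedDisc.1 hz).2 k
    rw [h, sub_self, norm_zero] at this
    linarith
  have hu0 : ∀ z ∈ Ω, u z ≠ 0 := fun z hz => norm_pos_iff.1 (ha.trans_le (hua z hz).1)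
  -- Not assumed: it follows from a ≤ |u| ≤ 1 at a point of the nonempty domain.
  have ha1 : a ^ 2 ≤ 1 := by
    obtain ⟨z, hz⟩ := nonempty_perforatedDisc hR₀ hR hpt
    exact pow_le_one₀ ha.le ((hua z hz).1.trans (hua z hz).2)
  have hRR : 1 ≤ R / R₀ := by rw [one_le_div hR₀]; linarith
  obtain ⟨T, g, hT, hT01, hTm, hgm, hgc, hg0, hTg, hgI⟩ := hprofile (R / R₀) hRR
  choose h c c₀ hh hhc hhc₀ hhX using hstream R R₀ pt T hR₀ hR hsep hpt hT hT01
  set q : ℂ → ℝ := fun z => C₂ * (∑ k, (if ‖z - pt k‖ ≤ 2 * R₀ then 1 / R₀ ^ 2 else 0) + 1 / R ^ 2)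
    with hq
  set v := canonicalMap pt deg with hv
  have hv1 : ContDiffOn ℝ 1 v Ω := fun z hz => (contDiffAt_canonicalMap (hne z hz)).contDiffWithinAt
  have hv0 : ∀ z ∈ Ω, v z ≠ 0 := fun z hz => canonicalMap_ne_zero (hne z hz)
  have hW : ∀ j, IntegrableOn (fun z => wedgeArg (h j) u z - wedgeArg (h j) v z) Ω ∧
      ∫ z in Ω, (wedgeArg (h j) u z - wedgeArg (h j) v z) = 0 := by
    intro j
    obtain ⟨h1, h2, h3⟩ := setIntegral_wedgeArg_sub_eq_zero hR₀ hR hsep hpt hu hv1 hu0 hv0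
      (exists_circulation_eq hR₀ hR hsep hpt hu huc hu0 hdeg) (hh j) (η := R₀ / 4) (by positivity)
      (hhc j) (hhc₀ j)
    exact ⟨h1.sub h2, h3⟩
  have hgrad : ∀ j, IntegrableOn (fun z => g (‖z - pt j‖ / R₀) / ‖z - pt j‖ ^ 2) Ω ∧
      ∫ z in Ω, g (‖z - pt j‖ / R₀) / ‖z - pt j‖ ^ 2 ≤
        2 * Real.pi * (vortexI J (R / R₀) 1 + C₁) := by
    intro j
    refine setIntegral_profile_le hR₀ hR hgc hg0 hgI fun z hz => ?_
    obtain ⟨h1, h2⟩ := mem_perforatedDisc.1 hz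
    refine ⟨h2 j, ?_⟩
    have := norm_sub_le z (pt j)
    dsimp only
    linarith [hpt j]
  have hJi := integrableOn_potential hJ.contDiff.continuous hu.continuousOn fun z hz => (hua z hz).2
  have hqi : IntegrableOn q Ω ∧ ∫ z in Ω, q z ≤ C₂ * (4 * Real.pi * m + Real.pi) := by
    obtain ⟨h1, h2⟩ := setIntegral_cutoff_error_le (pt := pt) hR₀ hR0
    refine ⟨h1.const_mul C₂, ?_⟩
    rw [hq, integral_const_mul]
    gcongr
  have hF2 := integrableOn_sq_norm_vortexField (R := R) (pt := pt) hR₀ (deg := deg)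
  -- the diagonal error
  set e₁ : ℂ → ℝ := fun z => ∑ j, (deg j : ℝ) ^ 2 * (g (‖z - pt j‖ / R₀) / ‖z - pt j‖ ^ 2 +
    Λ / R₀ ^ 2 * J (1 - ‖u z‖ ^ 2)) with he₁
  have he₁j : ∀ j, IntegrableOn (fun z => (deg j : ℝ) ^ 2 * (g (‖z - pt j‖ / R₀) / ‖z - pt j‖ ^ 2 +
      Λ / R₀ ^ 2 * J (1 - ‖u z‖ ^ 2))) Ω := fun j =>
    ((hgrad j).1.add (hJi.const_mul _)).const_mul _
  have he₁i : IntegrableOn e₁ Ω := integrable_finsetSum _ fun j _ => he₁j j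
  have hD : ∀ j, (deg j : ℝ) ^ 2 ≤ (d : ℝ) ^ 2 := fun j => by
    rw [← sq_abs]
    have := abs_deg_le hd j
    gcongr
  have hDsum : ∑ j, (deg j : ℝ) ^ 2 ≤ m * (d : ℝ) ^ 2 := by
    refine (Finset.sum_le_sum fun j _ => hD j).trans (le_of_eq ?_)
    simp
  have he₁v : ∫ z in Ω, e₁ z ≤ 2 * Real.pi * (∑ i, (deg i : ℝ) ^ 2) * vortexI J (R / R₀) 1 +
      m * d ^ 2 * (2 * Real.pi * C₁ + Λ * max K 0) := by
    have h1 : ∀ j, ∫ z in Ω, (deg j : ℝ) ^ 2 * (g (‖z - pt j‖ / R₀) / ‖z - pt j‖ ^ 2 +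
        Λ / R₀ ^ 2 * J (1 - ‖u z‖ ^ 2)) ≤ (deg j : ℝ) ^ 2 *
          (2 * Real.pi * (vortexI J (R / R₀) 1 + C₁) + Λ * max K 0) := by
      intro j
      rw [integral_const_mul, integral_add (hgrad j).1 (hJi.const_mul _), integral_const_mul]
      refine mul_le_mul_of_nonneg_left (add_le_add (hgrad j).2 ?_) (sq_nonneg _)
      rw [div_eq_mul_one_div, mul_assoc]
      exact mul_le_mul_of_nonneg_left (hK.trans (le_max_left _ _)) hΛ
    rw [he₁, integral_finsetSum _ fun j _ => he₁j j]
    refine (Finset.sum_le_sum fun j _ => h1 j).trans ?_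
    rw [← Finset.sum_mul]
    have h2 : 0 ≤ 2 * Real.pi * C₁ + Λ * max K 0 := by positivity
    have h3 := mul_le_mul_of_nonneg_right hDsum h2
    linarith
  -- the interaction error
  set e₂ : ℂ → ℝ := fun z => ∑ i, ∑ j ∈ Finset.univ.erase i,
    |(deg i : ℝ)| * |(deg j : ℝ)| * (‖(z - pt i)⁻¹‖ * ‖(z - pt j)⁻¹‖) with he₂
  have he₂i : IntegrableOn e₂ Ω := integrable_finsetSum _ fun i _ => integrable_finsetSum _
    fun j _ => (integrableOn_cross hR₀ i j).const_mul _
  have he₂v : ∫ z in Ω, e₂ z ≤ 2 * Real.pi * (∑ i, ∑ j ∈ Finset.univ.erase i,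
      |(deg i : ℝ)| * |(deg j : ℝ)| * Real.log (R / ‖pt i - pt j‖)) +
        m * m * d ^ 2 * (12 * Real.pi) := by
    rw [he₂, integral_finsetSum _ fun i _ => integrable_finsetSum _
      fun j _ => (integrableOn_cross hR₀ i j).const_mul _]
    have h1 : ∀ i, ∫ z in Ω, ∑ j ∈ Finset.univ.erase i,
        |(deg i : ℝ)| * |(deg j : ℝ)| * (‖(z - pt i)⁻¹‖ * ‖(z - pt j)⁻¹‖) ≤
        2 * Real.pi * (∑ j ∈ Finset.univ.erase i,
          |(deg i : ℝ)| * |(deg j : ℝ)| * Real.log (R / ‖pt i - pt j‖)) +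
          m * d ^ 2 * (12 * Real.pi) := by
      intro i
      rw [integral_finsetSum _ fun j _ => (integrableOn_cross hR₀ i j).const_mul _, Finset.mul_sum]
      have h2 : ∀ j ∈ Finset.univ.erase i, ∫ z in Ω,
          |(deg i : ℝ)| * |(deg j : ℝ)| * (‖(z - pt i)⁻¹‖ * ‖(z - pt j)⁻¹‖) ≤
          2 * Real.pi * (|(deg i : ℝ)| * |(deg j : ℝ)| * Real.log (R / ‖pt i - pt j‖)) +
            d ^ 2 * (12 * Real.pi) := by
        intro j hj
        rw [integral_const_mul]
        have h3 := setIntegral_cross_le hR₀ hpt hsep (Finset.ne_of_mem_erase hj).symm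
        have h4 : |(deg i : ℝ)| * |(deg j : ℝ)| ≤ d * d :=
          mul_le_mul (abs_deg_le hd i) (abs_deg_le hd j) (abs_nonneg _) (Nat.cast_nonneg d)
        have h5 := mul_le_mul_of_nonneg_left h3
          (mul_nonneg (abs_nonneg (deg i : ℝ)) (abs_nonneg (deg j : ℝ)))
        have h6 := mul_le_mul_of_nonneg_right h4 (show (0 : ℝ) ≤ 12 * Real.pi by positivity)
        linarith
      refine (Finset.sum_le_sum h2).trans ?_
      rw [Finset.sum_add_distrib]
      gcongr
      rw [Finset.sum_const, nsmul_eq_mul, mul_assoc]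
      gcongr
      refine (Finset.card_erase_le).trans (le_of_eq ?_)
      simp
    refine (Finset.sum_le_sum fun i _ => h1 i).trans (le_of_eq ?_)
    rw [Finset.sum_add_distrib, ← Finset.mul_sum]
    simp
    ring
  have hm0 : 0 ≤ 2 * (m : ℝ) / a ^ 2 := by positivity
  have hS0 : 0 ≤ ∑ j, (deg j : ℝ) ^ 2 := Finset.sum_nonneg fun j _ => sq_nonneg _
  set e₃ : ℂ → ℝ := fun z => 2 * m / a ^ 2 * (∑ j, (deg j : ℝ) ^ 2) * q z with he₃
  have he₃i : IntegrableOn e₃ Ω := hqi.1.const_mul _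
  have he₃v : ∫ z in Ω, e₃ z ≤
      2 * m / a ^ 2 * (m * d ^ 2) * (C₂ * (4 * Real.pi * m + Real.pi)) := by
    rw [he₃, integral_const_mul]
    refine (mul_le_mul_of_nonneg_left hqi.2 (mul_nonneg hm0 hS0)).trans ?_
    gcongr
  set w : ℂ → ℝ := fun z => 2 * ∑ j, (deg j : ℝ) * (wedgeArg (h j) u z - wedgeArg (h j) v z) with hw
  have hwi : IntegrableOn w Ω :=
    (integrable_finsetSum _ fun j _ => (hW j).1.const_mul _).const_mul 2
  have hwv : ∫ z in Ω, w z = 0 := by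
    rw [hw, integral_const_mul, integral_finsetSum _ fun j _ => (hW j).1.const_mul _]
    simp_rw [integral_const_mul, (hW _).2, mul_zero, Finset.sum_const_zero, mul_zero]
  refine ⟨fun z => ‖vortexField pt deg z‖ ^ 2 + w z - e₁ z - (1 - a ^ 2) * e₂ z - e₃ z,
    (((hF2.add hwi).sub he₁i).sub (he₂i.const_mul _)).sub he₃i, ?_, ?_⟩
  · intro z hz
    obtain ⟨hzR, hzj⟩ := mem_perforatedDisc.1 hz
    have hu1 : ‖u z‖ ^ 2 ≤ 1 := pow_le_one₀ (norm_nonneg _) (hua z hz).2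
    have hua2 : a ^ 2 ≤ ‖u z‖ ^ 2 := by
      have := (hua z hz).1
      gcongr
    set t := 1 - ‖u z‖ ^ 2 with ht
    have hpw := pointwise_energy_bound (m := m) (t := t) (q := q z) ha (by linarith) (by linarith)
      (fun j => (deg j : ℝ)) (fun j => (z - pt j)⁻¹) (fun j => streamField (h j) z)
      (fun j => T (‖z - pt j‖ / R₀)) (phaseField u z - vortexField pt deg z)
      (fun j => hhX j z hz)
    have hFe : ∑ j, (((deg j : ℝ)) : ℂ) * (z - pt j)⁻¹ = vortexField pt deg z := by
      simp [vortexField]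
    have hwe : w z = 2 * ∑ j, (deg j : ℝ) *
        inner ℝ (streamField (h j) z) (phaseField u z - vortexField pt deg z) := by
      simp only [hw, wedgeArg_eq_inner, inner_sub_right, hv, phaseField_canonicalMap (hne z hz)]
    have he₁z : ∑ j, (deg j : ℝ) ^ 2 * (‖(z - pt j)⁻¹‖ ^ 2 *
        (t + 2 * m / a ^ 2 * (t - T (‖z - pt j‖ / R₀)) ^ 2)) ≤ e₁ z := by
      refine Finset.sum_le_sum fun j _ => mul_le_mul_of_nonneg_left ?_ (sq_nonneg _)
      have hrj : 0 < ‖z - pt j‖ := hR₀.trans (hzj j)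
      -- With r = |z - a_j|/R₀ the factor |E_j|² turns Λ r² J(t) into Λ J(t)/R₀², which the bound K
      -- controls. The inequality |z - a_j| ≤ 3R/2 keeps r in the range of the profile.
      have h1 := hTg t ⟨by linarith, by linarith [sq_nonneg ‖u z‖]⟩ (‖z - pt j‖ / R₀)
        ⟨by rw [one_le_div hR₀]; exact (hzj j).le, by
          rw [← mul_div_assoc]
          have := norm_sub_le z (pt j)
          gcongr
          linarith [hpt j]⟩
      have h2 := mul_le_mul_of_nonneg_left h1 (sq_nonneg ‖(z - pt j)⁻¹‖)
      refine h2.trans (le_of_eq ?_)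
      rw [norm_inv, ← ht]
      field_simp
    rw [hFe, ← hwe, add_sub_cancel] at hpw
    have hgr := normSq_mul_phaseField_le u z
    rw [show ‖u z‖ ^ 2 = 1 - t by rw [ht]; ring] at hgr
    dsimp only
    linarith
  · have i1 := integral_sub (((hF2.add hwi).sub he₁i).sub (he₂i.const_mul (1 - a ^ 2))) he₃i
    have i2 := integral_sub ((hF2.add hwi).sub he₁i) (he₂i.const_mul (1 - a ^ 2))
    have i3 := integral_sub (hF2.add hwi) he₁i
    have i4 := integral_add hF2 hwi
    simp only [Pi.sub_apply, Pi.add_apply] at i1 i2 i3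
    rw [i1, i2, i3, i4, hwv, integral_const_mul]
    have h1a : 0 ≤ 1 - a ^ 2 := by linarith
    have h2 := mul_le_mul_of_nonneg_left he₂v h1a
    have h3 : (1 - a ^ 2) * (m * m * d ^ 2 * (12 * Real.pi)) ≤ m * m * d ^ 2 * (12 * Real.pi) :=
      mul_le_of_le_one_left (by positivity) (by linarith [sq_nonneg a])
    linarith

end energy

end GinzburgLandau

/-! ### The weighted lower bound. -/

theorem mainTheorem2 (J : ℝ → ℝ) (hJ : GinzburgLandau.IsPotential J)
    (p₀ a K : ℝ) (hp₀ : 0 < p₀) (ha : 0 < a) (m d : ℕ) :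
    ∃ C : ℝ, ∀ (R R₀ : ℝ) (pt : Fin m → ℂ) (deg : Fin m → ℤ) (u : ℂ → ℂ) (p : ℂ → ℝ),
      0 < R₀ → R₀ ≤ R / 4 →
      (∀ i j, i ≠ j → 4 * R₀ ≤ ‖pt i - pt j‖) →
      (∀ i, ‖pt i‖ ≤ R / 2) →
      ContDiffOn ℝ 1 u (GinzburgLandau.perforatedDisc R R₀ pt) →
      ContinuousOn u (closure (GinzburgLandau.perforatedDisc R R₀ pt)) →
      (∀ z ∈ GinzburgLandau.perforatedDisc R R₀ pt, a ≤ ‖u z‖ ∧ ‖u z‖ ≤ 1) →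
      (∀ j, GinzburgLandau.HasDegreeOnCircle u (pt j) R₀ (deg j)) →
      (∑ j, (deg j).natAbs = d) →
      1 / R₀ ^ 2 * (∫ z in GinzburgLandau.perforatedDisc R R₀ pt, J (1 - ‖u z‖ ^ 2)) ≤ K →
      AEMeasurable p
        (MeasureTheory.volume.restrict (GinzburgLandau.perforatedDisc R R₀ pt)) →
      (∀ z ∈ GinzburgLandau.perforatedDisc R R₀ pt, p₀ ≤ p z) →
      MeasureTheory.IntegrableOn
          (GinzburgLandau.gradSq (GinzburgLandau.canonicalMap pt deg))
          (GinzburgLandau.perforatedDisc R R₀ pt) ∧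
        ENNReal.ofReal
            (p₀ * (∫ z in GinzburgLandau.perforatedDisc R R₀ pt,
                GinzburgLandau.gradSq (GinzburgLandau.canonicalMap pt deg) z)
              - 2 * Real.pi * p₀ * (∑ i, (deg i : ℝ) ^ 2) * GinzburgLandau.vortexI J (R / R₀) 1
              - 2 * Real.pi * (1 - a ^ 2) * p₀ *
                (∑ i, ∑ j ∈ Finset.univ.erase i,
                  |(deg i : ℝ)| * |(deg j : ℝ)| * Real.log (R / ‖pt i - pt j‖))
              - C)
          ≤ ∫⁻ z in GinzburgLandau.perforatedDisc R R₀ pt,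
              ENNReal.ofReal (p z * GinzburgLandau.gradSq u z) := by
  obtain ⟨C, hC⟩ := GinzburgLandau.exists_integrable_minorant hJ ha K m d
  refine ⟨p₀ * C, ?_⟩
  intro R R₀ pt deg u p hR₀ hR hsep hpt hu huc hua hdeg hd hK _ hp
  obtain ⟨L, hLi, hLle, hLint⟩ := hC R R₀ pt deg u hR₀ hR hsep hpt hu huc hua hdeg hd hK
  have hΩ := (GinzburgLandau.isOpen_perforatedDisc (R := R) (R₀ := R₀) (pt := pt)).measurableSet
  have hgrad : Set.EqOn (GinzburgLandau.gradSq (GinzburgLandau.canonicalMap pt deg))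
      (fun z => ‖GinzburgLandau.vortexField pt deg z‖ ^ 2)
      (GinzburgLandau.perforatedDisc R R₀ pt) := by
    intro z hz
    refine GinzburgLandau.gradSq_canonicalMap fun j h => ?_
    have := (GinzburgLandau.mem_perforatedDisc.1 hz).2 j
    rw [h, sub_self, norm_zero] at this
    linarith
  refine ⟨(MeasureTheory.integrableOn_congr_fun hgrad hΩ).2
    (GinzburgLandau.integrableOn_sq_norm_vortexField hR₀), ?_⟩
  rw [MeasureTheory.setIntegral_congr_fun hΩ hgrad]
  calc _ ≤ ENNReal.ofReal (∫ z in GinzburgLandau.perforatedDisc R R₀ pt, p₀ * L z) := by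
        rw [MeasureTheory.integral_const_mul]
        apply ENNReal.ofReal_le_ofReal
        have := mul_le_mul_of_nonneg_left hLint hp₀.le
        linarith
    _ ≤ ∫⁻ z in GinzburgLandau.perforatedDisc R R₀ pt, ENNReal.ofReal (p₀ * L z) :=
        GinzburgLandau.ofReal_integral_le_lintegral_ofReal (hLi.const_mul p₀)
    _ ≤ _ := by
        refine MeasureTheory.setLIntegral_mono' hΩ fun z hz => ENNReal.ofReal_le_ofReal ?_
        have h0 : 0 ≤ GinzburgLandau.gradSq u z := by
          unfold GinzburgLandau.gradSq
          positivity
        -- L may be negative, so it is first replaced by the nonnegative energy density and only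
        -- then p₀ by p.
        exact (mul_le_mul_of_nonneg_left (hLle z hz) hp₀.le).trans
          (mul_le_mul_of_nonneg_right (hp z hz) h0)
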